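/- Let $M$ be an oriented smooth surface, $\alpha : M \to \mathbb{R}^3$ an immersion of class $C^r$, $r \ge 6$, with unit normal field $N$, Gaussian curvature $\mathcal{K}$ and arithmetic mean curvature $\mathcal{H}$. A line of harmonic mean curvature is a regular curve in the region where $\mathcal{K} > 0$ and $\mathcal{H}^2 - \mathcal{K} \neq 0$ whose normal curvature is $\mathcal{K}/\mathcal{H}$; these lines form two transversal foliations, distinguished by the sign of the geodesic torsion. Let $c$ be a closed line of harmonic mean curvature, parametrized by arc length $s$ and of total length $L$, with unit tangent $T$, geodesic curvature $k_g = \langle T', N\wedge T\rangle$ and geodesic torsion $\tau_g = \langle (N\wedge T)', N\rangle$. Let $\Sigma$ be a cross-section to $c$ at $c(0)$, that is, the image of an injective $C^1$ map $\sigma : [-\delta,\delta] \to M$, $\delta>0$, with $\sigma(0)=c(0)$, such that $\sigma$ crosses $c$ transversally at $c(0)$ and meets $c$ nowhere else, and let $\pi$ be the Poincaré map of $c$ on $\Sigma$, expressed in the coordinate $v \mapsto \sigma(v)$: it sends a point of $\Sigma$ near $c(0)$ to the first return to $\Sigma$ of the leaf through it of the foliation that contains $c$, followed in the direction of $c$.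 Then either $\tau_g = \frac{\sqrt{\mathcal{K}}}{\mathcal{H}}\sqrt{\mathcal{H}^2-\mathcal{K}}$ along all of $c$ or $\tau_g = -\frac{\sqrt{\mathcal{K}}}{\mathcal{H}}\sqrt{\mathcal{H}^2-\mathcal{K}}$ along all of $c$; the map $\pi$ is defined near $0$, differentiable at $0$ with $\pi'(0) > 0$, and $$\ln \pi'(0) = \int_0^L \left[ \frac{\left(\mathcal{K}/\mathcal{H}\right)_v}{2\tau_g} + \frac{k_g}{\tau_g}\left(\mathcal{H} - \frac{\mathcal{K}}{\mathcal{H}}\right)\right] ds,$$ where the integrand is integrable over $[0,L]$ and $(\mathcal{K}/\mathcal{H})_v$ denotes the derivative of $\mathcal{K}/\mathcal{H}$ at $c(s)$ in the direction $N\wedge T$. -/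

import Mathlib

open scoped Manifold ContDiff Topology

noncomputable section

namespace HarmonicLines

/-- The parameter plane and the ambient Euclidean space. -/
abbrev E2 : Type := EuclideanSpace ℝ (Fin 2)

abbrev E3 : Type := EuclideanSpace ℝ (Fin 3)

/-- The vector product of oriented Euclidean 3-space. -/
def cross (a b : E3) : E3 := WithLp.toLp 2 (crossProduct (WithLp.ofLp a) (WithLp.ofLp b))

/-- The coordinate vectors of the parameter plane. -/
def basisVec (i : Fin 2) : E2 := EuclideanSpace.single i 1

section Surface

variable {M : Type*} [TopologicalSpace M] [ChartedSpace E2 M]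

/-- `N` is a continuous unit normal field along the immersion `α`; the choice of such a field is
the choice of an orientation of the immersed surface. -/
structure IsUnitNormal (α N : M → E3) : Prop where
  continuous : Continuous N
  norm_eq_one : ∀ p, ‖N p‖ = 1
  orthogonal : ∀ (p : M) (w : TangentSpace (𝓡 2) p),
    inner ℝ (N p) (mfderiv (𝓡 2) 𝓘(ℝ, E3) α p w : E3) = 0

/-- The map `α` written in the preferred chart at `p`. The tangent space at `p` is identified
with the parameter plane through this chart. -/
def localRep (α : M → E3) (p : M) : E2 → E3 := fun x => α ((extChartAt (𝓡 2) p).symm x)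

/-- The first fundamental form `⟨Dα, Dα⟩` at `p`. -/
def firstForm (α : M → E3) (p : M) (v w : E2) : ℝ :=
  inner ℝ (fderiv ℝ (localRep α p) (extChartAt (𝓡 2) p p) v)
    (fderiv ℝ (localRep α p) (extChartAt (𝓡 2) p p) w)

/-- The second fundamental form `⟨N, D²α⟩` at `p`. -/
def secondForm (α N : M → E3) (p : M) (v w : E2) : ℝ :=
  inner ℝ (N p) (fderiv ℝ (fderiv ℝ (localRep α p)) (extChartAt (𝓡 2) p p) v w)

/-- The normal curvature in the direction of a nonzero tangent vector. -/
def normalCurvature (α N : M → E3) (p : M) (w : E2) : ℝ :=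
  secondForm α N p w w / firstForm α p w w

/-- The area density `EG - F²` at `p`. -/
def areaSq (α : M → E3) (p : M) : ℝ :=
  firstForm α p (basisVec 0) (basisVec 0) * firstForm α p (basisVec 1) (basisVec 1)
    - firstForm α p (basisVec 0) (basisVec 1) ^ 2

/-- The Gaussian curvature `(eg - f²) / (EG - F²)`. -/
def gaussCurvature (α N : M → E3) (p : M) : ℝ :=
  (secondForm α N p (basisVec 0) (basisVec 0) * secondForm α N p (basisVec 1) (basisVec 1)
    - secondForm α N p (basisVec 0) (basisVec 1) ^ 2) / areaSq α p

/-- The arithmetic mean curvature `(Eg - 2Ff + Ge) / (2 (EG - F²))`. -/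
def meanCurvature (α N : M → E3) (p : M) : ℝ :=
  (firstForm α p (basisVec 0) (basisVec 0) * secondForm α N p (basisVec 1) (basisVec 1)
    - 2 * firstForm α p (basisVec 0) (basisVec 1) * secondForm α N p (basisVec 0) (basisVec 1)
    + firstForm α p (basisVec 1) (basisVec 1) * secondForm α N p (basisVec 0) (basisVec 0))
    / (2 * areaSq α p)

/-- The harmonic mean curvature `K / H`. -/
def harmonicCurvature (α N : M → E3) (p : M) : ℝ :=
  gaussCurvature α N p / meanCurvature α N p

/-- The tangent `T` of the image curve in 3-space. -/
def tangent (α : M → E3) (γ : ℝ → M) (t : ℝ) : E3 := deriv (fun u => α (γ u)) t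

/-- The conormal `N ∧ T` along the curve. -/
def conormal (α N : M → E3) (γ : ℝ → M) (t : ℝ) : E3 := cross (N (γ t)) (tangent α γ t)

/-- The geodesic curvature of a unit speed curve: the component of `T'` along `N ∧ T`. -/
def geodesicCurvature (α N : M → E3) (γ : ℝ → M) (t : ℝ) : ℝ :=
  inner ℝ (deriv (tangent α γ) t) (conormal α N γ t)

/-- The geodesic torsion of a unit speed curve: the component of `(N ∧ T)'` along `N`. -/
def geodesicTorsion (α N : M → E3) (γ : ℝ → M) (t : ℝ) : ℝ :=
  inner ℝ (deriv (conormal α N γ) t) (N (γ t))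

/-- The tangent vector of the surface that `Dα` maps to the conormal `N ∧ T`
(it exists and is unique when `α` is an immersion). -/
def conormalVector (α N : M → E3) (γ : ℝ → M) (t : ℝ) : TangentSpace (𝓡 2) (γ t) :=
  Function.invFun (fun w : TangentSpace (𝓡 2) (γ t) =>
    (mfderiv (𝓡 2) 𝓘(ℝ, E3) α (γ t) w : E3)) (conormal α N γ t)

/-- The derivative `(K / H)_v` of the harmonic mean curvature at `γ t` in the direction
`∂α/∂v = N ∧ T`. -/
def harmonicCurvatureDeriv (α N : M → E3) (γ : ℝ → M) (t : ℝ) : ℝ :=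
  (mfderiv (𝓡 2) 𝓘(ℝ, ℝ) (harmonicCurvature α N) (γ t) (conormalVector α N γ t) : ℝ)

/-- `γ`, restricted to the open set `U` of times, is a line of harmonic mean curvature
parametrized by arc length: a regular curve in the elliptic region, free of umbilic points, with
normal curvature `K / H`. -/
structure IsHarmonicLineOn (α N : M → E3) (γ : ℝ → M) (U : Set ℝ) : Prop where
  contMDiffOn : ContMDiffOn 𝓘(ℝ, ℝ) (𝓡 2) 1 γ U
  unit_speed : ∀ t ∈ U, ‖tangent α γ t‖ = 1
  elliptic : ∀ t ∈ U, 0 < gaussCurvature α N (γ t)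
  not_umbilic : ∀ t ∈ U, meanCurvature α N (γ t) ^ 2 - gaussCurvature α N (γ t) ≠ 0
  normalCurvature_eq : ∀ t ∈ U,
    normalCurvature α N (γ t) (mfderiv 𝓘(ℝ, ℝ) (𝓡 2) γ t (1 : ℝ)) = harmonicCurvature α N (γ t)

/-- `c` is a closed line of harmonic mean curvature, parametrized by arc length and of total
length `L` (run through exactly once in a period). -/
structure IsHarmonicCycle (α N : M → E3) (c : ℝ → M) (L : ℝ) : Prop where
  length_pos : 0 < L
  isHarmonicLine : IsHarmonicLineOn α N c Set.univ
  periodic : Function.Periodic c L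
  injOn : Set.InjOn c (Set.Ico 0 L)

/-- `σ`, restricted to `[-δ, δ]`, parametrizes a cross-section to the closed curve `c` at `c 0`:
a simple arc of class `C¹` that crosses `c` transversally at the parameter `0` and does not meet
`c` at any other parameter. -/
structure IsCrossSection (α : M → E3) (c σ : ℝ → M) (δ : ℝ) : Prop where
  pos : 0 < δ
  contMDiffOn : ContMDiffOn 𝓘(ℝ, ℝ) (𝓡 2) 1 σ (Set.Icc (-δ) δ)
  injOn : Set.InjOn σ (Set.Icc (-δ) δ)
  base : σ 0 = c 0
  transversal : LinearIndependent ℝ ![tangent α c 0, tangent α σ 0]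
  meets_once : ∀ v ∈ Set.Icc (-δ) δ, σ v ∈ Set.range c → v = 0

/-- The section point with coordinate `v` has first return with coordinate `w`: the line of
harmonic mean curvature through `σ v` that belongs to the same foliation as `c` (its geodesic
torsion has the sign of that of `c`), run through in the direction of `c`, meets the section
after time `0` for the first time at `σ w`. -/
def FirstReturn (α N : M → E3) (c σ : ℝ → M) (δ v w : ℝ) : Prop :=
  ∃ (γ : ℝ → M) (a b T : ℝ), a < 0 ∧ 0 < T ∧ T < b ∧
    IsHarmonicLineOn α N γ (Set.Ioo a b) ∧
    (∀ t ∈ Set.Ioo a b, 0 < geodesicTorsion α N γ t * geodesicTorsion α N c 0) ∧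
    0 < inner ℝ (tangent α γ 0) (tangent α c 0) ∧
    γ 0 = σ v ∧ γ T = σ w ∧ w ∈ Set.Icc (-δ) δ ∧
    ∀ t ∈ Set.Ioo 0 T, γ t ∉ σ '' Set.Icc (-δ) δ

/-- `P` is, near `0`, the Poincaré return map of `c` on the cross-section, in the coordinate of
the section. -/
def IsPoincareMap (α N : M → E3) (c σ : ℝ → M) (δ : ℝ) (P : ℝ → ℝ) : Prop :=
  ∀ᶠ v in 𝓝 (0 : ℝ), FirstReturn α N c σ δ v (P v)

/-- The function integrated along the cycle. -/
def returnIntegrand (α N : M → E3) (c : ℝ → M) (s : ℝ) : ℝ :=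
  harmonicCurvatureDeriv α N c s / (2 * geodesicTorsion α N c s)
    + geodesicCurvature α N c s / geodesicTorsion α N c s
      * (meanCurvature α N (c s) - harmonicCurvature α N (c s))

end Surface

end HarmonicLines

end

noncomputable section

namespace HarmonicLines

open Set Filter

/-! ### Linear algebra of oriented Euclidean 3-space -/

/-! Write h = K/H, B for the shape operator and V = N ∧ T. In an adapted frame a direction of normal
curvature h has geodesic torsion ±τ with (h − H)² + τ² = H² − K. Where K > 0 and H² ≠ K this τ never
vanishes, so its sign separates two line fields of class C¹ (`dirProj`, `dirField`). Along `c` the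
sign is constant by continuity, and so is the sign of H, which gives the formula for the torsion.

Near `c` the foliation is read in moving coordinates: y₁ and y₂ are the components of α(p) − α(c(t))
along T(t) and V(t). A leaf followed by arc length t becomes a solution of y' = F(t, y), with `c` as
the equilibrium 0. Let X be the unit field of the foliation. Differentiating ⟨BX, X⟩ = h along V and
⟨BT, V⟩ = τ along T, and eliminating the derivative of B by the Codazzi equation, one finds
2τ⟨∂X/∂v, V⟩ = h_v − τ' + 2k_g(H − h) (`tubeDir_fderiv`). The y₁-terms from X and from V' cancel, so
the linearized equation is y₂' = (ρ − τ'/(2τ)) y₂ with ρ the integrand of the theorem. The weight w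
= √|τ| exp(−∫ρ) therefore makes w y₂ constant to first order (`returnWeight_identity`). Over a
period √|τ| returns to its value, and π'(0) = w(0)/w(L) = exp ∫ρ.

In the regularity carried along here T' and V' are merely continuous in t, so F is Lipschitz in y
but smooth dependence of the flow on initial data is not invoked. Instead Grönwall's inequality
bounds an orbit starting at σ(v) by A|v|, and w y₂ changes along it by o(v)
(`tubeField_linear_estimate`, `exists_radius_conservation`). Transversality makes the section a
chart in which y₂ is D v to first order, D being the V-component of σ'(0) (`exists_isSectionChart`).
Combining these at both ends gives `hasDerivAt_return`. Existence of the return is an intermediate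
value argument, that it is the first one follows from a contraction estimate (`exists_returnOrbit`),
and uniqueness of solutions identifies every curve admitted by `FirstReturn` with the orbit
constructed (`eq_of_isHarmonicLineOn`). -/

theorem inner_E3 (a b : E3) : inner ℝ a b = a 0 * b 0 + a 1 * b 1 + a 2 * b 2 := by
  simp [PiLp.inner_apply, Fin.sum_univ_three]; ring

theorem cross_apply_zero (a b : E3) : cross a b 0 = a 1 * b 2 - a 2 * b 1 := by
  simp [cross, cross_apply]

theorem cross_apply_one (a b : E3) : cross a b 1 = a 2 * b 0 - a 0 * b 2 := by
  simp [cross, cross_apply]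

theorem cross_apply_two (a b : E3) : cross a b 2 = a 0 * b 1 - a 1 * b 0 := by
  simp [cross, cross_apply]

theorem ext_E3 {a b : E3} (h0 : a 0 = b 0) (h1 : a 1 = b 1) (h2 : a 2 = b 2) : a = b := by
  ext i; fin_cases i <;> assumption

/-- The vector product as a continuous bilinear map. -/
def crossL : E3 →L[ℝ] E3 →L[ℝ] E3 :=
  LinearMap.toContinuousBilinearMap (LinearMap.mk₂ ℝ cross
    (fun a b c => by apply ext_E3 <;> simp [cross_apply_zero, cross_apply_one, cross_apply_two] <;> ring)
    (fun a b c => by apply ext_E3 <;> simp [cross_apply_zero, cross_apply_one, cross_apply_two] <;> ring)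
    (fun a b c => by apply ext_E3 <;> simp [cross_apply_zero, cross_apply_one, cross_apply_two] <;> ring)
    (fun a b c => by apply ext_E3 <;> simp [cross_apply_zero, cross_apply_one, cross_apply_two] <;> ring))

theorem crossL_apply (a b : E3) : crossL a b = cross a b := rfl

theorem cross_add (a b c : E3) : cross a (b + c) = cross a b + cross a c :=
  (crossL a).map_add b c

theorem cross_smul (a : E3) (r : ℝ) (b : E3) : cross a (r • b) = r • cross a b :=
  (crossL a).map_smul r b

theorem inner_cross_left (a b : E3) : inner ℝ (cross a b) a = 0 := by
  simp only [inner_E3, cross_apply_zero, cross_apply_one, cross_apply_two]; ring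

theorem inner_cross_right (a b : E3) : inner ℝ (cross a b) b = 0 := by
  simp only [inner_E3, cross_apply_zero, cross_apply_one, cross_apply_two]; ring

theorem inner_cross_cross (a b : E3) :
    inner ℝ (cross a b) (cross a b) = inner ℝ a a * inner ℝ b b - inner ℝ a b ^ 2 := by
  simp only [inner_E3, cross_apply_zero, cross_apply_one, cross_apply_two]; ring

theorem inner_left_cross (n e : E3) : inner ℝ n (cross n e) = 0 := by
  rw [real_inner_comm]; exact inner_cross_left n e

theorem inner_right_cross (n e : E3) : inner ℝ e (cross n e) = 0 := by
  rw [real_inner_comm]; exact inner_cross_right n e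

theorem cross_cross_self (a b : E3) :
    cross a (cross a b) = inner ℝ a b • a - inner ℝ a a • b := by
  apply ext_E3 <;>
  simp only [inner_E3, cross_apply_zero, cross_apply_one, cross_apply_two, PiLp.sub_apply,
    PiLp.smul_apply, smul_eq_mul] <;> ring

/-- `n, e` are the normal and the first vector of an adapted orthonormal frame `e, n ∧ e, n`. -/
structure IsFrame (n e : E3) : Prop where
  norm_normal : ‖n‖ = 1
  norm_fst : ‖e‖ = 1
  inner_eq_zero : inner ℝ n e = 0

namespace IsFrame

variable {n e : E3} (h : IsFrame n e)
include h

theorem inner_nn : inner ℝ n n = 1 := by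
  rw [real_inner_self_eq_norm_sq, h.norm_normal]; norm_num

theorem inner_ee : inner ℝ e e = 1 := by
  rw [real_inner_self_eq_norm_sq, h.norm_fst]; norm_num

theorem inner_ff : inner ℝ (cross n e) (cross n e) = 1 := by
  rw [inner_cross_cross, h.inner_nn, h.inner_ee, h.inner_eq_zero]; norm_num

theorem norm_snd : ‖cross n e‖ = 1 := by
  have := h.inner_ff
  rw [real_inner_self_eq_norm_sq] at this
  nlinarith [norm_nonneg (cross n e)]

theorem inner_en : inner ℝ e n = 0 := by rw [real_inner_comm]; exact h.inner_eq_zero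

theorem cross_normal_snd : cross n (cross n e) = -e := by
  rw [cross_cross_self, h.inner_eq_zero, h.inner_nn]; simp

theorem expand (u : E3) :
    u = inner ℝ u e • e + inner ℝ u (cross n e) • cross n e + inner ℝ u n • n := by
  set f := cross n e with hf
  have ho : Orthonormal ℝ ![e, f, n] := by
    rw [orthonormal_iff_ite]
    intro i j
    fin_cases i <;> fin_cases j <;>
      simp [h.norm_fst, h.norm_normal, h.norm_snd, h.inner_eq_zero, h.inner_en, hf,
        inner_left_cross, inner_right_cross, inner_cross_left, inner_cross_right]
  let b := basisOfOrthonormalOfCardEqFinrank ho (by simp)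
  have hb : ⇑b = ![e, f, n] := coe_basisOfOrthonormalOfCardEqFinrank ho (by simp)
  let ob := b.toOrthonormalBasis (by rw [hb]; exact ho)
  have := ob.sum_repr' u
  have hob : ⇑ob = ![e, f, n] := by simp [ob, hb]
  rw [Fin.sum_univ_three, hob] at this
  simp only [Matrix.cons_val_zero, Matrix.cons_val_one, Matrix.cons_val] at this
  rw [real_inner_comm e u, real_inner_comm f u, real_inner_comm n u]
  exact this.symm

theorem inner_expand (u v : E3) :
    inner ℝ u v = inner ℝ u e * inner ℝ v e + inner ℝ u (cross n e) * inner ℝ v (cross n e)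
      + inner ℝ u n * inner ℝ v n := by
  conv_lhs => rw [h.expand u]
  simp only [inner_add_left, real_inner_smul_left]
  rw [real_inner_comm v e, real_inner_comm v (cross n e), real_inner_comm v n]

theorem ext {u v : E3} (h1 : inner ℝ u e = inner ℝ v e)
    (h2 : inner ℝ u (cross n e) = inner ℝ v (cross n e)) (h3 : inner ℝ u n = inner ℝ v n) :
    u = v := by
  rw [h.expand u, h.expand v, h1, h2, h3]

end IsFrame

/-- A shape operator on 3-space: a symmetric operator vanishing on the normal. -/
structure IsShape (B : E3 →L[ℝ] E3) (n : E3) : Prop where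
  symm : ∀ u v, inner ℝ (B u) v = inner ℝ u (B v)
  normal : B n = 0

/-! ### Shape operators in an adapted frame, and the projection to a direction -/

section Shape

variable {B : E3 →L[ℝ] E3} {n e : E3}

theorem IsShape.inner_normal (hB : IsShape B n) (u : E3) : inner ℝ (B u) n = 0 := by
  rw [hB.symm, hB.normal, inner_zero_right]

theorem IsShape.apply_fst (hB : IsShape B n) (h : IsFrame n e) :
    B e = inner ℝ (B e) e • e + inner ℝ (B e) (cross n e) • cross n e := by
  conv_lhs => rw [h.expand (B e), hB.inner_normal]
  simp

theorem IsShape.apply_snd (hB : IsShape B n) (h : IsFrame n e) :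
    B (cross n e) = inner ℝ (B e) (cross n e) • e
      + inner ℝ (B (cross n e)) (cross n e) • cross n e := by
  conv_lhs => rw [h.expand (B (cross n e)), hB.inner_normal, hB.symm, real_inner_comm]
  simp

/-- The determinant and the half trace of a shape operator in an arbitrary basis of the tangent
plane agree with those in an adapted orthonormal frame. -/
theorem IsShape.gauss_mean_eq (hB : IsShape B n) (h : IsFrame n e) {a b : E3}
    (ha : inner ℝ a n = 0) (hb : inner ℝ b n = 0)
    (hab : inner ℝ a a * inner ℝ b b - inner ℝ a b ^ 2 ≠ 0) :
    (inner ℝ (B a) a * inner ℝ (B b) b - inner ℝ (B a) b ^ 2)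
        / (inner ℝ a a * inner ℝ b b - inner ℝ a b ^ 2)
      = inner ℝ (B e) e * inner ℝ (B (cross n e)) (cross n e)
        - inner ℝ (B e) (cross n e) ^ 2 ∧
    (inner ℝ a a * inner ℝ (B b) b - 2 * inner ℝ a b * inner ℝ (B a) b
        + inner ℝ b b * inner ℝ (B a) a)
        / (2 * (inner ℝ a a * inner ℝ b b - inner ℝ a b ^ 2))
      = (inner ℝ (B e) e + inner ℝ (B (cross n e)) (cross n e)) / 2 := by
  -- In coordinates with respect to `e, n ∧ e` both forms become polynomials in the components of
  -- `a` and `b`, and the claim reduces to polynomial identities.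
  have key : ∀ u : E3, inner ℝ u n = 0 → ∀ v : E3, inner ℝ v n = 0 →
      inner ℝ (B u) v = inner ℝ u e * inner ℝ v e * inner ℝ (B e) e
        + (inner ℝ u e * inner ℝ v (cross n e) + inner ℝ u (cross n e) * inner ℝ v e)
          * inner ℝ (B e) (cross n e)
        + inner ℝ u (cross n e) * inner ℝ v (cross n e)
          * inner ℝ (B (cross n e)) (cross n e) := by
    intro u hu v hv
    have e1 : inner ℝ (B u) e = inner ℝ u e * inner ℝ (B e) e
        + inner ℝ u (cross n e) * inner ℝ (B e) (cross n e) := by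
      rw [hB.symm, h.inner_expand u (B e), hB.inner_normal]; ring
    have e2 : inner ℝ (B u) (cross n e) = inner ℝ u e * inner ℝ (B e) (cross n e)
        + inner ℝ u (cross n e) * inner ℝ (B (cross n e)) (cross n e) := by
      rw [hB.symm, h.inner_expand u (B (cross n e)), hB.inner_normal,
        hB.symm (cross n e) e, real_inner_comm (B e) (cross n e)]; ring
    rw [h.inner_expand (B u) v, e1, e2, hv]; ring
  have key2 : ∀ u : E3, inner ℝ u n = 0 → ∀ v : E3,
      inner ℝ u v = inner ℝ u e * inner ℝ v e + inner ℝ u (cross n e) * inner ℝ v (cross n e) := by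
    intro u hu v
    rw [h.inner_expand u v, hu]; ring
  rw [key2 a ha a, key2 b hb b, key2 a ha b] at hab ⊢
  rw [key a ha a ha, key b hb b hb, key a ha b hb]
  generalize inner ℝ a e = x0 at *
  generalize inner ℝ a (cross n e) = y0 at *
  generalize inner ℝ b e = x1 at *
  generalize inner ℝ b (cross n e) = y1 at *
  generalize inner ℝ (B e) e = p at *
  generalize inner ℝ (B e) (cross n e) = q at *
  generalize inner ℝ (B (cross n e)) (cross n e) = r at *
  constructor
  · rw [div_eq_iff hab]; ring
  · rw [div_eq_iff (by simpa using hab)]; ring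

/-- The orthogonal projection to the plane with unit normal `n`. -/
def tangentialPart (n : E3) : E3 →L[ℝ] E3 := -(crossL n).comp (crossL n)

theorem tangentialPart_apply {n : E3} (hn : ‖n‖ = 1) (u : E3) :
    tangentialPart n u = u - inner ℝ n u • n := by
  have : tangentialPart n u = -cross n (cross n u) := rfl
  rw [this, cross_cross_self, real_inner_self_eq_norm_sq, hn]
  module

/-- The traceless part of a shape operator. -/
def tracelessPart (B : E3 →L[ℝ] E3) (n : E3) (H : ℝ) : E3 →L[ℝ] E3 :=
  B - H • tangentialPart n

/-- The orthogonal projection to the tangent direction with normal curvature `h` and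
geodesic torsion `τ`, for a shape operator with half trace `H` and with `(h - H)² + τ² = D`. -/
def directionProj (B : E3 →L[ℝ] E3) (n : E3) (h H τ D : ℝ) : E3 →L[ℝ] E3 :=
  (1 / 2 : ℝ) • (tangentialPart n + D⁻¹ • ((h - H) • tracelessPart B n H
    - τ • (crossL n).comp (tracelessPart B n H)))

variable {h H τ D : ℝ}

/-- In the frame `e, n ∧ e` the traceless part has the matrix (m, q; q, −m), and `cross n` is the
quarter turn. The term with D⁻¹ is then (r₁, r₂; r₂, −r₁) with r₁ = D⁻¹((h − H)m + τq) and r₂ =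
D⁻¹((h − H)q − τm). For a reflection, half its sum with the identity is the projection to its axis.
No frame enters the definition, so the projection inherits the regularity of its data. -/
theorem directionProj_apply_of_frame (hB : IsShape B n) (he : IsFrame n e) (u : E3)
    {m q : ℝ} (hm : inner ℝ (B e) e = H + m) (hq : inner ℝ (B e) (cross n e) = q)
    (hm' : inner ℝ (B (cross n e)) (cross n e) = H - m) :
    directionProj B n h H τ D u =
      ((1 / 2) * (inner ℝ u e * (1 + D⁻¹ * ((h - H) * m + τ * q))
        + inner ℝ u (cross n e) * (D⁻¹ * ((h - H) * q - τ * m)))) • e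
      + ((1 / 2) * (inner ℝ u e * (D⁻¹ * ((h - H) * q - τ * m))
        + inner ℝ u (cross n e) * (1 - D⁻¹ * ((h - H) * m + τ * q)))) • cross n e := by
  have h1 := hB.apply_fst he
  have h2 := hB.apply_snd he
  rw [hm, hq] at h1
  rw [hm', hq] at h2
  have hu := he.expand u
  have hT : tangentialPart n u = inner ℝ u e • e + inner ℝ u (cross n e) • cross n e := by
    rw [tangentialPart_apply he.norm_normal, real_inner_comm]
    conv_lhs => rw [hu]
    simp only [inner_add_left, real_inner_smul_left, he.inner_en, he.inner_nn, inner_cross_left]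
    module
  have hB0 : tracelessPart B n H u = (inner ℝ u e * m + inner ℝ u (cross n e) * q) • e
      + (inner ℝ u e * q - inner ℝ u (cross n e) * m) • cross n e := by
    simp only [tracelessPart, sub_apply, smul_apply, hT]
    conv_lhs => enter [1]; rw [hu]
    simp only [map_add, map_smul, hB.normal]
    rw [h1, h2]
    module
  simp only [directionProj, smul_apply, add_apply,
    sub_apply, ContinuousLinearMap.comp_apply, hT, hB0, crossL_apply, cross_add,
    cross_smul, he.cross_normal_snd]
  module

/-- The projection to a known direction. -/
theorem directionProj_apply (hB : IsShape B n) (he : IsFrame n e)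
    (hh : inner ℝ (B e) e = h) (hτ : inner ℝ (B e) (cross n e) = τ)
    (hH : inner ℝ (B e) e + inner ℝ (B (cross n e)) (cross n e) = 2 * H)
    (hD : (h - H) ^ 2 + τ ^ 2 = D) (hD0 : D ≠ 0) (u : E3) :
    directionProj B n h H τ D u = inner ℝ u e • e := by
  rw [directionProj_apply_of_frame (m := h - H) (q := τ) hB he u (by rw [hh]; ring) hτ
    (by linarith)]
  have : D⁻¹ * ((h - H) * (h - H) + τ * τ) = 1 := by
    rw [← hD]; rw [← hD] at hD0; field_simp
  rw [this]
  have : (h - H) * τ - τ * (h - H) = 0 := by ring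
  rw [this]
  module

/-- The image of the projection consists of the tangent vectors with normal curvature `h` and
geodesic torsion `τ`. -/
theorem directionProj_spec (hB : IsShape B n) (he : IsFrame n e)
    (hH : inner ℝ (B e) e + inner ℝ (B (cross n e)) (cross n e) = 2 * H)
    (hK : inner ℝ (B e) e * inner ℝ (B (cross n e)) (cross n e)
      - inner ℝ (B e) (cross n e) ^ 2 = H ^ 2 - D)
    (hD : (h - H) ^ 2 + τ ^ 2 = D) (hD0 : D ≠ 0) (u : E3) :
    inner ℝ (directionProj B n h H τ D u) n = 0 ∧
    inner ℝ (B (directionProj B n h H τ D u)) (directionProj B n h H τ D u)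
      = h * inner ℝ (directionProj B n h H τ D u) (directionProj B n h H τ D u) ∧
    inner ℝ (B (directionProj B n h H τ D u)) (cross n (directionProj B n h H τ D u))
      = τ * inner ℝ (directionProj B n h H τ D u) (directionProj B n h H τ D u) := by
  obtain ⟨m, hm⟩ : ∃ m, inner ℝ (B e) e = H + m := ⟨inner ℝ (B e) e - H, by ring⟩
  have hm' : inner ℝ (B (cross n e)) (cross n e) = H - m := by linarith
  obtain ⟨q, hq⟩ : ∃ q, inner ℝ (B e) (cross n e) = q := ⟨_, rfl⟩
  have hmq : m ^ 2 + q ^ 2 = D := by rw [hm, hm', hq] at hK; linarith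
  rw [directionProj_apply_of_frame hB he u hm hq hm']
  have h1 := hB.apply_fst he
  have h2 := hB.apply_snd he
  rw [hm, hq] at h1
  rw [hm', hq] at h2
  set x := inner ℝ u e
  set y := inner ℝ u (cross n e)
  set r1 := D⁻¹ * ((h - H) * m + τ * q) with hr1
  set r2 := D⁻¹ * ((h - H) * q - τ * m) with hr2
  -- By `e3` the matrix (r₁, r₂; r₂, −r₁) is a reflection; `e1` and `e2` say that on its axis the
  -- traceless part has normal component h − H and torsion τ.
  have e1 : r1 * m + r2 * q = h - H := by
    rw [hr1, hr2]
    have : D⁻¹ * ((h - H) * m + τ * q) * m + D⁻¹ * ((h - H) * q - τ * m) * q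
      = D⁻¹ * (m ^ 2 + q ^ 2) * (h - H) := by ring
    rw [this, hmq, inv_mul_cancel₀ hD0, one_mul]
  have e2 : r1 * q - r2 * m = τ := by
    rw [hr1, hr2]
    have : D⁻¹ * ((h - H) * m + τ * q) * q - D⁻¹ * ((h - H) * q - τ * m) * m
      = D⁻¹ * (m ^ 2 + q ^ 2) * τ := by ring
    rw [this, hmq, inv_mul_cancel₀ hD0, one_mul]
  have e3 : r1 ^ 2 + r2 ^ 2 = 1 := by
    rw [hr1, hr2]
    have : (D⁻¹ * ((h - H) * m + τ * q)) ^ 2 + (D⁻¹ * ((h - H) * q - τ * m)) ^ 2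
      = D⁻¹ * (D⁻¹ * ((h - H) ^ 2 + τ ^ 2) * (m ^ 2 + q ^ 2)) := by ring
    rw [this, hmq, hD, inv_mul_cancel₀ hD0, one_mul, inv_mul_cancel₀ hD0]
  clear_value r1 r2
  simp only [map_add, map_smul, h1, h2, cross_add, cross_smul, he.cross_normal_snd,
    inner_add_left, inner_add_right, real_inner_smul_left, real_inner_smul_right,
    inner_neg_right, he.inner_ee, he.inner_ff, inner_right_cross, he.inner_en, inner_cross_left,
    inner_cross_right]
  have hh : h = H + (r1 * m + r2 * q) := by linarith
  refine ⟨by ring, ?_, ?_⟩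
  · rw [hh]
    linear_combination (-(1/4 * (x ^ 2 - y ^ 2) * m + 1/2 * x * y * q) - (1/2 * (x^2+y^2) * (r1 * m + r2 * q))/2) * e3
  · rw [← e2]
    linear_combination (-(1/4 * (x ^ 2 - y ^ 2) * q - 1/2 * x * y * m) - (1/2 * (x^2+y^2) * (r1 * q - r2 * m))/2) * e3

end Shape

/-! ### Maps on the surface read in preferred charts -/

section SurfaceTheory

variable {M : Type*} [TopologicalSpace M] [ChartedSpace E2 M]
  {F : Type*} [NormedAddCommGroup F] [NormedSpace ℝ F]

/-- The differential of a vector valued map on the surface. -/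
def tderiv (f : M → F) (p : M) : E2 →L[ℝ] F := mfderiv (𝓡 2) 𝓘(ℝ, F) f p

/-- A map on the surface, read in the preferred chart at `p`. -/
def chartRep (f : M → F) (p : M) (x : E2) : F := f ((extChartAt (𝓡 2) p).symm x)

theorem tderiv_eq_fderiv {f : M → F} {p : M} (hf : MDifferentiableAt (𝓡 2) 𝓘(ℝ, F) f p) :
    tderiv f p = fderiv ℝ (chartRep f p) (extChartAt (𝓡 2) p p) := by
  refine hf.mfderiv.trans ?_
  have h : writtenInExtChartAt (𝓡 2) 𝓘(ℝ, F) p f = chartRep f p := rfl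
  rw [h, modelWithCornersSelf_coe, range_id, fderivWithin_univ]

variable [IsManifold (𝓡 2) ∞ M]

theorem contDiffAt_chartRep {f : M → F} {p q : M} {n : ℕ}
    (hq : q ∈ (extChartAt (𝓡 2) p).source) (hf : ContMDiffAt (𝓡 2) 𝓘(ℝ, F) n f q) :
    ContDiffAt ℝ n (chartRep f p) (extChartAt (𝓡 2) p q) := by
  have : IsManifold (𝓡 2) n M := IsManifold.of_le (n := ∞) (by exact_mod_cast le_top)
  rw [← contMDiffAt_iff_contDiffAt]
  have h1 : ContMDiffAt 𝓘(ℝ, E2) (𝓡 2) n (extChartAt (𝓡 2) p).symm (extChartAt (𝓡 2) p q) :=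
    (contMDiffOn_extChartAt_symm p).contMDiffAt
      ((isOpen_extChartAt_target p).mem_nhds ((extChartAt (𝓡 2) p).map_source hq))
  have h2 : (extChartAt (𝓡 2) p).symm (extChartAt (𝓡 2) p q) = q :=
    (extChartAt (𝓡 2) p).left_inv hq
  exact ContMDiffAt.comp _ (by rw [h2]; exact hf) h1

theorem contMDiffAt_of_chartRep {f : M → F} {p q : M} {n : ℕ}
    (hq : q ∈ (extChartAt (𝓡 2) p).source)
    (hf : ContDiffAt ℝ n (chartRep f p) (extChartAt (𝓡 2) p q)) :
    ContMDiffAt (𝓡 2) 𝓘(ℝ, F) n f q := by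
  have : IsManifold (𝓡 2) n M := IsManifold.of_le (n := ∞) (by exact_mod_cast le_top)
  have h1 : ContMDiffAt (𝓡 2) 𝓘(ℝ, E2) n (extChartAt (𝓡 2) p) q :=
    contMDiffAt_extChartAt' (by simpa using hq)
  have h2 := (contMDiffAt_iff_contDiffAt.2 hf).comp q h1
  refine h2.congr_of_eventuallyEq ?_
  filter_upwards [(isOpen_extChartAt_source p).mem_nhds hq] with q' hq'
  simp only [chartRep, Function.comp_apply, (extChartAt (𝓡 2) p).left_inv hq']

/-- The differential of the inverse of the preferred chart at `p`. -/
def chartSymmDeriv (p : M) (x : E2) : E2 →L[ℝ] E2 :=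
  mfderiv 𝓘(ℝ, E2) (𝓡 2) (extChartAt (𝓡 2) p).symm x

theorem chartSymmDeriv_injective {p q : M} (hq : q ∈ (extChartAt (𝓡 2) p).source) :
    Function.Injective (chartSymmDeriv p (extChartAt (𝓡 2) p q)) := by
  have : IsManifold (𝓡 2) 1 M := IsManifold.of_le (n := ∞) (by norm_num)
  have h := isInvertible_mfderivWithin_extChartAt_symm (I := 𝓡 2)
    ((extChartAt (𝓡 2) p).map_source hq)
  simp only [modelWithCornersSelf_coe, range_id, mfderivWithin_univ] at h
  exact h.injective

/-- Passing from the intrinsic differential at `q` to the derivative in the fixed chart at `p` costs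
one injective factor, independent of `f`. Identities known at every point can thus be differentiated
in a single chart. -/
theorem fderiv_chartRep {f : M → F} {p q : M} (hq : q ∈ (extChartAt (𝓡 2) p).source)
    (hf : MDifferentiableAt (𝓡 2) 𝓘(ℝ, F) f q) :
    fderiv ℝ (chartRep f p) (extChartAt (𝓡 2) p q)
      = (tderiv f q).comp (chartSymmDeriv p (extChartAt (𝓡 2) p q)) := by
  have : IsManifold (𝓡 2) 1 M := IsManifold.of_le (n := ∞) (by norm_num)
  have h1 : MDifferentiableAt 𝓘(ℝ, E2) (𝓡 2) (extChartAt (𝓡 2) p).symm (extChartAt (𝓡 2) p q) :=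
    ((contMDiffOn_extChartAt_symm (n := 1) p).contMDiffAt
      ((isOpen_extChartAt_target p).mem_nhds ((extChartAt (𝓡 2) p).map_source hq))).mdifferentiableAt
        (by norm_num)
  have h2 : (extChartAt (𝓡 2) p).symm (extChartAt (𝓡 2) p q) = q :=
    (extChartAt (𝓡 2) p).left_inv hq
  have h3 := mfderiv_comp (extChartAt (𝓡 2) p q) (g := f) (by rw [h2]; exact hf) h1
  rw [← mfderiv_eq_fderiv]
  refine h3.trans ?_
  rw [h2]
  rfl

/-- The velocity of a curve on the surface. -/
def velocity (γ : ℝ → M) (t : ℝ) : E2 := mfderiv 𝓘(ℝ, ℝ) (𝓡 2) γ t (1 : ℝ)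

/-- The derivative of a map from a normed space to the surface. -/
def mapDeriv {E : Type*} [NormedAddCommGroup E] [NormedSpace ℝ E] (Θ : E → M) (x : E) :
    E →L[ℝ] E2 := mfderiv 𝓘(ℝ, E) (𝓡 2) Θ x

omit [IsManifold (𝓡 2) ∞ M] in
theorem hasFDerivAt_comp {E : Type*} [NormedAddCommGroup E] [NormedSpace ℝ E] {f : M → F}
    {Θ : E → M} {x : E} (hf : MDifferentiableAt (𝓡 2) 𝓘(ℝ, F) f (Θ x))
    (hΘ : MDifferentiableAt 𝓘(ℝ, E) (𝓡 2) Θ x) :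
    HasFDerivAt (fun y => f (Θ y))
      ((tderiv f (Θ x)).comp (mapDeriv Θ x)) x := by
  have := hf.hasMFDerivAt.comp x hΘ.hasMFDerivAt
  exact hasMFDerivAt_iff_hasFDerivAt.1 this

omit [IsManifold (𝓡 2) ∞ M] in
theorem hasDerivAt_comp {f : M → F} {γ : ℝ → M} {t : ℝ}
    (hf : MDifferentiableAt (𝓡 2) 𝓘(ℝ, F) f (γ t))
    (hγ : MDifferentiableAt 𝓘(ℝ, ℝ) (𝓡 2) γ t) :
    HasDerivAt (fun s => f (γ s)) (tderiv f (γ t) (velocity γ t)) t := by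
  have := (hasFDerivAt_comp hf hγ).hasDerivAt
  exact this

end SurfaceTheory

/-! ### Immersed oriented surfaces and their shape operator -/

section Immersion

theorem cross_eq_smul_of_orthogonal {a b n : E3} (hn : ‖n‖ = 1) (ha : inner ℝ n a = 0)
    (hb : inner ℝ n b = 0) : cross a b = inner ℝ n (cross a b) • n := by
  have h1 : cross n (cross a b) = inner ℝ n b • a - inner ℝ n a • b := by
    apply ext_E3 <;>
    simp only [inner_E3, cross_apply_zero, cross_apply_one, cross_apply_two, PiLp.sub_apply,
      PiLp.smul_apply, smul_eq_mul] <;> ring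
  have h2 := cross_cross_self n (cross a b)
  rw [h1, ha, hb, real_inner_self_eq_norm_sq, hn] at h2
  have h3 : cross n ((0 : ℝ) • a - (0 : ℝ) • b) = 0 := by
    rw [zero_smul, zero_smul, sub_zero]; exact (crossL n).map_zero
  rw [h3] at h2
  have : inner ℝ n (cross a b) • n - cross a b = 0 := by
    rw [h2]; norm_num
  exact (sub_eq_zero.1 this).symm

theorem E2_expand (w : E2) : w = w 0 • basisVec 0 + w 1 • basisVec 1 := by
  ext i; fin_cases i <;> simp [basisVec]

/-- The equality case of Cauchy–Schwarz: a vanishing determinant makes ⟨b, b⟩a − ⟨a, b⟩b the zero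
vector, and injectivity turns this into a relation between the basis vectors. -/
theorem gram_ne_zero {A : E2 →L[ℝ] E3} (hA : Function.Injective A) :
    inner ℝ (A (basisVec 0)) (A (basisVec 0)) * inner ℝ (A (basisVec 1)) (A (basisVec 1))
      - inner ℝ (A (basisVec 0)) (A (basisVec 1)) ^ 2 ≠ 0 := by
  set a := A (basisVec 0) with ha
  set b := A (basisVec 1) with hb
  intro h
  have hb0 : inner ℝ b b ≠ 0 := by
    intro h0
    rw [inner_self_eq_zero] at h0
    have := hA (h0.trans A.map_zero.symm)
    have := congrArg (fun w : E2 => w 1) this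
    simp [basisVec] at this
  have h1 : (inner ℝ b b • a - inner ℝ a b • b : E3) = 0 := by
    rw [← inner_self_eq_zero (𝕜 := ℝ)]
    simp only [inner_sub_left, inner_sub_right, real_inner_smul_left, real_inner_smul_right]
    rw [real_inner_comm b a] at *
    linear_combination inner ℝ b b * h
  have h2 : A (inner ℝ b b • basisVec 0 - inner ℝ a b • basisVec 1) = A 0 := by
    rw [map_sub, map_smul, map_smul, map_zero]; exact h1
  have := congrArg (fun w : E2 => w 0) (hA h2)
  simp [basisVec] at this
  exact hb0 (by rw [this]; simp)

/-- The operator that maps `a, b, n` to `-na, -nb, 0`. -/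
def shapeOf (a b n na nb : E3) : E3 →L[ℝ] E3 :=
  -((inner ℝ (cross a b) n)⁻¹ • ((innerSL ℝ (cross b n)).smulRight na
    + (innerSL ℝ (cross n a)).smulRight nb))

theorem shapeOf_apply (a b n na nb u : E3) : shapeOf a b n na nb u =
    -((inner ℝ (cross a b) n)⁻¹ • (inner ℝ (cross b n) u • na + inner ℝ (cross n a) u • nb)) := by
  simp [shapeOf]

theorem shapeOf_normal (a b n na nb : E3) : shapeOf a b n na nb n = 0 := by
  rw [shapeOf_apply, inner_cross_right, inner_cross_left]; simp

theorem shapeOf_fst {a b n : E3} (na nb : E3) (h : inner ℝ (cross a b) n ≠ 0) :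
    shapeOf a b n na nb a = -na := by
  rw [shapeOf_apply, inner_cross_right]
  have : inner ℝ (cross b n) a = inner ℝ (cross a b) n := by
    simp only [inner_E3, cross_apply_zero, cross_apply_one, cross_apply_two]; ring
  rw [this, zero_smul, add_zero, smul_smul, inv_mul_cancel₀ h, one_smul]

theorem shapeOf_snd {a b n : E3} (na nb : E3) (h : inner ℝ (cross a b) n ≠ 0) :
    shapeOf a b n na nb b = -nb := by
  rw [shapeOf_apply, inner_cross_left]
  have : inner ℝ (cross n a) b = inner ℝ (cross a b) n := by
    simp only [inner_E3, cross_apply_zero, cross_apply_one, cross_apply_two]; ring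
  rw [this, zero_smul, zero_add, smul_smul, inv_mul_cancel₀ h, one_smul]

theorem det_ne_zero {n : E3} {A : E2 →L[ℝ] E3} (hA : Function.Injective A) (hn : ‖n‖ = 1)
    (ho : ∀ w, inner ℝ n (A w) = 0) :
    inner ℝ (cross (A (basisVec 0)) (A (basisVec 1))) n ≠ 0 := by
  intro h
  apply gram_ne_zero hA
  rw [← inner_cross_cross]
  have := cross_eq_smul_of_orthogonal hn (ho (basisVec 0)) (ho (basisVec 1))
  rw [real_inner_comm] at h
  rw [h, zero_smul] at this
  rw [this, inner_zero_left]

/-- The map (w, s) ↦ Aw + sn is injective between spaces of dimension three, hence onto. -/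
theorem exists_apply_add_smul {n : E3} {A : E2 →L[ℝ] E3} (hA : Function.Injective A)
    (hn : ‖n‖ = 1) (ho : ∀ w, inner ℝ n (A w) = 0) (u : E3) :
    ∃ w, u = A w + inner ℝ u n • n := by
  let f : (E2 × ℝ) →ₗ[ℝ] E3 :=
    (A : E2 →ₗ[ℝ] E3).coprod (LinearMap.toSpanSingleton ℝ E3 n)
  have hN1 : inner ℝ n n = 1 := by
    rw [real_inner_self_eq_norm_sq, hn]; norm_num
  have hf : ∀ w s, f (w, s) = A w + s • n := fun w s => by simp [f]
  have hinj : Function.Injective f := by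
    rw [injective_iff_map_eq_zero]
    rintro ⟨w, s⟩ h
    rw [hf] at h
    have h1 : s = 0 := by
      have := congrArg (fun z => inner ℝ n z) h
      simpa only [inner_add_right, ho, real_inner_smul_right, hN1, inner_zero_right,
        zero_add, mul_one] using this
    subst h1
    have h2 : A w = A 0 := by simpa using h
    rw [hA h2]; rfl
  have hsurj : Function.Surjective f :=
    (LinearMap.injective_iff_surjective_of_finrank_eq_finrank (by simp)).1 hinj
  obtain ⟨⟨w, s⟩, hws⟩ := hsurj u
  rw [hf] at hws
  refine ⟨w, ?_⟩
  have h1 := congrArg (fun z => inner ℝ n z) hws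
  simp only [inner_add_right, ho, real_inner_smul_right, hN1, zero_add, mul_one] at h1
  rw [real_inner_comm, ← h1, hws]

variable {M : Type*} [TopologicalSpace M] [ChartedSpace E2 M]

/-- An immersion of class `C³` with a unit normal field of class `C²`. -/
structure IsOrientedImmersion (α N : M → E3) : Prop where
  contMDiff : ContMDiff (𝓡 2) 𝓘(ℝ, E3) (3 : ℕ) α
  contMDiff_normal : ContMDiff (𝓡 2) 𝓘(ℝ, E3) (2 : ℕ) N
  injective : ∀ p, Function.Injective (tderiv α p)
  norm_normal : ∀ p, ‖N p‖ = 1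
  orthogonal : ∀ p w, inner ℝ (N p) (tderiv α p w) = 0

section

variable [IsManifold (𝓡 2) ∞ M]

/-- The field `N` is only assumed continuous. In a chart the vector product m of the coordinate
tangent vectors is of class C², nowhere zero and parallel to `N`, so N = ±m/‖m‖; continuity of `N`
makes the sign locally constant. -/
theorem IsUnitNormal.contMDiff {α N : M → E3} (hN : IsUnitNormal α N)
    (hα : ContMDiff (𝓡 2) 𝓘(ℝ, E3) (3 : ℕ) α) (hinj : ∀ p, Function.Injective (tderiv α p)) :
    ContMDiff (𝓡 2) 𝓘(ℝ, E3) (2 : ℕ) N := by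
  intro p
  have hp := mem_extChartAt_source (I := 𝓡 2) p
  apply contMDiffAt_of_chartRep hp
  set x₀ := extChartAt (𝓡 2) p p with hx₀
  have hA : ContDiffAt ℝ (3 : ℕ) (chartRep α p) x₀ := contDiffAt_chartRep hp (hα p)
  have hD : ContDiffAt ℝ (2 : ℕ) (fderiv ℝ (chartRep α p)) x₀ :=
    hA.fderiv_right (m := (2 : ℕ)) (by norm_num)
  set m : E2 → E3 := fun x => cross (fderiv ℝ (chartRep α p) x (basisVec 0))
    (fderiv ℝ (chartRep α p) x (basisVec 1)) with hm
  have hmC : ContDiffAt ℝ (2 : ℕ) m x₀ :=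
    (crossL.contDiff.contDiffAt.comp x₀ (hD.clm_apply contDiffAt_const)).clm_apply
      (hD.clm_apply contDiffAt_const)
  have htar : ∀ᶠ x in 𝓝 x₀, x ∈ (extChartAt (𝓡 2) p).target :=
    (isOpen_extChartAt_target p).mem_nhds (mem_extChartAt_target p)
  have hm_ev : ∀ᶠ x in 𝓝 x₀, m x ≠ 0 ∧
      m x = inner ℝ (chartRep N p x) (m x) • chartRep N p x ∧ ‖chartRep N p x‖ = 1 := by
    filter_upwards [htar] with x hx
    obtain ⟨q, hq, rfl⟩ : ∃ q, q ∈ (extChartAt (𝓡 2) p).source ∧ extChartAt (𝓡 2) p q = x :=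
      ⟨_, (extChartAt (𝓡 2) p).map_target hx, (extChartAt (𝓡 2) p).right_inv hx⟩
    have hd := fderiv_chartRep hq ((hα q).mdifferentiableAt (by norm_num))
    have hNq : chartRep N p (extChartAt (𝓡 2) p q) = N q := by
      simp only [chartRep, (extChartAt (𝓡 2) p).left_inv hq]
    have hi : Function.Injective (fderiv ℝ (chartRep α p) (extChartAt (𝓡 2) p q)) := by
      rw [hd]; exact (hinj q).comp (chartSymmDeriv_injective hq)
    have ho : ∀ w, inner ℝ (N q) (fderiv ℝ (chartRep α p) (extChartAt (𝓡 2) p q) w) = 0 := by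
      intro w; rw [hd]; exact hN.orthogonal q _
    refine ⟨?_, ?_, ?_⟩
    · intro h0
      apply gram_ne_zero hi
      rw [← inner_cross_cross]
      simp only [hm] at h0
      rw [h0, inner_zero_left]
    · rw [hNq]
      exact cross_eq_smul_of_orthogonal (hN.norm_eq_one q) (ho _) (ho _)
    · rw [hNq]; exact hN.norm_eq_one q
  have hNc : ContinuousAt (chartRep N p) x₀ :=
    ContinuousAt.comp (by exact hN.continuous.continuousAt) (continuousAt_extChartAt_symm p)
  set s : E2 → ℝ := fun x => inner ℝ (chartRep N p x) (m x) with hs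
  have hsc : ContinuousAt s x₀ := hNc.inner hmC.continuousAt
  have hs0 : s x₀ ≠ 0 := by
    intro h
    obtain ⟨h1, h2, -⟩ := hm_ev.self_of_nhds
    apply h1; rw [h2]; simp only [hs] at h; rw [h, zero_smul]
  have habs : ∀ᶠ x in 𝓝 x₀, ‖m x‖ = |s x| := by
    filter_upwards [hm_ev] with x ⟨_, h2, h3⟩
    conv_lhs => rw [h2]
    rw [norm_smul, h3, mul_one]; rfl
  have hinv : ContDiffAt ℝ (2 : ℕ) (fun x => ‖m x‖⁻¹) x₀ :=
    (hmC.norm ℝ hm_ev.self_of_nhds.1).inv (norm_ne_zero_iff.2 hm_ev.self_of_nhds.1)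
  rcases lt_or_gt_of_ne hs0 with hneg | hpos
  · have hev : chartRep N p =ᶠ[𝓝 x₀] fun x => -(‖m x‖⁻¹ • m x) := by
      filter_upwards [hm_ev, habs, hsc.eventually (gt_mem_nhds hneg)] with x ⟨h1, h2, h3⟩ h4 h5
      rw [abs_of_neg h5] at h4
      rw [h4]
      conv_rhs => rw [h2]
      rw [smul_smul]
      have : (-s x)⁻¹ * inner ℝ (chartRep N p x) (m x) = -1 := by
        change (-s x)⁻¹ * s x = -1
        field_simp [h5.ne]
      rw [this]; simp
    exact ((hinv.smul hmC).neg).congr_of_eventuallyEq hev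
  · have hev : chartRep N p =ᶠ[𝓝 x₀] fun x => ‖m x‖⁻¹ • m x := by
      filter_upwards [hm_ev, habs, hsc.eventually (lt_mem_nhds hpos)] with x ⟨h1, h2, h3⟩ h4 h5
      rw [abs_of_pos h5] at h4
      rw [h4]
      conv_rhs => rw [h2]
      rw [smul_smul]
      have : (s x)⁻¹ * inner ℝ (chartRep N p x) (m x) = 1 := by
        change (s x)⁻¹ * s x = 1
        field_simp [h5.ne']
      rw [this]; simp
    exact (hinv.smul hmC).congr_of_eventuallyEq hev

end

/-- The shape operator `-dN` of the surface, extended by `0` to the normal direction. -/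
def shapeOp (α N : M → E3) (p : M) : E3 →L[ℝ] E3 :=
  shapeOf (tderiv α p (basisVec 0)) (tderiv α p (basisVec 1)) (N p)
    (tderiv N p (basisVec 0)) (tderiv N p (basisVec 1))

namespace IsOrientedImmersion

variable {α N : M → E3} (S : IsOrientedImmersion α N)
include S

theorem mdifferentiableAt (p : M) : MDifferentiableAt (𝓡 2) 𝓘(ℝ, E3) α p :=
  (S.contMDiff p).mdifferentiableAt (by norm_num)

theorem mdifferentiableAt_normal (p : M) : MDifferentiableAt (𝓡 2) 𝓘(ℝ, E3) N p :=
  (S.contMDiff_normal p).mdifferentiableAt (by norm_num)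

theorem shapeOp_tderiv (p : M) (w : E2) : shapeOp α N p (tderiv α p w) = -tderiv N p w := by
  have hd := det_ne_zero (S.injective p) (S.norm_normal p) (S.orthogonal p)
  rw [E2_expand w]
  simp only [map_add, map_smul, shapeOp]
  rw [shapeOf_fst _ _ hd, shapeOf_snd _ _ hd]
  module

omit S in
theorem shapeOp_normal (p : M) : shapeOp α N p (N p) = 0 := shapeOf_normal _ _ _ _ _

variable [IsManifold (𝓡 2) ∞ M]

/-- The differential of the normal in terms of the second derivative of the immersion. -/
theorem secondForm_eq (p : M) (v w : E2) :
    secondForm α N p v w = inner ℝ (shapeOp α N p (tderiv α p v)) (tderiv α p w) := by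
  have hp := mem_extChartAt_source (I := 𝓡 2) p
  set x₀ := extChartAt (𝓡 2) p p with hx₀
  have hA : ContDiffAt ℝ (3 : ℕ) (chartRep α p) x₀ := contDiffAt_chartRep hp (S.contMDiff p)
  have hn : ContDiffAt ℝ (2 : ℕ) (chartRep N p) x₀ := contDiffAt_chartRep hp (S.contMDiff_normal p)
  have hD : ContDiffAt ℝ (2 : ℕ) (fderiv ℝ (chartRep α p)) x₀ :=
    hA.fderiv_right (m := (2 : ℕ)) (by norm_num)
  have h1 : HasFDerivAt (fun x => fderiv ℝ (chartRep α p) x w)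
      ((fderiv ℝ (fderiv ℝ (chartRep α p)) x₀).flip w) x₀ := by
    have := (hD.differentiableAt (by norm_num)).hasFDerivAt.clm_apply (hasFDerivAt_const w x₀)
    simpa using this
  have h2 : HasFDerivAt (chartRep N p) (fderiv ℝ (chartRep N p) x₀) x₀ :=
    (hn.differentiableAt (by norm_num)).hasFDerivAt
  have h3 := h2.inner ℝ h1
  -- The relation ⟨N, Dα w⟩ = 0 holds at all nearby points and may be differentiated in the
  -- direction `v`.
  have h4 : (fun x => inner ℝ (chartRep N p x) (fderiv ℝ (chartRep α p) x w)) =ᶠ[𝓝 x₀]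
      fun _ => (0 : ℝ) := by
    filter_upwards [(isOpen_extChartAt_target p).mem_nhds (mem_extChartAt_target p)] with x hx
    obtain ⟨q, hq, rfl⟩ : ∃ q, q ∈ (extChartAt (𝓡 2) p).source ∧ extChartAt (𝓡 2) p q = x :=
      ⟨_, (extChartAt (𝓡 2) p).map_target hx, (extChartAt (𝓡 2) p).right_inv hx⟩
    rw [fderiv_chartRep hq (S.mdifferentiableAt q)]
    have hNq : chartRep N p (extChartAt (𝓡 2) p q) = N q := by
      simp only [chartRep, (extChartAt (𝓡 2) p).left_inv hq]
    rw [hNq]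
    exact S.orthogonal q _
  have h5 := h3.unique ((hasFDerivAt_const (0 : ℝ) x₀).congr_of_eventuallyEq h4)
  have h6 := congrArg (fun l : E2 →L[ℝ] ℝ => l v) h5
  rw [S.shapeOp_tderiv, tderiv_eq_fderiv (S.mdifferentiableAt p),
    tderiv_eq_fderiv (S.mdifferentiableAt_normal p)]
  have hNp : chartRep N p x₀ = N p := by
    simp only [chartRep, hx₀, (extChartAt (𝓡 2) p).left_inv hp]
  simp [fderivInnerCLM_apply, hNp] at h6
  rw [inner_neg_left]
  change inner ℝ (N p) (fderiv ℝ (fderiv ℝ (chartRep α p)) x₀ v w) = _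
  linarith

theorem secondForm_comm (p : M) (v w : E2) : secondForm α N p v w = secondForm α N p w v := by
  have hp := mem_extChartAt_source (I := 𝓡 2) p
  have hA : ContDiffAt ℝ (3 : ℕ) (chartRep α p) _ := contDiffAt_chartRep hp (S.contMDiff p)
  have := hA.isSymmSndFDerivAt (by norm_num)
  change inner ℝ (N p) (fderiv ℝ (fderiv ℝ (chartRep α p)) _ v w)
    = inner ℝ (N p) (fderiv ℝ (fderiv ℝ (chartRep α p)) _ w v)
  rw [this.eq]

omit [IsManifold (𝓡 2) ∞ M] in
theorem firstForm_eq (p : M) (v w : E2) :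
    firstForm α p v w = inner ℝ (tderiv α p v) (tderiv α p w) := by
  rw [tderiv_eq_fderiv (S.mdifferentiableAt p)]; rfl

omit [IsManifold (𝓡 2) ∞ M] in
-- Differentiating ⟨N, N⟩ = 1 shows that dN has tangent values.
theorem shapeOp_inner_normal (p : M) (u : E3) : inner ℝ (shapeOp α N p u) (N p) = 0 := by
  have hn : ∀ w, inner ℝ (tderiv N p w) (N p) = 0 := by
    intro w
    have h1 : HasMFDerivAt (𝓡 2) 𝓘(ℝ, E3) N p (mfderiv (𝓡 2) 𝓘(ℝ, E3) N p) :=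
      (S.mdifferentiableAt_normal p).hasMFDerivAt
    have h2 : HasFDerivAt (fun v : E3 => inner ℝ v v)
      ((fderivInnerCLM ℝ (N p, N p)).comp
        ((ContinuousLinearMap.id ℝ E3).prod (ContinuousLinearMap.id ℝ E3))) (N p) :=
      (hasFDerivAt_id (N p)).inner ℝ (hasFDerivAt_id (N p))
    have h3 := (hasMFDerivAt_iff_hasFDerivAt.2 h2).comp p h1
    have h4 : (fun v : E3 => inner ℝ v v) ∘ N = fun _ => (1 : ℝ) := by
      funext q
      simp only [Function.comp_apply]
      rw [real_inner_self_eq_norm_sq, S.norm_normal]; norm_num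
    rw [h4] at h3
    have h5 := hasMFDerivAt_unique h3 (hasMFDerivAt_const (1 : ℝ) p)
    have h6 := congrArg (fun l : E2 →L[ℝ] ℝ => l w) h5
    have h7 : inner ℝ (N p) (tderiv N p w) + inner ℝ (tderiv N p w) (N p) = 0 := h6
    rw [real_inner_comm] at h7
    linarith
  simp only [shapeOp, shapeOf_apply, inner_neg_left, real_inner_smul_left, inner_add_left, hn]
  simp

/-- On tangent vectors symmetry is that of the second derivatives of α, by `secondForm_eq`. Normal
components contribute nothing, since the operator annihilates N and has tangent values. -/
theorem isShape (p : M) : IsShape (shapeOp α N p) (N p) := by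
  refine ⟨fun u v => ?_, shapeOp_normal p⟩
  have hdec := exists_apply_add_smul (S.injective p) (S.norm_normal p) (S.orthogonal p)
  obtain ⟨a, ha⟩ := hdec u
  obtain ⟨b, hb⟩ := hdec v
  have hu : shapeOp α N p u = shapeOp α N p (tderiv α p a) := by
    conv_lhs => rw [ha]
    rw [map_add, map_smul, shapeOp_normal, smul_zero, add_zero]
  have hv : shapeOp α N p v = shapeOp α N p (tderiv α p b) := by
    conv_lhs => rw [hb]
    rw [map_add, map_smul, shapeOp_normal, smul_zero, add_zero]
  rw [hu, hv]
  conv_lhs => rw [hb]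
  conv_rhs => rw [ha]
  rw [inner_add_right, inner_add_left, real_inner_smul_right, real_inner_smul_left,
    S.shapeOp_inner_normal, real_inner_comm _ (N p), S.shapeOp_inner_normal, ← S.secondForm_eq,
    S.secondForm_comm, S.secondForm_eq, real_inner_comm (shapeOp α N p (tderiv α p b))]
  simp

end IsOrientedImmersion

end Immersion

/-! ### Curvatures, their regularity and the Codazzi equation -/

section Curvature

theorem contDiffAt_clm_of_apply {E F G : Type*} [NormedAddCommGroup E] [NormedSpace ℝ E]
    [NormedAddCommGroup F] [NormedSpace ℝ F] [NormedAddCommGroup G] [NormedSpace ℝ G]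
    [FiniteDimensional ℝ F] {f : E → F →L[ℝ] G} {x : E} {n : WithTop ℕ∞}
    (h : ∀ y, ContDiffAt ℝ n (fun z => f z y) x) : ContDiffAt ℝ n f x := by
  let d := Module.finrank ℝ F
  have hd : d = Module.finrank ℝ (Fin d → ℝ) := (Module.finrank_fin_fun ℝ).symm
  let e₁ := ContinuousLinearEquiv.ofFinrankEq hd
  let e₂ := (e₁.arrowCongr (1 : G ≃L[ℝ] G)).trans (ContinuousLinearEquiv.piRing (Fin d))
  rw [← Function.id_comp f, ← e₂.symm_comp_self]
  exact e₂.symm.contDiff.contDiffAt.comp x (contDiffAt_pi.mpr fun i => h _)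

theorem _root_.ContDiffAt.cross_E3 {E : Type*} [NormedAddCommGroup E] [NormedSpace ℝ E] {f g : E → E3}
    {x : E} {n : WithTop ℕ∞} (hf : ContDiffAt ℝ n f x) (hg : ContDiffAt ℝ n g x) :
    ContDiffAt ℝ n (fun y => cross (f y) (g y)) x :=
  (crossL.contDiff.contDiffAt.comp x hf).clm_apply hg

variable {M : Type*} [TopologicalSpace M] [ChartedSpace E2 M]

theorem eventually_chart (p : M) : ∀ᶠ x in 𝓝 (extChartAt (𝓡 2) p p),
    ∃ q, q ∈ (extChartAt (𝓡 2) p).source ∧ extChartAt (𝓡 2) p q = x ∧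
      (extChartAt (𝓡 2) p).symm x = q := by
  filter_upwards [(isOpen_extChartAt_target p).mem_nhds (mem_extChartAt_target p)] with x hx
  exact ⟨_, (extChartAt (𝓡 2) p).map_target hx, (extChartAt (𝓡 2) p).right_inv hx, rfl⟩

namespace IsOrientedImmersion

variable {α N : M → E3} (S : IsOrientedImmersion α N)
include S

/-- At every point there is an adapted orthonormal frame. -/
theorem exists_isFrame (p : M) : ∃ e, IsFrame (N p) e := by
  have h0 : tderiv α p (basisVec 0) ≠ 0 := by
    intro h
    have := congrArg (fun w : E2 => w 0) (S.injective p (h.trans (map_zero _).symm))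
    simp [basisVec] at this
  refine ⟨‖tderiv α p (basisVec 0)‖⁻¹ • tderiv α p (basisVec 0), S.norm_normal p, ?_, ?_⟩
  · rw [norm_smul, norm_inv, norm_norm, inv_mul_cancel₀ (norm_ne_zero_iff.2 h0)]
  · rw [real_inner_smul_right, S.orthogonal, mul_zero]

variable [IsManifold (𝓡 2) ∞ M]

theorem curvatures_eq_of_isFrame {p : M} {e : E3} (he : IsFrame (N p) e) :
    gaussCurvature α N p = inner ℝ (shapeOp α N p e) e
      * inner ℝ (shapeOp α N p (cross (N p) e)) (cross (N p) e)
        - inner ℝ (shapeOp α N p e) (cross (N p) e) ^ 2 ∧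
    meanCurvature α N p = (inner ℝ (shapeOp α N p e) e
      + inner ℝ (shapeOp α N p (cross (N p) e)) (cross (N p) e)) / 2 := by
  have ho : ∀ w, inner ℝ (tderiv α p w) (N p) = 0 := fun w => by
    rw [real_inner_comm]; exact S.orthogonal p w
  have := (S.isShape p).gauss_mean_eq he (ho (basisVec 0)) (ho (basisVec 1))
    (gram_ne_zero (S.injective p))
  simp only [gaussCurvature, meanCurvature, areaSq, S.firstForm_eq, S.secondForm_eq]
  exact this

/-- The curvatures in an arbitrary basis of the tangent plane. -/
theorem curvatures_eq_of_injective {p : M} {A : E2 →L[ℝ] E3} (hA : Function.Injective A)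
    (ho : ∀ w, inner ℝ (N p) (A w) = 0) :
    gaussCurvature α N p =
      (inner ℝ (shapeOp α N p (A (basisVec 0))) (A (basisVec 0))
        * inner ℝ (shapeOp α N p (A (basisVec 1))) (A (basisVec 1))
        - inner ℝ (shapeOp α N p (A (basisVec 0))) (A (basisVec 1)) ^ 2)
      / (inner ℝ (A (basisVec 0)) (A (basisVec 0)) * inner ℝ (A (basisVec 1)) (A (basisVec 1))
          - inner ℝ (A (basisVec 0)) (A (basisVec 1)) ^ 2) ∧
    meanCurvature α N p =
      (inner ℝ (A (basisVec 0)) (A (basisVec 0))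
        * inner ℝ (shapeOp α N p (A (basisVec 1))) (A (basisVec 1))
        - 2 * inner ℝ (A (basisVec 0)) (A (basisVec 1))
          * inner ℝ (shapeOp α N p (A (basisVec 0))) (A (basisVec 1))
        + inner ℝ (A (basisVec 1)) (A (basisVec 1))
          * inner ℝ (shapeOp α N p (A (basisVec 0))) (A (basisVec 0)))
      / (2 * (inner ℝ (A (basisVec 0)) (A (basisVec 0)) * inner ℝ (A (basisVec 1)) (A (basisVec 1))
          - inner ℝ (A (basisVec 0)) (A (basisVec 1)) ^ 2)) := by
  obtain ⟨e, he⟩ := S.exists_isFrame p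
  have ho' : ∀ w, inner ℝ (A w) (N p) = 0 := fun w => by
    rw [real_inner_comm]; exact ho w
  have h1 := (S.isShape p).gauss_mean_eq he (ho' (basisVec 0)) (ho' (basisVec 1)) (gram_ne_zero hA)
  have h2 := S.curvatures_eq_of_isFrame he
  exact ⟨h2.1.trans h1.1.symm, h2.2.trans h1.2.symm⟩

/-- Data of the immersion at a point read in the chart at another point. -/
theorem chart_data {p q : M} (hq : q ∈ (extChartAt (𝓡 2) p).source) :
    Function.Injective (fderiv ℝ (chartRep α p) (extChartAt (𝓡 2) p q)) ∧
    (∀ w, inner ℝ (N q) (fderiv ℝ (chartRep α p) (extChartAt (𝓡 2) p q) w) = 0) ∧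
    (∀ w, shapeOp α N q (fderiv ℝ (chartRep α p) (extChartAt (𝓡 2) p q) w)
      = -fderiv ℝ (chartRep N p) (extChartAt (𝓡 2) p q) w) := by
  have hd := fderiv_chartRep hq (S.mdifferentiableAt q)
  have hdN := fderiv_chartRep hq (S.mdifferentiableAt_normal q)
  refine ⟨?_, fun w => ?_, fun w => ?_⟩
  · rw [hd]; exact (S.injective q).comp (chartSymmDeriv_injective hq)
  · rw [hd]; exact S.orthogonal q _
  · rw [hd, hdN]; exact S.shapeOp_tderiv q _

theorem contDiffAt_fderiv_chartRep (p : M) :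
    ContDiffAt ℝ (2 : ℕ) (fderiv ℝ (chartRep α p)) (extChartAt (𝓡 2) p p) :=
  (contDiffAt_chartRep (mem_extChartAt_source p) (S.contMDiff p)).fderiv_right
    (m := (2 : ℕ)) (by norm_num)

theorem contDiffAt_fderiv_chartRep_normal (p : M) :
    ContDiffAt ℝ (1 : ℕ) (fderiv ℝ (chartRep N p)) (extChartAt (𝓡 2) p p) :=
  (contDiffAt_chartRep (mem_extChartAt_source p) (S.contMDiff_normal p)).fderiv_right
    (m := (1 : ℕ)) (by norm_num)

/-- Because the operator is extended to all of 3-space, it is a map into a fixed vector space. It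
does not depend on the basis of the tangent plane, so near `p` it is `shapeOf` applied to
derivatives in the one chart at `p`; these include first derivatives of N, whence class C¹. -/
theorem contMDiff_shapeOp : ContMDiff (𝓡 2) 𝓘(ℝ, E3 →L[ℝ] E3) (1 : ℕ) (shapeOp α N) := by
  intro p
  have hp := mem_extChartAt_source (I := 𝓡 2) p
  apply contMDiffAt_of_chartRep hp
  set x₀ := extChartAt (𝓡 2) p p with hx₀
  have hev : chartRep (shapeOp α N) p =ᶠ[𝓝 x₀] fun x =>
      shapeOf (fderiv ℝ (chartRep α p) x (basisVec 0)) (fderiv ℝ (chartRep α p) x (basisVec 1))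
        (chartRep N p x) (fderiv ℝ (chartRep N p) x (basisVec 0))
        (fderiv ℝ (chartRep N p) x (basisVec 1)) := by
    filter_upwards [eventually_chart p] with x ⟨q, hq, hqx, hxq⟩
    subst hqx
    obtain ⟨hi, ho, hB⟩ := S.chart_data hq
    have hd := det_ne_zero hi (S.norm_normal q) ho
    simp only [chartRep, hxq]
    ext1 u
    obtain ⟨w, hw⟩ := exists_apply_add_smul hi (S.norm_normal q) ho u
    rw [hw, map_add, map_add, map_smul, map_smul, shapeOp_normal, shapeOf_normal, hB, E2_expand w]
    have h1 := shapeOf_fst (fderiv ℝ (chartRep N p) (extChartAt (𝓡 2) p q) (basisVec 0))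
      (fderiv ℝ (chartRep N p) (extChartAt (𝓡 2) p q) (basisVec 1)) hd
    have h2 := shapeOf_snd (fderiv ℝ (chartRep N p) (extChartAt (𝓡 2) p q) (basisVec 0))
      (fderiv ℝ (chartRep N p) (extChartAt (𝓡 2) p q) (basisVec 1)) hd
    simp only [map_add, map_smul]
    unfold chartRep at h1 h2
    unfold chartRep
    rw [h1, h2]
    module
  refine ContDiffAt.congr_of_eventuallyEq ?_ hev
  have ha : ∀ w, ContDiffAt ℝ (1 : ℕ) (fun x => fderiv ℝ (chartRep α p) x w) x₀ := fun w =>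
    ((S.contDiffAt_fderiv_chartRep p).of_le (by norm_num)).clm_apply contDiffAt_const
  have hna : ∀ w, ContDiffAt ℝ (1 : ℕ) (fun x => fderiv ℝ (chartRep N p) x w) x₀ := fun w =>
    (S.contDiffAt_fderiv_chartRep_normal p).clm_apply contDiffAt_const
  have hn : ContDiffAt ℝ (1 : ℕ) (chartRep N p) x₀ :=
    (contDiffAt_chartRep hp (S.contMDiff_normal p)).of_le (by norm_num)
  obtain ⟨hi, ho, -⟩ := S.chart_data hp
  have hd := det_ne_zero hi (S.norm_normal p) ho
  have hNp : chartRep N p x₀ = N p := by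
    simp only [chartRep, hx₀, (extChartAt (𝓡 2) p).left_inv hp]
  apply contDiffAt_clm_of_apply
  intro u
  simp only [shapeOf_apply]
  refine ContDiffAt.neg (ContDiffAt.smul (ContDiffAt.inv
    (((ha _).cross_E3 (ha _)).inner ℝ hn) (by rw [hNp]; exact hd)) (ContDiffAt.add
    (ContDiffAt.smul (((ha _).cross_E3 hn).inner ℝ contDiffAt_const) (hna _))
    (ContDiffAt.smul ((hn.cross_E3 (ha _)).inner ℝ contDiffAt_const) (hna _))))

/-- The definitions of K and H use at each point the preferred chart of that point, which need not
vary continuously. Independence of the basis, `curvatures_eq_of_injective`, rewrites them near `p`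
through the chart at `p` alone. -/
theorem contMDiff_curvatures :
    ContMDiff (𝓡 2) 𝓘(ℝ, ℝ) (1 : ℕ) (gaussCurvature α N) ∧
    ContMDiff (𝓡 2) 𝓘(ℝ, ℝ) (1 : ℕ) (meanCurvature α N) := by
  have main : ∀ p : M, ContMDiffAt (𝓡 2) 𝓘(ℝ, ℝ) (1 : ℕ) (gaussCurvature α N) p ∧
      ContMDiffAt (𝓡 2) 𝓘(ℝ, ℝ) (1 : ℕ) (meanCurvature α N) p := by
    intro p
    have hp := mem_extChartAt_source (I := 𝓡 2) p
    set x₀ := extChartAt (𝓡 2) p p with hx₀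
    have hB : ContDiffAt ℝ (1 : ℕ) (chartRep (shapeOp α N) p) x₀ :=
      contDiffAt_chartRep hp (S.contMDiff_shapeOp p)
    have ha : ∀ w, ContDiffAt ℝ (1 : ℕ) (fun x => fderiv ℝ (chartRep α p) x w) x₀ := fun w =>
      ((S.contDiffAt_fderiv_chartRep p).of_le (by norm_num)).clm_apply contDiffAt_const
    obtain ⟨hi, ho, -⟩ := S.chart_data hp
    have hd := gram_ne_zero hi
    have hev : ∀ᶠ x in 𝓝 x₀, ∃ q, (extChartAt (𝓡 2) p).symm x = q ∧
        Function.Injective (fderiv ℝ (chartRep α p) x) ∧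
        (∀ w, inner ℝ (N q) (fderiv ℝ (chartRep α p) x w) = 0) := by
      filter_upwards [eventually_chart p] with x ⟨q, hq, hqx, hxq⟩
      subst hqx
      exact ⟨q, hxq, (S.chart_data hq).1, (S.chart_data hq).2.1⟩
    constructor
    · apply contMDiffAt_of_chartRep hp
      refine ContDiffAt.congr_of_eventuallyEq ?_
        (hev.mono fun x ⟨q, hxq, h1, h2⟩ => (show chartRep (gaussCurvature α N) p x = _ from
          (congrArg (gaussCurvature α N) hxq).trans
            ((S.curvatures_eq_of_injective h1 h2).1.trans (by rw [← hxq]))))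
      exact ContDiffAt.div (((hB.clm_apply (ha _)).inner ℝ (ha _)).mul
        ((hB.clm_apply (ha _)).inner ℝ (ha _)) |>.sub
          (((hB.clm_apply (ha _)).inner ℝ (ha _)).pow 2))
        ((((ha _).inner ℝ (ha _)).mul ((ha _).inner ℝ (ha _))).sub (((ha _).inner ℝ (ha _)).pow 2))
        hd
    · apply contMDiffAt_of_chartRep hp
      refine ContDiffAt.congr_of_eventuallyEq ?_
        (hev.mono fun x ⟨q, hxq, h1, h2⟩ => (show chartRep (meanCurvature α N) p x = _ from
          (congrArg (meanCurvature α N) hxq).trans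
            ((S.curvatures_eq_of_injective h1 h2).2.trans (by rw [← hxq]))))
      exact ContDiffAt.div (((((ha _).inner ℝ (ha _)).mul
        ((hB.clm_apply (ha _)).inner ℝ (ha _))).sub
          ((contDiffAt_const.mul ((ha _).inner ℝ (ha _))).mul
            ((hB.clm_apply (ha _)).inner ℝ (ha _)))).add
          (((ha _).inner ℝ (ha _)).mul ((hB.clm_apply (ha _)).inner ℝ (ha _))))
        (contDiffAt_const.mul
        ((((ha _).inner ℝ (ha _)).mul ((ha _).inner ℝ (ha _))).sub (((ha _).inner ℝ (ha _)).pow 2)))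
        (mul_ne_zero two_ne_zero hd)
  exact ⟨fun p => (main p).1, fun p => (main p).2⟩

theorem mdifferentiableAt_shapeOp (p : M) :
    MDifferentiableAt (𝓡 2) 𝓘(ℝ, E3 →L[ℝ] E3) (shapeOp α N) p :=
  (S.contMDiff_shapeOp p).mdifferentiableAt (by norm_num)

/-- The **Codazzi equation**. -/
theorem codazzi (p : M) (v w : E2) :
    tderiv (shapeOp α N) p v (tderiv α p w) = tderiv (shapeOp α N) p w (tderiv α p v) := by
  have hp := mem_extChartAt_source (I := 𝓡 2) p
  rw [tderiv_eq_fderiv (S.mdifferentiableAt_shapeOp p), tderiv_eq_fderiv (S.mdifferentiableAt p)]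
  set x₀ := extChartAt (𝓡 2) p p with hx₀
  have hB : HasFDerivAt (chartRep (shapeOp α N) p) (fderiv ℝ (chartRep (shapeOp α N) p) x₀) x₀ :=
    ((contDiffAt_chartRep hp (S.contMDiff_shapeOp p)).differentiableAt (by norm_num)).hasFDerivAt
  have hA : HasFDerivAt _ (fderiv ℝ (fderiv ℝ (chartRep α p)) x₀) x₀ :=
    ((S.contDiffAt_fderiv_chartRep p).differentiableAt (by norm_num)).hasFDerivAt
  have hn : HasFDerivAt _ (fderiv ℝ (fderiv ℝ (chartRep N p)) x₀) x₀ :=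
    ((S.contDiffAt_fderiv_chartRep_normal p).differentiableAt (by norm_num)).hasFDerivAt
  -- Differentiating B(Dα w) = −DN w along `v` leaves only second derivatives of α and N on the
  -- right, and these are symmetric in `v` and `w`.
  have key : ∀ v w : E2, fderiv ℝ (chartRep (shapeOp α N) p) x₀ v (fderiv ℝ (chartRep α p) x₀ w)
      = -fderiv ℝ (fderiv ℝ (chartRep N p)) x₀ v w
        - chartRep (shapeOp α N) p x₀ (fderiv ℝ (fderiv ℝ (chartRep α p)) x₀ v w) := by
    intro v w
    have h1 := hB.clm_apply (hA.clm_apply (hasFDerivAt_const w x₀))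
    have h2 := (hn.clm_apply (hasFDerivAt_const w x₀)).neg
    have h3 : (fun x => chartRep (shapeOp α N) p x (fderiv ℝ (chartRep α p) x w)) =ᶠ[𝓝 x₀]
        fun x => -(fderiv ℝ (chartRep N p) x w) := by
      filter_upwards [eventually_chart p] with x ⟨q, hq, hqx, hxq⟩
      subst hqx
      have := (S.chart_data hq).2.2 w
      simpa only [chartRep, hxq] using this
    have h4 := h1.unique (h2.congr_of_eventuallyEq h3)
    have h5 := congrArg (fun l : E2 →L[ℝ] E3 => l v) h4
    simp at h5
    rw [← h5]; abel
  rw [key v w, key w v]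
  have s1 := (contDiffAt_chartRep hp (S.contMDiff p)).isSymmSndFDerivAt (by norm_num)
  have s2 := (contDiffAt_chartRep hp (S.contMDiff_normal p)).isSymmSndFDerivAt (by norm_num)
  rw [s1.eq, s2.eq]

/-- The derivative of the shape operator is symmetric. -/
theorem tderiv_shapeOp_symm (p : M) (v : E2) (u u' : E3) :
    inner ℝ (tderiv (shapeOp α N) p v u) u' = inner ℝ u (tderiv (shapeOp α N) p v u') := by
  have hp := mem_extChartAt_source (I := 𝓡 2) p
  rw [tderiv_eq_fderiv (S.mdifferentiableAt_shapeOp p)]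
  set x₀ := extChartAt (𝓡 2) p p with hx₀
  have hB : HasFDerivAt (chartRep (shapeOp α N) p) (fderiv ℝ (chartRep (shapeOp α N) p) x₀) x₀ :=
    ((contDiffAt_chartRep hp (S.contMDiff_shapeOp p)).differentiableAt (by norm_num)).hasFDerivAt
  have h1 := (hB.clm_apply (hasFDerivAt_const u x₀)).inner ℝ (hasFDerivAt_const u' x₀)
  have h2 := (hasFDerivAt_const u x₀).inner ℝ (hB.clm_apply (hasFDerivAt_const u' x₀))
  have h3 : (fun x => inner ℝ (chartRep (shapeOp α N) p x u) u')
      = fun x => inner ℝ u (chartRep (shapeOp α N) p x u') := by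
    funext x; exact (S.isShape _).symm u u'
  rw [h3] at h1
  have h5 := congrArg (fun l : E2 →L[ℝ] ℝ => l v) (h1.unique h2)
  simpa [fderivInnerCLM_apply] using h5

end IsOrientedImmersion

end Curvature

/-! ### The direction field of a foliation by lines of harmonic mean curvature -/

section DirectionField

variable {M : Type*} [TopologicalSpace M] [ChartedSpace E2 M]

/-- The elliptic points that are not umbilic. -/
def IsRegularPoint (α N : M → E3) (p : M) : Prop :=
  0 < gaussCurvature α N p ∧ meanCurvature α N p ^ 2 - gaussCurvature α N p ≠ 0

/-- The geodesic torsion of the lines of harmonic mean curvature, with the sign `ε`. -/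
def torsionFun (α N : M → E3) (ε : ℝ) (p : M) : ℝ :=
  ε * √(gaussCurvature α N p * (meanCurvature α N p ^ 2 - gaussCurvature α N p)
    / meanCurvature α N p ^ 2)

/-- The orthogonal projection to the direction of harmonic mean curvature with torsion of
sign `ε`. -/
def dirProj (α N : M → E3) (ε : ℝ) (p : M) : E3 →L[ℝ] E3 :=
  directionProj (shapeOp α N p) (N p) (harmonicCurvature α N p) (meanCurvature α N p)
    (torsionFun α N ε p) (meanCurvature α N p ^ 2 - gaussCurvature α N p)

/-- The unit vector of harmonic mean curvature closest to `u`. -/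
def dirField (α N : M → E3) (ε : ℝ) (u : E3) (p : M) : E3 :=
  ‖dirProj α N ε p u‖⁻¹ • dirProj α N ε p u

/-- `e` is a unit tangent vector at `p` of harmonic mean curvature with torsion of sign `ε`. -/
structure IsHarmonicDir (α N : M → E3) (ε : ℝ) (p : M) (e : E3) : Prop where
  isFrame : IsFrame (N p) e
  normal : inner ℝ (shapeOp α N p e) e = harmonicCurvature α N p
  torsion : inner ℝ (shapeOp α N p e) (cross (N p) e) = torsionFun α N ε p

theorem directionProj_smooth {E : Type*} [NormedAddCommGroup E] [NormedSpace ℝ E]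
    {B : E → E3 →L[ℝ] E3} {n : E → E3} {h H τ D : E → ℝ} {x : E} {k : WithTop ℕ∞}
    (hB : ContDiffAt ℝ k B x) (hn : ContDiffAt ℝ k n x) (hh : ContDiffAt ℝ k h x)
    (hH : ContDiffAt ℝ k H x) (hτ : ContDiffAt ℝ k τ x) (hD : ContDiffAt ℝ k D x)
    (hD0 : D x ≠ 0) :
    ContDiffAt ℝ k (fun y => directionProj (B y) (n y) (h y) (H y) (τ y) (D y)) x := by
  have hc : ContDiffAt ℝ k (fun y => crossL (n y)) x := crossL.contDiff.contDiffAt.comp x hn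
  have ht : ContDiffAt ℝ k (fun y => tangentialPart (n y)) x := (hc.clm_comp hc).neg
  have hB0 : ContDiffAt ℝ k (fun y => tracelessPart (B y) (n y) (H y)) x :=
    hB.sub (hH.smul ht)
  have h1 : ContDiffAt ℝ k (fun y => (D y)⁻¹ • ((h y - H y) • tracelessPart (B y) (n y) (H y)
      - τ y • (crossL (n y)).comp (tracelessPart (B y) (n y) (H y)))) x :=
    (hD.inv hD0).smul (((hh.sub hH).smul hB0).sub (hτ.smul (hc.clm_comp hB0)))
  have h2 : ContDiffAt ℝ k (fun _ : E => (1 / 2 : ℝ)) x := contDiffAt_const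
  exact h2.smul (ht.add h1)

namespace IsOrientedImmersion

variable {α N : M → E3} (S : IsOrientedImmersion α N) [IsManifold (𝓡 2) ∞ M]
include S

theorem disc_nonneg (p : M) : 0 ≤ meanCurvature α N p ^ 2 - gaussCurvature α N p := by
  obtain ⟨e, he⟩ := S.exists_isFrame p
  obtain ⟨h1, h2⟩ := S.curvatures_eq_of_isFrame he
  rw [h1, h2]
  nlinarith [sq_nonneg (inner ℝ (shapeOp α N p e) e
    - inner ℝ (shapeOp α N p (cross (N p) e)) (cross (N p) e)),
    sq_nonneg (inner ℝ (shapeOp α N p e) (cross (N p) e))]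

theorem disc_pos {p : M} (hp : IsRegularPoint α N p) :
    0 < meanCurvature α N p ^ 2 - gaussCurvature α N p :=
  lt_of_le_of_ne (S.disc_nonneg p) hp.2.symm

theorem mean_ne_zero {p : M} (hp : IsRegularPoint α N p) : meanCurvature α N p ≠ 0 := by
  intro h
  have := S.disc_nonneg p
  rw [h] at this
  have := hp.1
  linarith

theorem isOpen_regular : IsOpen {p | IsRegularPoint α N p} := by
  have h1 := S.contMDiff_curvatures.1.continuous
  have h2 := S.contMDiff_curvatures.2.continuous
  exact (isOpen_lt continuous_const h1).inter (isOpen_ne_fun ((h2.pow 2).sub h1) continuous_const)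

theorem radicand_pos {p : M} (hp : IsRegularPoint α N p) :
    0 < gaussCurvature α N p * (meanCurvature α N p ^ 2 - gaussCurvature α N p)
      / meanCurvature α N p ^ 2 :=
  div_pos (mul_pos hp.1 (S.disc_pos hp)) (by have := S.mean_ne_zero hp; positivity)

theorem torsionFun_sq {ε : ℝ} (hε : ε ^ 2 = 1) {p : M} (hp : IsRegularPoint α N p) :
    torsionFun α N ε p ^ 2 = gaussCurvature α N p
      * (meanCurvature α N p ^ 2 - gaussCurvature α N p) / meanCurvature α N p ^ 2 := by
  rw [torsionFun, mul_pow, hε, one_mul, Real.sq_sqrt (S.radicand_pos hp).le]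

/-- The point (h, τ) lies on the Mohr circle with centre (H, 0) and radius √(H² − K). This is the
condition under which `directionProj` is a projection. -/
theorem torsion_identity {ε : ℝ} (hε : ε ^ 2 = 1) {p : M} (hp : IsRegularPoint α N p) :
    (harmonicCurvature α N p - meanCurvature α N p) ^ 2 + torsionFun α N ε p ^ 2
      = meanCurvature α N p ^ 2 - gaussCurvature α N p := by
  rw [S.torsionFun_sq hε hp, harmonicCurvature]
  have := S.mean_ne_zero hp
  field_simp
  ring

theorem torsionFun_mul_pos {ε : ℝ} (hε : ε ^ 2 = 1) {p : M} (hp : IsRegularPoint α N p) :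
    0 < torsionFun α N ε p * ε := by
  have h := Real.sqrt_pos.2 (S.radicand_pos hp)
  rw [torsionFun]
  nlinarith

/-- In the frame the operator has diagonal entries h and 2H − h and determinant K, so the square of
the off-diagonal entry is h(2H − h) − K. -/
theorem torsion_sq_eq {ε : ℝ} (hε : ε ^ 2 = 1) {p : M} (hp : IsRegularPoint α N p) {e : E3}
    (he : IsFrame (N p) e) (hn : inner ℝ (shapeOp α N p e) e = harmonicCurvature α N p) :
    inner ℝ (shapeOp α N p e) (cross (N p) e) ^ 2 = torsionFun α N ε p ^ 2 := by
  obtain ⟨h1, h2⟩ := S.curvatures_eq_of_isFrame he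
  have h3 := S.torsion_identity hε hp
  rw [hn] at h1 h2
  have h4 : inner ℝ (shapeOp α N p (cross (N p) e)) (cross (N p) e)
    = 2 * meanCurvature α N p - harmonicCurvature α N p := by linarith
  rw [h4] at h1
  nlinarith

/-- The sign of the torsion selects the foliation. -/
theorem isHarmonicDir_of_sign {ε : ℝ} (hε : ε ^ 2 = 1) {p : M} (hp : IsRegularPoint α N p) {e : E3}
    (he : IsFrame (N p) e) (hn : inner ℝ (shapeOp α N p e) e = harmonicCurvature α N p)
    (hs : 0 < inner ℝ (shapeOp α N p e) (cross (N p) e) * ε) : IsHarmonicDir α N ε p e := by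
  refine ⟨he, hn, ?_⟩
  have h1 := S.torsionFun_mul_pos hε hp
  rcases sq_eq_sq_iff_eq_or_eq_neg.1 (S.torsion_sq_eq hε hp he hn) with h | h
  · exact h
  · rw [h] at hs; nlinarith

theorem dirProj_apply {ε : ℝ} (hε : ε ^ 2 = 1) {p : M} (hp : IsRegularPoint α N p) {e : E3}
    (he : IsHarmonicDir α N ε p e) (u : E3) : dirProj α N ε p u = inner ℝ u e • e :=
  directionProj_apply (S.isShape p) he.isFrame he.normal he.torsion
    (by rw [(S.curvatures_eq_of_isFrame he.isFrame).2]; ring) (S.torsion_identity hε hp) hp.2 u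

/-- The reference vector `u` only decides between e and −e. It can therefore be kept constant near a
point, which orients the line field locally. -/
theorem dirField_eq {ε : ℝ} (hε : ε ^ 2 = 1) {p : M} (hp : IsRegularPoint α N p) {e u : E3}
    (he : IsHarmonicDir α N ε p e) (hu : 0 < inner ℝ u e) :
    dirProj α N ε p u ≠ 0 ∧ dirField α N ε u p = e := by
  have h := S.dirProj_apply hε hp he u
  have he0 : e ≠ 0 := by
    intro h0; have := he.isFrame.norm_fst; rw [h0, norm_zero] at this; norm_num at this
  refine ⟨by rw [h]; exact smul_ne_zero hu.ne' he0, ?_⟩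
  rw [dirField, h, norm_smul, he.isFrame.norm_fst, mul_one, Real.norm_of_nonneg hu.le, smul_smul,
    inv_mul_cancel₀ hu.ne', one_smul]

/-- This supplies harmonic directions at points off `c`, where none is given beforehand: the image
of the projection, once nonzero, has the right normal curvature and torsion by `directionProj_spec`.
-/
theorem isHarmonicDir_dirField {ε : ℝ} (hε : ε ^ 2 = 1) {p : M} (hp : IsRegularPoint α N p)
    {u : E3} (hu : dirProj α N ε p u ≠ 0) : IsHarmonicDir α N ε p (dirField α N ε u p) := by
  obtain ⟨e, he⟩ := S.exists_isFrame p
  obtain ⟨h1, h2⟩ := S.curvatures_eq_of_isFrame he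
  obtain ⟨s1, s2, s3⟩ := directionProj_spec (S.isShape p) he (H := meanCurvature α N p)
    (by rw [h2]; ring) (by rw [← h1]; ring) (S.torsion_identity hε hp) hp.2 u
  change inner ℝ (dirProj α N ε p u) (N p) = 0 at s1
  change inner ℝ (shapeOp α N p (dirProj α N ε p u)) (dirProj α N ε p u)
    = harmonicCurvature α N p * inner ℝ (dirProj α N ε p u) (dirProj α N ε p u) at s2
  change inner ℝ (shapeOp α N p (dirProj α N ε p u)) (cross (N p) (dirProj α N ε p u))
    = torsionFun α N ε p * inner ℝ (dirProj α N ε p u) (dirProj α N ε p u) at s3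
  rw [real_inner_self_eq_norm_sq] at s2 s3
  have hw : ‖dirProj α N ε p u‖ ≠ 0 := norm_ne_zero_iff.2 hu
  refine ⟨⟨S.norm_normal p, ?_, ?_⟩, ?_, ?_⟩
  · rw [dirField, norm_smul, norm_inv, norm_norm, inv_mul_cancel₀ hw]
  · rw [dirField, real_inner_smul_right, real_inner_comm, s1, mul_zero]
  · rw [dirField, map_smul, real_inner_smul_left, real_inner_smul_right, s2]
    field_simp
  · rw [dirField, map_smul, cross_smul, real_inner_smul_left, real_inner_smul_right, s3]
    field_simp

theorem contMDiffAt_harmonicCurvature {p : M} (hp : IsRegularPoint α N p) :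
    ContMDiffAt (𝓡 2) 𝓘(ℝ, ℝ) (1 : ℕ) (harmonicCurvature α N) p := by
  have hs := mem_extChartAt_source (I := 𝓡 2) p
  have hpp : (extChartAt (𝓡 2) p).symm (extChartAt (𝓡 2) p p) = p :=
    (extChartAt (𝓡 2) p).left_inv hs
  refine contMDiffAt_of_chartRep hs (ContDiffAt.div
    (contDiffAt_chartRep hs (S.contMDiff_curvatures.1 p))
    (contDiffAt_chartRep hs (S.contMDiff_curvatures.2 p)) ?_)
  simp only [hpp]
  exact S.mean_ne_zero hp

theorem contMDiffAt_torsionFun (ε : ℝ) {p : M} (hp : IsRegularPoint α N p) :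
    ContMDiffAt (𝓡 2) 𝓘(ℝ, ℝ) (1 : ℕ) (torsionFun α N ε) p := by
  have hs := mem_extChartAt_source (I := 𝓡 2) p
  have hpp : (extChartAt (𝓡 2) p).symm (extChartAt (𝓡 2) p p) = p :=
    (extChartAt (𝓡 2) p).left_inv hs
  have hK := contDiffAt_chartRep hs (S.contMDiff_curvatures.1 p)
  have hH := contDiffAt_chartRep hs (S.contMDiff_curvatures.2 p)
  refine contMDiffAt_of_chartRep hs (contDiffAt_const.mul (ContDiffAt.sqrt
    ((hK.mul ((hH.pow 2).sub hK)).div (hH.pow 2) ?_) ?_))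
  · simp only [hpp]
    exact pow_ne_zero 2 (S.mean_ne_zero hp)
  · simp only [hpp]
    exact (S.radicand_pos hp).ne'

theorem contMDiffAt_dirProj (ε : ℝ) {p : M} (hp : IsRegularPoint α N p) :
    ContMDiffAt (𝓡 2) 𝓘(ℝ, E3 →L[ℝ] E3) (1 : ℕ) (dirProj α N ε) p := by
  have hs := mem_extChartAt_source (I := 𝓡 2) p
  have hpp : (extChartAt (𝓡 2) p).symm (extChartAt (𝓡 2) p p) = p :=
    (extChartAt (𝓡 2) p).left_inv hs
  have hK := contDiffAt_chartRep hs (S.contMDiff_curvatures.1 p)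
  have hH := contDiffAt_chartRep hs (S.contMDiff_curvatures.2 p)
  refine contMDiffAt_of_chartRep hs (directionProj_smooth
    (contDiffAt_chartRep hs (S.contMDiff_shapeOp p))
    ((contDiffAt_chartRep hs (S.contMDiff_normal p)).of_le (by norm_num))
    (contDiffAt_chartRep hs (S.contMDiffAt_harmonicCurvature hp)) hH
    (contDiffAt_chartRep hs (S.contMDiffAt_torsionFun ε hp)) ((hH.pow 2).sub hK) ?_)
  simp only [hpp]
  exact hp.2

end IsOrientedImmersion

end DirectionField

/-! ### Lines of harmonic mean curvature as integral curves -/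

section Lines

variable {M : Type*} [TopologicalSpace M] [ChartedSpace E2 M]

namespace IsOrientedImmersion

variable {α N : M → E3} (S : IsOrientedImmersion α N)
include S

theorem hasDerivAt_curve {γ : ℝ → M} {t : ℝ} (hγ : MDifferentiableAt 𝓘(ℝ, ℝ) (𝓡 2) γ t) :
    HasDerivAt (fun s => α (γ s)) (tangent α γ t) t :=
  (hasDerivAt_comp (S.mdifferentiableAt _) hγ).differentiableAt.hasDerivAt

theorem tangent_eq {γ : ℝ → M} {t : ℝ} (hγ : MDifferentiableAt 𝓘(ℝ, ℝ) (𝓡 2) γ t) :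
    tangent α γ t = tderiv α (γ t) (velocity γ t) :=
  (hasDerivAt_comp (S.mdifferentiableAt _) hγ).deriv

theorem hasDerivAt_normal {γ : ℝ → M} {t : ℝ} (hγ : MDifferentiableAt 𝓘(ℝ, ℝ) (𝓡 2) γ t) :
    HasDerivAt (fun s => N (γ s)) (-shapeOp α N (γ t) (tangent α γ t)) t := by
  rw [S.tangent_eq hγ, S.shapeOp_tderiv, neg_neg]
  exact hasDerivAt_comp (S.mdifferentiableAt_normal _) hγ

theorem isFrame_tangent {γ : ℝ → M} {t : ℝ} (hγ : MDifferentiableAt 𝓘(ℝ, ℝ) (𝓡 2) γ t)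
    (hu : ‖tangent α γ t‖ = 1) : IsFrame (N (γ t)) (tangent α γ t) :=
  ⟨S.norm_normal _, hu, by rw [S.tangent_eq hγ]; exact S.orthogonal _ _⟩

theorem normalCurvature_eq [IsManifold (𝓡 2) ∞ M] {γ : ℝ → M} {t : ℝ}
    (hγ : MDifferentiableAt 𝓘(ℝ, ℝ) (𝓡 2) γ t) (hu : ‖tangent α γ t‖ = 1) :
    normalCurvature α N (γ t) (mfderiv 𝓘(ℝ, ℝ) (𝓡 2) γ t (1 : ℝ))
      = inner ℝ (shapeOp α N (γ t) (tangent α γ t)) (tangent α γ t) := by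
  change secondForm α N (γ t) (velocity γ t) (velocity γ t)
    / firstForm α (γ t) (velocity γ t) (velocity γ t) = _
  rw [S.secondForm_eq, S.firstForm_eq, ← S.tangent_eq hγ, real_inner_self_eq_norm_sq, hu]
  simp

/-- Differentiate ⟨N ∧ T, N⟩ = 0. Differentiability of the conormal is a genuine hypothesis, as a
line is only required to be of class C¹. -/
theorem geodesicTorsion_eq {γ : ℝ → M} {t : ℝ} (hγ : MDifferentiableAt 𝓘(ℝ, ℝ) (𝓡 2) γ t)
    (hd : DifferentiableAt ℝ (conormal α N γ) t) :
    geodesicTorsion α N γ t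
      = inner ℝ (shapeOp α N (γ t) (tangent α γ t)) (cross (N (γ t)) (tangent α γ t)) := by
  have h1 := hd.hasDerivAt.inner ℝ (S.hasDerivAt_normal hγ)
  have h2 : (fun s => inner ℝ (conormal α N γ s) (N (γ s))) = fun _ => (0 : ℝ) := by
    funext s; exact inner_cross_left _ _
  rw [h2] at h1
  have h3 := h1.unique (hasDerivAt_const t (0 : ℝ))
  rw [inner_neg_right] at h3
  rw [geodesicTorsion, real_inner_comm (cross (N (γ t)) (tangent α γ t))]
  change _ = inner ℝ (conormal α N γ t) _
  linarith

variable [IsManifold (𝓡 2) ∞ M]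

/-- A line of harmonic mean curvature whose torsion has the sign `ε` is tangent to the
corresponding direction. -/
theorem isHarmonicDir_tangent {ε : ℝ} (hε : ε ^ 2 = 1) {γ : ℝ → M} {U : Set ℝ} (hU : IsOpen U)
    (h : IsHarmonicLineOn α N γ U) {t : ℝ} (ht : t ∈ U)
    (hs : 0 < geodesicTorsion α N γ t * ε) : IsHarmonicDir α N ε (γ t) (tangent α γ t) := by
  have hγ : MDifferentiableAt 𝓘(ℝ, ℝ) (𝓡 2) γ t :=
    (h.contMDiffOn.contMDiffAt (hU.mem_nhds ht)).mdifferentiableAt (by norm_num)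
  have hu := h.unit_speed t ht
  have hd : DifferentiableAt ℝ (conormal α N γ) t := by
    -- At a point where the conormal is not differentiable its `deriv` is 0 by convention; the
    -- torsion would vanish there, against `hs`.
    by_contra hd
    rw [geodesicTorsion, deriv_zero_of_not_differentiableAt hd, inner_zero_left] at hs
    simp at hs
  refine S.isHarmonicDir_of_sign hε ⟨h.elliptic t ht, h.not_umbilic t ht⟩
    (S.isFrame_tangent hγ hu) ?_ ?_
  · rw [← S.normalCurvature_eq hγ hu]; exact h.normalCurvature_eq t ht
  · rw [← S.geodesicTorsion_eq hγ hd]; exact hs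

/-- A curve tangent to the directions of harmonic mean curvature is a line of harmonic mean
curvature. -/
theorem isHarmonicLineOn_of_tangent {ε : ℝ} {γ : ℝ → M} {U : Set ℝ} (hU : IsOpen U)
    (hγ : ContMDiffOn 𝓘(ℝ, ℝ) (𝓡 2) 1 γ U) (hr : ∀ t ∈ U, IsRegularPoint α N (γ t))
    (h : ∀ t ∈ U, IsHarmonicDir α N ε (γ t) (tangent α γ t)) : IsHarmonicLineOn α N γ U := by
  have hd : ∀ t ∈ U, MDifferentiableAt 𝓘(ℝ, ℝ) (𝓡 2) γ t := fun t ht =>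
    (hγ.contMDiffAt (hU.mem_nhds ht)).mdifferentiableAt (by norm_num)
  exact ⟨hγ, fun t ht => (h t ht).isFrame.norm_fst, fun t ht => (hr t ht).1,
    fun t ht => (hr t ht).2, fun t ht => by
      rw [S.normalCurvature_eq (hd t ht) (h t ht).isFrame.norm_fst, (h t ht).normal]⟩

end IsOrientedImmersion

end Lines

/-! ### Regularity of a line of harmonic mean curvature and its Darboux frame -/

section DirectedLine

variable {M : Type*} [TopologicalSpace M] [ChartedSpace E2 M]

/-- A complete line of harmonic mean curvature with torsion of sign `ε`. -/
structure IsDirectedLine (α N : M → E3) (ε : ℝ) (c : ℝ → M) : Prop where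
  contMDiff : ContMDiff 𝓘(ℝ, ℝ) (𝓡 2) 1 c
  regular : ∀ t, IsRegularPoint α N (c t)
  dir : ∀ t, IsHarmonicDir α N ε (c t) (tangent α c t)

theorem contDiffAt_comp {F : Type*} [NormedAddCommGroup F] [NormedSpace ℝ F]
    {E : Type*} [NormedAddCommGroup E] [NormedSpace ℝ E] {f : M → F} {Θ : E → M} {x : E}
    (hf : ContMDiffAt (𝓡 2) 𝓘(ℝ, F) (1 : ℕ) f (Θ x)) (hΘ : ContMDiffAt 𝓘(ℝ, E) (𝓡 2) 1 Θ x) :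
    ContDiffAt ℝ 1 (fun y => f (Θ y)) x := by
  have := ContMDiffAt.comp x (by exact_mod_cast hf) hΘ
  exact contMDiffAt_iff_contDiffAt.1 this

theorem contDiffAt_normalize {E : Type*} [NormedAddCommGroup E] [NormedSpace ℝ E]
    {v : E → E3} {x : E} (hv : ContDiffAt ℝ 1 v x) (h0 : v x ≠ 0) :
    ContDiffAt ℝ 1 (fun y => ‖v y‖⁻¹ • v y) x :=
  ((hv.norm ℝ h0).inv (norm_ne_zero_iff.2 h0)).smul hv

namespace IsOrientedImmersion

variable {α N : M → E3} (S : IsOrientedImmersion α N)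
include S

theorem continuous_tangent {c : ℝ → M} (hc : ContMDiff 𝓘(ℝ, ℝ) (𝓡 2) 1 c) :
    Continuous (tangent α c) := by
  have h : ContDiff ℝ 1 (fun t => α (c t)) := by
    rw [contDiff_iff_contDiffAt]
    intro t
    exact contDiffAt_comp ((S.contMDiff _).of_le (by norm_num)) (hc t)
  exact h.continuous_deriv le_rfl

variable [IsManifold (𝓡 2) ∞ M]

/-- The torsion is continuous and never zero on the line, so its sign is constant. It is expressed
through the shape operator because at this stage T is known only to be continuous. -/
theorem exists_isDirectedLine {c : ℝ → M} (h : IsHarmonicLineOn α N c univ) :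
    ∃ ε : ℝ, ε ^ 2 = 1 ∧ IsDirectedLine α N ε c := by
  have hc : ContMDiff 𝓘(ℝ, ℝ) (𝓡 2) 1 c := contMDiffOn_univ.1 h.contMDiffOn
  have hr : ∀ t, IsRegularPoint α N (c t) := fun t =>
    ⟨h.elliptic t (mem_univ t), h.not_umbilic t (mem_univ t)⟩
  have hd : ∀ t, MDifferentiableAt 𝓘(ℝ, ℝ) (𝓡 2) c t := fun t =>
    (hc t).mdifferentiableAt (by norm_num)
  have hT := S.continuous_tangent hc
  have hN : Continuous (fun t => N (c t)) := S.contMDiff_normal.continuous.comp hc.continuous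
  have hB : Continuous (fun t => shapeOp α N (c t)) :=
    S.contMDiff_shapeOp.continuous.comp hc.continuous
  have hu := fun t => h.unit_speed t (mem_univ t)
  have hn : ∀ t, inner ℝ (shapeOp α N (c t) (tangent α c t)) (tangent α c t)
      = harmonicCurvature α N (c t) := fun t => by
    rw [← S.normalCurvature_eq (hd t) (hu t)]; exact h.normalCurvature_eq t (mem_univ t)
  set b : ℝ → ℝ := fun t => inner ℝ (shapeOp α N (c t) (tangent α c t))
    (cross (N (c t)) (tangent α c t)) with hb
  have hbc : Continuous b :=
    (hB.clm_apply hT).inner ((crossL.continuous.comp hN).clm_apply hT)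
  have hb0 : ∀ t, b t ≠ 0 := by
    intro t h0
    have h1 := S.torsion_sq_eq (ε := 1) (by norm_num) (hr t) (S.isFrame_tangent (hd t) (hu t)) (hn t)
    have h2 := S.torsionFun_mul_pos (ε := 1) (by norm_num) (hr t)
    change b t ^ 2 = _ at h1
    rw [h0] at h1
    nlinarith
  have key : (∀ t, 0 < b t) ∨ ∀ t, b t < 0 := by
    by_contra hcon
    push Not at hcon
    obtain ⟨⟨t₁, h1⟩, t₂, h2⟩ := hcon
    obtain ⟨t, ht⟩ := mem_range_of_exists_le_of_exists_ge hbc ⟨t₁, h1⟩ ⟨t₂, h2⟩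
    exact hb0 t ht
  rcases key with hpos | hneg
  · exact ⟨1, by norm_num, hc, hr, fun t => S.isHarmonicDir_of_sign (by norm_num) (hr t)
      (S.isFrame_tangent (hd t) (hu t)) (hn t) (by simpa using hpos t)⟩
  · refine ⟨-1, by norm_num, hc, hr, fun t => S.isHarmonicDir_of_sign (by norm_num) (hr t)
      (S.isFrame_tangent (hd t) (hu t)) (hn t) ?_⟩
    have := hneg t
    simp only [hb] at this
    linarith

end IsOrientedImmersion

namespace IsDirectedLine

variable {α N : M → E3} {ε : ℝ} {c : ℝ → M}

theorem mdifferentiableAt (hc : IsDirectedLine α N ε c) (t : ℝ) :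
    MDifferentiableAt 𝓘(ℝ, ℝ) (𝓡 2) c t :=
  (hc.contMDiff t).mdifferentiableAt (by norm_num)

variable [IsManifold (𝓡 2) ∞ M] (S : IsOrientedImmersion α N) (hε : ε ^ 2 = 1)
  (hc : IsDirectedLine α N ε c)
include S hε hc

/-- A gain of regularity from the foliation: near `t₀` the tangent at `t` is the value at `c t` of
the C¹ field `dirField` with the constant reference vector T(t₀), and `c` is of class C¹. -/
theorem contDiff_tangent : ContDiff ℝ 1 (tangent α c) := by
  rw [contDiff_iff_contDiffAt]
  intro t₀
  have hT := S.continuous_tangent hc.contMDiff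
  have hev : tangent α c =ᶠ[𝓝 t₀] fun t => dirField α N ε (tangent α c t₀) (c t) := by
    have h0 : 0 < inner ℝ (tangent α c t₀) (tangent α c t₀) := by
      rw [(hc.dir t₀).isFrame.inner_ee]; norm_num
    have := (continuous_const.inner hT : Continuous fun t =>
      inner ℝ (tangent α c t₀) (tangent α c t)).continuousAt.eventually (lt_mem_nhds h0)
    filter_upwards [this] with t ht
    exact (S.dirField_eq hε (hc.regular t) (hc.dir t) ht).2.symm
  refine ContDiffAt.congr_of_eventuallyEq ?_ hev
  have h1 : ContDiffAt ℝ 1 (fun t => dirProj α N ε (c t)) t₀ :=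
    contDiffAt_comp (S.contMDiffAt_dirProj ε (hc.regular t₀)) (hc.contMDiff t₀)
  refine contDiffAt_normalize (h1.clm_apply contDiffAt_const) ?_
  refine (S.dirField_eq hε (hc.regular t₀) (hc.dir t₀) ?_).1
  rw [(hc.dir t₀).isFrame.inner_ee]; norm_num

omit hε [IsManifold (𝓡 2) ∞ M] in
theorem contDiff_normal : ContDiff ℝ 1 (fun t => N (c t)) := by
  rw [contDiff_iff_contDiffAt]
  exact fun t => contDiffAt_comp ((S.contMDiff_normal _).of_le (by norm_num)) (hc.contMDiff t)

theorem contDiff_conormal : ContDiff ℝ 1 (conormal α N c) := by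
  rw [contDiff_iff_contDiffAt]
  exact fun t => (hc.contDiff_normal S).contDiffAt.cross_E3 (hc.contDiff_tangent S hε).contDiffAt

theorem hasDerivAt_tangent (t : ℝ) : HasDerivAt (tangent α c) (deriv (tangent α c) t) t :=
  ((hc.contDiff_tangent S hε).differentiable (by norm_num) t).hasDerivAt

theorem hasDerivAt_conormal (t : ℝ) :
    HasDerivAt (conormal α N c) (deriv (conormal α N c) t) t :=
  ((hc.contDiff_conormal S hε).differentiable (by norm_num) t).hasDerivAt

theorem geodesicTorsion_eq (t : ℝ) : geodesicTorsion α N c t = torsionFun α N ε (c t) := by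
  rw [S.geodesicTorsion_eq (hc.mdifferentiableAt t) (hc.hasDerivAt_conormal S hε t).differentiableAt]
  exact (hc.dir t).torsion

omit hε in
theorem shapeOp_conormal_inner (t : ℝ) :
    inner ℝ (shapeOp α N (c t) (conormal α N c t)) (conormal α N c t)
      = 2 * meanCurvature α N (c t) - harmonicCurvature α N (c t) := by
  have h := (S.curvatures_eq_of_isFrame (hc.dir t).isFrame).2
  rw [(hc.dir t).normal] at h
  change _ = (_ + inner ℝ (shapeOp α N (c t) (conormal α N c t)) (conormal α N c t)) / 2 at h
  linarith

theorem inner_deriv_tangent_tangent (t : ℝ) :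
    inner ℝ (deriv (tangent α c) t) (tangent α c t) = 0 := by
  have h1 := (hc.hasDerivAt_tangent S hε t).inner ℝ (hc.hasDerivAt_tangent S hε t)
  have h2 : (fun s => inner ℝ (tangent α c s) (tangent α c s)) = fun _ => (1 : ℝ) := by
    funext s; exact (hc.dir s).isFrame.inner_ee
  rw [h2] at h1
  have h3 := h1.unique (hasDerivAt_const t (1 : ℝ))
  rw [real_inner_comm (tangent α c t)] at h3
  rw [real_inner_comm]
  linarith

theorem inner_deriv_conormal_conormal (t : ℝ) :
    inner ℝ (deriv (conormal α N c) t) (conormal α N c t) = 0 := by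
  have h1 := (hc.hasDerivAt_conormal S hε t).inner ℝ (hc.hasDerivAt_conormal S hε t)
  have h2 : (fun s => inner ℝ (conormal α N c s) (conormal α N c s)) = fun _ => (1 : ℝ) := by
    funext s; exact (hc.dir s).isFrame.inner_ff
  rw [h2] at h1
  have h3 := h1.unique (hasDerivAt_const t (1 : ℝ))
  rw [real_inner_comm (conormal α N c t)] at h3
  rw [real_inner_comm]
  linarith

theorem inner_deriv_conormal_tangent (t : ℝ) :
    inner ℝ (deriv (conormal α N c) t) (tangent α c t) = -geodesicCurvature α N c t := by
  have h1 := (hc.hasDerivAt_conormal S hε t).inner ℝ (hc.hasDerivAt_tangent S hε t)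
  have h2 : (fun s => inner ℝ (conormal α N c s) (tangent α c s)) = fun _ => (0 : ℝ) := by
    funext s; exact inner_cross_right _ _
  rw [h2] at h1
  have h3 := h1.unique (hasDerivAt_const t (0 : ℝ))
  rw [geodesicCurvature, real_inner_comm (conormal α N c t)]
  linarith

theorem inner_deriv_tangent_normal (t : ℝ) :
    inner ℝ (deriv (tangent α c) t) (N (c t)) = harmonicCurvature α N (c t) := by
  have h1 := (hc.hasDerivAt_tangent S hε t).inner ℝ (S.hasDerivAt_normal (hc.mdifferentiableAt t))
  have h2 : (fun s => inner ℝ (tangent α c s) (N (c s))) = fun _ => (0 : ℝ) := by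
    funext s; exact (hc.dir s).isFrame.inner_en
  rw [h2] at h1
  have h3 := h1.unique (hasDerivAt_const t (0 : ℝ))
  rw [inner_neg_right, real_inner_comm (shapeOp α N (c t) (tangent α c t)), (hc.dir t).normal] at h3
  linarith

theorem deriv_tangent (t : ℝ) : deriv (tangent α c) t
    = geodesicCurvature α N c t • conormal α N c t + harmonicCurvature α N (c t) • N (c t) := by
  rw [(hc.dir t).isFrame.expand (deriv (tangent α c) t), hc.inner_deriv_tangent_tangent S hε,
    hc.inner_deriv_tangent_normal S hε, zero_smul, zero_add]
  rfl

theorem deriv_conormal (t : ℝ) : deriv (conormal α N c) t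
    = -geodesicCurvature α N c t • tangent α c t + torsionFun α N ε (c t) • N (c t) := by
  rw [← hc.geodesicTorsion_eq S hε, (hc.dir t).isFrame.expand (deriv (conormal α N c) t),
    hc.inner_deriv_conormal_tangent S hε]
  have := hc.inner_deriv_conormal_conormal S hε t
  change inner ℝ _ (cross (N (c t)) (tangent α c t)) = 0 at this
  rw [this, zero_smul, add_zero]
  rfl

theorem continuous_geodesicCurvature : Continuous (geodesicCurvature α N c) :=
  ((hc.contDiff_tangent S hε).continuous_deriv le_rfl).inner (hc.contDiff_conormal S hε).continuous

end IsDirectedLine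

end DirectedLine

/-! ### Moving coordinates along a line -/

section Tube

variable {M : Type*} [TopologicalSpace M] [ChartedSpace E2 M]

/-- The coordinates of `p` in the tangent plane at `c t`. -/
def movingCoord (α N : M → E3) (c : ℝ → M) (t : ℝ) (p : M) : ℝ × ℝ :=
  (inner ℝ (α p - α (c t)) (tangent α c t), inner ℝ (α p - α (c t)) (conormal α N c t))

omit [TopologicalSpace M] [ChartedSpace E2 M] in
theorem movingCoord_self (α N : M → E3) (c : ℝ → M) (t : ℝ) : movingCoord α N c t (c t) = 0 := by
  simp [movingCoord]

/-- `Θ` is, near time `t`, the inverse of the moving coordinates. -/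
structure IsTubeAt (α N : M → E3) (c : ℝ → M) (Θ : ℝ × (ℝ × ℝ) → M) (t : ℝ) : Prop where
  contMDiffAt : ContMDiffAt 𝓘(ℝ, ℝ × (ℝ × ℝ)) (𝓡 2) 1 Θ (t, 0)
  base : Θ (t, 0) = c t
  right_inv : ∀ᶠ q in 𝓝 ((t, 0) : ℝ × (ℝ × ℝ)), movingCoord α N c q.1 (Θ q) = q.2
  left_inv : ∀ᶠ q in 𝓝 ((t, c t) : ℝ × M), Θ (q.1, movingCoord α N c q.1 q.2) = q.2

variable {α N : M → E3} {ε : ℝ} {c : ℝ → M}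
variable [IsManifold (𝓡 2) ∞ M] (S : IsOrientedImmersion α N) (hε : ε ^ 2 = 1)
  (hc : IsDirectedLine α N ε c)
include S hε hc

/-- Time and point vary simultaneously. The motion of the origin contributes −τ' to the first
coordinate, as ⟨T, T⟩ = 1, and nothing to the second, as ⟨T, V⟩ = 0. The terms with T' and V' carry
the factor α(P) − α(c), which vanishes on the line. -/
theorem hasFDerivAt_movingCoord {E : Type*} [NormedAddCommGroup E] [NormedSpace ℝ E]
    {τ : E → ℝ} {P : E → M} {x : E} {τ' : E →L[ℝ] ℝ} {A : E →L[ℝ] E3} (hτ : HasFDerivAt τ τ' x)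
    (hP : HasFDerivAt (fun y => α (P y)) A x) :
    HasFDerivAt (fun y => movingCoord α N c (τ y) (P y))
      ((((innerSL ℝ (tangent α c (τ x))).comp A - τ')
        + (innerSL ℝ (α (P x) - α (c (τ x)))).comp (τ'.smulRight (deriv (tangent α c) (τ x)))).prod
       ((innerSL ℝ (conormal α N c (τ x))).comp A
        + (innerSL ℝ (α (P x) - α (c (τ x)))).comp
            (τ'.smulRight (deriv (conormal α N c) (τ x))))) x := by
  have hT := (hc.hasDerivAt_tangent S hε (τ x)).hasFDerivAt.comp x hτ
  have hV := (hc.hasDerivAt_conormal S hε (τ x)).hasFDerivAt.comp x hτ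
  have hα := (S.hasDerivAt_curve (hc.mdifferentiableAt (τ x))).hasFDerivAt.comp x hτ
  have hw := hP.sub hα
  have h1 := (hw.inner ℝ hT).prodMk (hw.inner ℝ hV)
  refine h1.congr_fderiv ?_
  ext1 v
  have e1 := (hc.dir (τ x)).isFrame.norm_fst
  have e2 : inner ℝ (tangent α c (τ x)) (conormal α N c (τ x)) = 0 := inner_right_cross _ _
  simp [fderivInnerCLM_apply, inner_sub_left, real_inner_smul_left, real_inner_smul_right, e1, e2,
    real_inner_comm (A v)]
  constructor <;> ring

theorem contDiffAt_movingCoord {E : Type*} [NormedAddCommGroup E] [NormedSpace ℝ E]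
    {τ : E → ℝ} {P : E → M} {x : E} (hτ : ContDiffAt ℝ 1 τ x)
    (hP : ContDiffAt ℝ 1 (fun y => α (P y)) x) :
    ContDiffAt ℝ 1 (fun y => movingCoord α N c (τ y) (P y)) x := by
  have hT : ContDiffAt ℝ 1 (fun y => tangent α c (τ y)) x :=
    (hc.contDiff_tangent S hε).contDiffAt.comp x hτ
  have hV : ContDiffAt ℝ 1 (fun y => conormal α N c (τ y)) x :=
    (hc.contDiff_conormal S hε).contDiffAt.comp x hτ
  have hα : ContDiffAt ℝ 1 (fun y => α (c (τ y))) x :=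
    ContDiffAt.comp x (g := fun t => α (c t))
      (contDiffAt_comp ((S.contMDiff _).of_le (by norm_num)) (hc.contMDiff _)) hτ
  exact ((hP.sub hα).inner ℝ hT).prodMk ((hP.sub hα).inner ℝ hV)

/-- Near a point of the line, the moving coordinates have a local inverse. -/
theorem exists_local_inverse (t₀ : ℝ) :
    (∃ u ∈ 𝓝 (t₀, c t₀), InjOn (fun q : ℝ × M => (q.1, movingCoord α N c q.1 q.2)) u) ∧
    ∃ Θ : ℝ × (ℝ × ℝ) → M, ContMDiffAt 𝓘(ℝ, ℝ × (ℝ × ℝ)) (𝓡 2) 1 Θ (t₀, 0) ∧ Θ (t₀, 0) = c t₀ ∧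
      ∀ᶠ q in 𝓝 ((t₀, 0) : ℝ × (ℝ × ℝ)), movingCoord α N c q.1 (Θ q) = q.2 := by
  set φ := extChartAt (𝓡 2) (c t₀) with hφ
  have hs : c t₀ ∈ φ.source := mem_extChartAt_source _
  have hpp : φ.symm (φ (c t₀)) = c t₀ := φ.left_inv hs
  set f : ℝ × E2 → ℝ × (ℝ × ℝ) := fun q => (q.1, movingCoord α N c q.1 (φ.symm q.2)) with hf
  set a : ℝ × E2 := (t₀, φ (c t₀)) with ha
  have hA : ContDiffAt ℝ 1 (chartRep α (c t₀)) (φ (c t₀)) :=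
    (contDiffAt_chartRep hs (S.contMDiff _)).of_le (by norm_num)
  have hP : ContDiffAt ℝ 1 (fun q : ℝ × E2 => α (φ.symm q.2)) a :=
    ContDiffAt.comp a (g := chartRep α (c t₀)) hA contDiffAt_snd
  have hfC : ContDiffAt ℝ 1 f a :=
    contDiffAt_fst.prodMk (contDiffAt_movingCoord S hε hc (τ := Prod.fst)
      (P := fun q : ℝ × E2 => φ.symm q.2) contDiffAt_fst hP)
  have hfa : f a = (t₀, 0) := by simp only [hf, ha, hpp, movingCoord_self]
  set A := fderiv ℝ (chartRep α (c t₀)) (φ (c t₀)) with hAdef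
  obtain ⟨hi, ho, -⟩ := S.chart_data hs
  have hPD : HasFDerivAt (fun q : ℝ × E2 => α (φ.symm q.2))
      (A.comp (ContinuousLinearMap.snd ℝ ℝ E2)) a :=
    HasFDerivAt.comp (g := chartRep α (c t₀)) (f := Prod.snd) a
      (hA.differentiableAt (by norm_num)).hasFDerivAt hasFDerivAt_snd
  have hfD := (hasFDerivAt_fst (𝕜 := ℝ) (p := a)).prodMk
    (hasFDerivAt_movingCoord S hε hc hasFDerivAt_fst hPD)
  set f' : ℝ × E2 →L[ℝ] ℝ × (ℝ × ℝ) := _ with hf'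
  replace hfD : HasFDerivAt f f' a := hfD
  -- At a point of the line the derivative is (s, w) ↦ (s, ⟨T, Aw⟩ − s, ⟨V, Aw⟩), and a tangent
  -- vector without T- and V-components is zero.
  have hinj : Function.Injective f' := by
    rw [injective_iff_map_eq_zero]
    rintro ⟨s, w⟩ h
    simp only [hf', ha, hpp, sub_self, map_zero, ContinuousLinearMap.zero_comp, add_zero,
      ContinuousLinearMap.prod_apply, Prod.mk_eq_zero] at h
    obtain ⟨h1, h2, h3⟩ := h
    have h1 : s = 0 := h1
    have h2 : inner ℝ (tangent α c t₀) (A w) - s = 0 := h2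
    have h3 : inner ℝ (conormal α N c t₀) (A w) = 0 := h3
    have hAw : A w = A 0 := by
      rw [map_zero]
      apply (hc.dir t₀).isFrame.ext
      · rw [inner_zero_left, real_inner_comm]; linarith
      · rw [inner_zero_left, real_inner_comm]; exact h3
      · rw [inner_zero_left, real_inner_comm]; exact ho w
    rw [h1, hi hAw]; rfl
  let e' : (ℝ × E2) ≃L[ℝ] ℝ × (ℝ × ℝ) :=
    (LinearEquiv.ofInjectiveOfFinrankEq (f' : (ℝ × E2) →ₗ[ℝ] ℝ × (ℝ × ℝ)) hinj
      (by simp)).toContinuousLinearEquiv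
  have he' : (e' : (ℝ × E2) →L[ℝ] ℝ × (ℝ × ℝ)) = f' := by ext v <;> rfl
  rw [← he'] at hfD
  set e := hfC.toOpenPartialHomeomorph f hfD (by norm_num) with he
  have hea : a ∈ e.source := hfC.mem_toOpenPartialHomeomorph_source hfD (by norm_num)
  have hef : ∀ q, e q = f q := fun q => rfl
  constructor
  · have hcont : ContinuousAt (fun q : ℝ × M => (q.1, φ q.2)) (t₀, c t₀) :=
      continuousAt_fst.prodMk (ContinuousAt.comp (f := Prod.snd) (g := φ) (x := (t₀, c t₀))
        (continuousAt_extChartAt (c t₀)) continuousAt_snd)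
    have hsrc : ∀ᶠ q : ℝ × M in 𝓝 (t₀, c t₀), q.2 ∈ φ.source :=
      continuousAt_snd.eventually ((isOpen_extChartAt_source (c t₀)).mem_nhds hs)
    refine ⟨_, (hcont.eventually (e.open_source.mem_nhds hea)).and hsrc, ?_⟩
    rintro ⟨t, p⟩ ⟨h1, h2⟩ ⟨t', p'⟩ ⟨h1', h2'⟩ h
    have h3 : e (t, φ p) = e (t', φ p') := by
      rw [hef, hef]
      simpa only [hf, φ.left_inv h2, φ.left_inv h2'] using h
    have h4 := e.injOn h1 h1' h3
    rw [Prod.mk.injEq] at h4 ⊢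
    exact ⟨h4.1, φ.injOn h2 h2' h4.2⟩
  · have h0 : ((t₀, 0) : ℝ × (ℝ × ℝ)) ∈ e.target := by rw [← hfa]; exact e.map_source hea
    have hsymm : e.symm (t₀, 0) = a := by rw [← hfa]; exact e.left_inv hea
    have hC : ContDiffAt ℝ 1 e.symm (t₀, 0) := by
      refine e.contDiffAt_symm (f₀' := e') h0 ?_ ?_
      · rw [hsymm]; exact hfD
      · rw [hsymm]; exact hfC
    have : IsManifold (𝓡 2) 1 M := IsManifold.of_le (n := ∞) (by norm_num)
    refine ⟨fun q => φ.symm (e.symm q).2, ?_, by simp only [hsymm]; exact hpp, ?_⟩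
    · have h1 : ContMDiffAt 𝓘(ℝ, E2) (𝓡 2) 1 φ.symm (e.symm (t₀, 0)).2 := by
        rw [hsymm]
        exact (contMDiffOn_extChartAt_symm (c t₀)).contMDiffAt
          ((isOpen_extChartAt_target (c t₀)).mem_nhds (φ.map_source hs))
      have h2 : ContDiffAt ℝ 1 (fun q => (e.symm q).2) (t₀, (0 : ℝ × ℝ)) :=
        contDiffAt_snd.comp _ hC
      exact ContMDiffAt.comp _ h1 (contMDiffAt_iff_contDiffAt.2 h2)
    · filter_upwards [e.open_target.mem_nhds h0] with q hq
      have h1 : f (e.symm q) = q := e.right_inv hq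
      have h2 : (e.symm q).1 = q.1 := congrArg Prod.fst h1
      have h3 := congrArg Prod.snd h1
      simp only [hf] at h3
      rw [← h2]; exact h3

/-- Inverse moving coordinates in a neighbourhood of a compact piece of the line. -/
theorem exists_tube [T2Space M] (a b : ℝ) :
    ∃ Θ : ℝ × (ℝ × ℝ) → M, ∀ t ∈ Icc a b, IsTubeAt α N c Θ t := by
  classical
  set f : ℝ × M → ℝ × (ℝ × ℝ) := fun q => (q.1, movingCoord α N c q.1 q.2) with hf
  set K : Set (ℝ × M) := (fun t => (t, c t)) '' Icc a b with hK
  have hKc : IsCompact K :=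
    isCompact_Icc.image (continuous_id.prodMk hc.contMDiff.continuous)
  have hcα : Continuous α := S.contMDiff.continuous
  have hfc : Continuous f := by
    have h1 : Continuous fun q : ℝ × M => α q.2 - α (c q.1) :=
      (hcα.comp continuous_snd).sub (hcα.comp (hc.contMDiff.continuous.comp continuous_fst))
    exact continuous_fst.prodMk
      ((h1.inner ((hc.contDiff_tangent S hε).continuous.comp continuous_fst)).prodMk
        (h1.inner ((hc.contDiff_conormal S hε).continuous.comp continuous_fst)))
  -- Time is a component of `f`, so `f` is injective on the graph of `c` even where `c` closes up.
  -- With local injectivity and compactness this extends to a neighbourhood `U`, on which the local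
  -- inverses must agree.
  have hKi : InjOn f K := by
    rintro _ ⟨t, -, rfl⟩ _ ⟨t', -, rfl⟩ h
    have : t = t' := congrArg Prod.fst h
    rw [this]
  obtain ⟨U, hU, hUi⟩ := hKi.exists_mem_nhdsSet hKc (fun x _ => hfc.continuousAt) (by
    rintro _ ⟨t, -, rfl⟩
    exact (exists_local_inverse S hε hc t).1)
  have hU' : ∀ t ∈ Icc a b, U ∈ 𝓝 (t, c t) := fun t ht =>
    mem_nhdsSet_iff_forall.1 hU _ ⟨t, ht, rfl⟩
  -- The value `c 0` off the image of `U` is arbitrary.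
  let Θ : ℝ × (ℝ × ℝ) → M := fun q =>
    if h : ∃ p, (q.1, p) ∈ U ∧ movingCoord α N c q.1 p = q.2 then h.choose else c 0
  have hΘ : ∀ q : ℝ × M, q ∈ U → Θ (q.1, movingCoord α N c q.1 q.2) = q.2 := by
    rintro ⟨t, p⟩ hq
    have h : ∃ p', (t, p') ∈ U ∧ movingCoord α N c t p' = movingCoord α N c t p := ⟨p, hq, rfl⟩
    have h1 : Θ (t, movingCoord α N c t p) = h.choose := dif_pos h
    have h2 := hUi h.choose_spec.1 hq (by simp only [hf, h.choose_spec.2])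
    rw [h1]
    exact congrArg Prod.snd h2
  refine ⟨Θ, fun t ht => ?_⟩
  obtain ⟨Θ₁, hC, h0, hinv⟩ := (exists_local_inverse S hε hc t).2
  have hev : Θ =ᶠ[𝓝 (t, 0)] Θ₁ := by
    have hcont : ContinuousAt (fun q : ℝ × (ℝ × ℝ) => (q.1, Θ₁ q)) (t, 0) :=
      continuousAt_fst.prodMk hC.continuousAt
    have h1 : ∀ᶠ q in 𝓝 ((t, 0) : ℝ × (ℝ × ℝ)), (q.1, Θ₁ q) ∈ U :=
      hcont.eventually (by simp only [h0]; exact hU' t ht)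
    filter_upwards [h1, hinv] with q h2 h3
    have := hΘ _ h2
    simp only [h3] at this
    exact this
  refine ⟨hC.congr_of_eventuallyEq hev, hev.self_of_nhds.trans h0, ?_, ?_⟩
  · filter_upwards [hev, hinv] with q h1 h2
    rw [h1, h2]
  · filter_upwards [hU' t ht] with q hq using hΘ q hq

end Tube

/-! ### The foliation in moving coordinates -/

section Field

variable {M : Type*} [TopologicalSpace M] [ChartedSpace E2 M]

/-- The direction field of the foliation in moving coordinates. -/
def tubeDir (α N : M → E3) (ε : ℝ) (c : ℝ → M) (Θ : ℝ × (ℝ × ℝ) → M) (q : ℝ × (ℝ × ℝ)) : E3 :=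
  dirField α N ε (tangent α c q.1) (Θ q)

/-- The differential equation of the foliation in moving coordinates. -/
def tubeField (α N : M → E3) (ε : ℝ) (c : ℝ → M) (Θ : ℝ × (ℝ × ℝ) → M) (t : ℝ) (y : ℝ × ℝ) :
    ℝ × ℝ :=
  (inner ℝ (tubeDir α N ε c Θ (t, y) - tangent α c t) (tangent α c t)
    + inner ℝ (α (Θ (t, y)) - α (c t)) (deriv (tangent α c) t),
   inner ℝ (tubeDir α N ε c Θ (t, y) - tangent α c t) (conormal α N c t)
    + inner ℝ (α (Θ (t, y)) - α (c t)) (deriv (conormal α N c) t))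

/-- The conditions on a point of the tube under which moving coordinates can be used. -/
structure IsGood (α N : M → E3) (ε : ℝ) (c : ℝ → M) (Θ : ℝ × (ℝ × ℝ) → M)
    (q : ℝ × (ℝ × ℝ)) : Prop where
  contMDiffAt : ContMDiffAt 𝓘(ℝ, ℝ × (ℝ × ℝ)) (𝓡 2) 1 Θ q
  regular : IsRegularPoint α N (Θ q)
  proj_ne : dirProj α N ε (Θ q) (tangent α c q.1) ≠ 0
  normal : 0 < inner ℝ (N (Θ q)) (N (c q.1))
  forward : 0 < inner ℝ (tubeDir α N ε c Θ q) (tangent α c q.1)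
  right_inv : ∀ᶠ q' in 𝓝 q, movingCoord α N c q'.1 (Θ q') = q'.2
  left_inv : ∀ᶠ r in 𝓝 ((q.1, Θ q) : ℝ × M), Θ (r.1, movingCoord α N c r.1 r.2) = r.2

variable {α N : M → E3} {ε : ℝ} {c : ℝ → M} {Θ : ℝ × (ℝ × ℝ) → M}
variable [IsManifold (𝓡 2) ∞ M] (S : IsOrientedImmersion α N) (hε : ε ^ 2 = 1)
  (hc : IsDirectedLine α N ε c)
include S hε hc

theorem contDiffAt_tubeDir {q : ℝ × (ℝ × ℝ)}
    (hΘ : ContMDiffAt 𝓘(ℝ, ℝ × (ℝ × ℝ)) (𝓡 2) 1 Θ q) (hr : IsRegularPoint α N (Θ q))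
    (hp : dirProj α N ε (Θ q) (tangent α c q.1) ≠ 0) :
    ContDiffAt ℝ 1 (tubeDir α N ε c Θ) q := by
  have h1 : ContDiffAt ℝ 1 (fun q => dirProj α N ε (Θ q)) q :=
    contDiffAt_comp (S.contMDiffAt_dirProj ε hr) hΘ
  have h2 : ContDiffAt ℝ 1 (fun q : ℝ × (ℝ × ℝ) => tangent α c q.1) q :=
    (hc.contDiff_tangent S hε).contDiffAt.comp q contDiffAt_fst
  exact contDiffAt_normalize (h1.clm_apply h2) hp

theorem tubeDir_base {t : ℝ} (h : Θ (t, 0) = c t) :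
    dirProj α N ε (Θ (t, 0)) (tangent α c t) ≠ 0 ∧ tubeDir α N ε c Θ (t, 0) = tangent α c t := by
  rw [tubeDir]
  simp only [h]
  exact S.dirField_eq hε (hc.regular t) (hc.dir t) (by rw [(hc.dir t).isFrame.inner_ee]; norm_num)

theorem tubeField_zero {t : ℝ} (h : Θ (t, 0) = c t) : tubeField α N ε c Θ t 0 = 0 := by
  simp only [tubeField, (tubeDir_base S hε hc h).2, h]
  simp

/-- Each condition is open and holds on the line itself, where X = T. -/
theorem eventually_isGood {t₀ : ℝ} (h : IsTubeAt α N c Θ t₀) :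
    ∀ᶠ q in 𝓝 ((t₀, 0) : ℝ × (ℝ × ℝ)), IsGood α N ε c Θ q := by
  have : IsManifold (𝓡 2) 1 M := IsManifold.of_le (n := ∞) (by norm_num)
  obtain ⟨hp0, hd0⟩ := tubeDir_base S hε hc h.base
  have hr0 : IsRegularPoint α N (Θ (t₀, 0)) := by rw [h.base]; exact hc.regular t₀
  have hcd := contDiffAt_tubeDir S hε hc h.contMDiffAt hr0 hp0
  have hΘ := h.contMDiffAt.continuousAt
  have hT := (hc.contDiff_tangent S hε).continuous
  have hN := S.contMDiff_normal.continuous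
  have hTq : ContinuousAt (fun q : ℝ × (ℝ × ℝ) => tangent α c q.1) (t₀, 0) :=
    (hT.comp continuous_fst).continuousAt
  have hNΘ : ContinuousAt (fun q => N (Θ q)) (t₀, 0) := hN.continuousAt.comp hΘ
  have hNc : ContinuousAt (fun q : ℝ × (ℝ × ℝ) => N (c q.1)) (t₀, 0) :=
    (hN.comp (hc.contMDiff.continuous.comp continuous_fst)).continuousAt
  have e1 := contMDiffAt_iff_contMDiffAt_nhds (by simp) |>.1 h.contMDiffAt
  have e2 := hΘ.eventually (S.isOpen_regular.mem_nhds hr0)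
  have e3 : ∀ᶠ q in 𝓝 ((t₀, 0) : ℝ × (ℝ × ℝ)), dirProj α N ε (Θ q) (tangent α c q.1) ≠ 0 := by
    have h1 : ContinuousAt (fun q => dirProj α N ε (Θ q)) (t₀, 0) :=
      (contDiffAt_comp (S.contMDiffAt_dirProj ε hr0) h.contMDiffAt).continuousAt
    exact (h1.clm_apply hTq).eventually_ne hp0
  have e4 : ∀ᶠ q in 𝓝 ((t₀, 0) : ℝ × (ℝ × ℝ)), 0 < inner ℝ (N (Θ q)) (N (c q.1)) := by
    refine (hNΘ.inner hNc).eventually (lt_mem_nhds ?_)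
    simp only [h.base]
    rw [(hc.dir t₀).isFrame.inner_nn]; norm_num
  have e5 : ∀ᶠ q in 𝓝 ((t₀, 0) : ℝ × (ℝ × ℝ)),
      0 < inner ℝ (tubeDir α N ε c Θ q) (tangent α c q.1) := by
    refine (hcd.continuousAt.inner hTq).eventually (lt_mem_nhds ?_)
    simp only [hd0]
    rw [(hc.dir t₀).isFrame.inner_ee]; norm_num
  have e6 := h.right_inv.eventually_nhds
  have e7 : ∀ᶠ q in 𝓝 ((t₀, 0) : ℝ × (ℝ × ℝ)),
      ∀ᶠ r in 𝓝 ((q.1, Θ q) : ℝ × M), Θ (r.1, movingCoord α N c r.1 r.2) = r.2 := by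
    have h1 : ContinuousAt (fun q : ℝ × (ℝ × ℝ) => (q.1, Θ q)) (t₀, 0) :=
      continuousAt_fst.prodMk hΘ
    exact h1.eventually (by simp only [h.base]; exact h.left_inv.eventually_nhds)
  filter_upwards [e1, e2, e3, e4, e5, e6, e7] with q g1 g2 g3 g4 g5 g6 g7
  exact ⟨g1, g2, g3, g4, g5, g6, g7⟩

omit [IsManifold (𝓡 2) ∞ M] hε hc in
theorem contDiffAt_tubePoint {q : ℝ × (ℝ × ℝ)}
    (hΘ : ContMDiffAt 𝓘(ℝ, ℝ × (ℝ × ℝ)) (𝓡 2) 1 Θ q) :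
    ContDiffAt ℝ 1 (fun q => α (Θ q)) q :=
  contDiffAt_comp ((S.contMDiff _).of_le (by norm_num)) hΘ

theorem IsGood.contDiffAt_tubeDir {q : ℝ × (ℝ × ℝ)} (h : IsGood α N ε c Θ q) :
    ContDiffAt ℝ 1 (tubeDir α N ε c Θ) q :=
  HarmonicLines.contDiffAt_tubeDir S hε hc h.contMDiffAt h.regular h.proj_ne

theorem continuousAt_tubeField {q : ℝ × (ℝ × ℝ)} (h : IsGood α N ε c Θ q) :
    ContinuousAt (fun q : ℝ × (ℝ × ℝ) => tubeField α N ε c Θ q.1 q.2) q := by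
  have hT : ContinuousAt (fun q : ℝ × (ℝ × ℝ) => tangent α c q.1) q :=
    ((hc.contDiff_tangent S hε).continuous.comp continuous_fst).continuousAt
  have hV : ContinuousAt (fun q : ℝ × (ℝ × ℝ) => conormal α N c q.1) q :=
    ((hc.contDiff_conormal S hε).continuous.comp continuous_fst).continuousAt
  have hT' : ContinuousAt (fun q : ℝ × (ℝ × ℝ) => deriv (tangent α c) q.1) q :=
    (((hc.contDiff_tangent S hε).continuous_deriv le_rfl).comp continuous_fst).continuousAt
  have hV' : ContinuousAt (fun q : ℝ × (ℝ × ℝ) => deriv (conormal α N c) q.1) q :=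
    (((hc.contDiff_conormal S hε).continuous_deriv le_rfl).comp continuous_fst).continuousAt
  have hα : ContinuousAt (fun q : ℝ × (ℝ × ℝ) => α (c q.1)) q :=
    (S.contMDiff.continuous.comp (hc.contMDiff.continuous.comp continuous_fst)).continuousAt
  have hx := (contDiffAt_tubePoint S h.contMDiffAt).continuousAt
  have hX := (h.contDiffAt_tubeDir S hε hc).continuousAt
  exact ((((hX.sub hT).inner hT).add ((hx.sub hα).inner hT')).prodMk
    (((hX.sub hT).inner hV).add ((hx.sub hα).inner hV')))

/-- The differential of the inverse moving coordinates, seen in 3-space. -/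
theorem tubePoint_fderiv {t₀ : ℝ} (h : IsTubeAt α N c Θ t₀) (v : ℝ × (ℝ × ℝ)) :
    fderiv ℝ (fun q => α (Θ q)) (t₀, 0) v
      = (v.1 + v.2.1) • tangent α c t₀ + v.2.2 • conormal α N c t₀ := by
  have hx := ((contDiffAt_tubePoint S h.contMDiffAt).differentiableAt
    (by norm_num)).hasFDerivAt
  set A := fderiv ℝ (fun q => α (Θ q)) (t₀, 0) with hA
  have h1 := hasFDerivAt_movingCoord S hε hc
    (hasFDerivAt_fst (𝕜 := ℝ) (p := ((t₀, 0) : ℝ × (ℝ × ℝ)))) hx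
  have h2 := h1.unique
    ((hasFDerivAt_snd (𝕜 := ℝ) (p := ((t₀, 0) : ℝ × (ℝ × ℝ)))).congr_of_eventuallyEq h.right_inv)
  have h3 := congrArg (fun l : ℝ × (ℝ × ℝ) →L[ℝ] ℝ × ℝ => l v) h2
  simp only [h.base, sub_self, map_zero, ContinuousLinearMap.zero_comp, add_zero,
    ContinuousLinearMap.prod_apply] at h3
  have h4 : inner ℝ (tangent α c t₀) (A v) - v.1 = v.2.1 := congrArg Prod.fst h3
  have h5 : inner ℝ (conormal α N c t₀) (A v) = v.2.2 := congrArg Prod.snd h3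
  have h6 : inner ℝ (N (c t₀)) (A v) = 0 := by
    have h7 := (hasFDerivAt_comp (S.mdifferentiableAt _)
      (h.contMDiffAt.mdifferentiableAt (by norm_num))).unique hx
    rw [← h7, h.base]
    exact S.orthogonal _ _
  have := (hc.dir t₀).isFrame.expand (A v)
  rw [real_inner_comm (N (c t₀)), h6, zero_smul, add_zero, real_inner_comm (tangent α c t₀)] at this
  rw [this, show inner ℝ (tangent α c t₀) (A v) = v.1 + v.2.1 by linarith, real_inner_comm]
  change _ + inner ℝ (conormal α N c t₀) (A v) • conormal α N c t₀ = _
  rw [h5]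

/-- The differential of `Θ` at a point of the line. -/
theorem tderiv_tube {t₀ : ℝ} (h : IsTubeAt α N c Θ t₀) (v : ℝ × (ℝ × ℝ)) :
    tderiv α (c t₀) (mapDeriv Θ (t₀, 0) v)
      = (v.1 + v.2.1) • tangent α c t₀ + v.2.2 • conormal α N c t₀ := by
  have h7 := (hasFDerivAt_comp (S.mdifferentiableAt _)
      (h.contMDiffAt.mdifferentiableAt (by norm_num))).fderiv
  rw [← tubePoint_fderiv S hε hc h v, h7, h.base]
  rfl

theorem mfderiv_tube_conormal {t₀ : ℝ} (h : IsTubeAt α N c Θ t₀) :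
    mapDeriv Θ (t₀, 0) (0, (0, 1))
      = conormalVector α N c t₀ := by
  have h1 := tderiv_tube S hε hc h (0, (0, 1))
  rw [add_zero, zero_smul, zero_add, one_smul] at h1
  have h2 := Function.leftInverse_invFun (S.injective (c t₀))
    (mapDeriv Θ (t₀, 0) (0, (0, 1)))
  rw [h1] at h2
  exact h2.symm

/-- The derivative of the harmonic mean curvature along the conormal in moving coordinates. -/
theorem harmonicCurvatureDeriv_eq {t₀ : ℝ} (h : IsTubeAt α N c Θ t₀) :
    harmonicCurvatureDeriv α N c t₀
      = fderiv ℝ (fun q => harmonicCurvature α N (Θ q)) (t₀, 0) (0, (0, 1)) := by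
  have hr : IsRegularPoint α N (Θ (t₀, 0)) := by rw [h.base]; exact hc.regular t₀
  rw [(hasFDerivAt_comp ((S.contMDiffAt_harmonicCurvature hr).mdifferentiableAt (by norm_num))
    (h.contMDiffAt.mdifferentiableAt (by norm_num))).fderiv]
  change _ = tderiv (harmonicCurvature α N) (Θ (t₀, 0))
    (mapDeriv Θ (t₀, 0) (0, (0, 1)))
  rw [mfderiv_tube_conormal S hε hc h, h.base]
  rfl

/-- The definition works pointwise, through an inverse function and tangent spaces identified by
varying charts. In moving coordinates it becomes a partial derivative of a C¹ function, and
continuity is visible. -/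
theorem continuous_harmonicCurvatureDeriv [T2Space M] :
    Continuous (harmonicCurvatureDeriv α N c) := by
  rw [continuous_iff_continuousAt]
  intro t₀
  obtain ⟨Θ, hΘ⟩ := exists_tube S hε hc (t₀ - 1) (t₀ + 1)
  have h0 := hΘ t₀ ⟨by linarith, by linarith⟩
  have hr : IsRegularPoint α N (Θ (t₀, 0)) := by rw [h0.base]; exact hc.regular t₀
  have h1 : ContDiffAt ℝ 1 (fun q => harmonicCurvature α N (Θ q)) (t₀, 0) :=
    contDiffAt_comp (S.contMDiffAt_harmonicCurvature hr) h0.contMDiffAt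
  have h2 : ContinuousAt (fun t : ℝ => fderiv ℝ (fun q => harmonicCurvature α N (Θ q)) (t, 0)
      (0, (0, 1))) t₀ := by
    have h3 : ContinuousAt (fun t : ℝ => ((t, 0) : ℝ × (ℝ × ℝ))) t₀ :=
      continuousAt_id.prodMk continuousAt_const
    have h4 := h1.continuousAt_fderiv (by norm_num)
    exact (ContinuousAt.comp (f := fun t : ℝ => ((t, 0) : ℝ × (ℝ × ℝ))) h4 h3).clm_apply
      continuousAt_const
  refine h2.congr ?_
  filter_upwards [Icc_mem_nhds (show t₀ - 1 < t₀ by linarith) (show t₀ < t₀ + 1 by linarith)]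
    with t ht
  exact (harmonicCurvatureDeriv_eq S hε hc (hΘ t ht)).symm

theorem continuous_returnIntegrand [T2Space M] : Continuous (returnIntegrand α N c) := by
  have hne : ∀ t, geodesicTorsion α N c t ≠ 0 := fun t h => by
    have := S.torsionFun_mul_pos hε (hc.regular t)
    rw [← hc.geodesicTorsion_eq S hε, h] at this
    simp at this
  have hτ : Continuous (geodesicTorsion α N c) := by
    rw [continuous_iff_continuousAt]
    intro t
    have := (contDiffAt_comp (S.contMDiffAt_torsionFun ε (hc.regular t)) (hc.contMDiff t)).continuousAt
    exact this.congr (Eventually.of_forall fun s => (hc.geodesicTorsion_eq S hε s).symm)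
  have hH : Continuous fun t => meanCurvature α N (c t) :=
    S.contMDiff_curvatures.2.continuous.comp hc.contMDiff.continuous
  have hh : Continuous fun t => harmonicCurvature α N (c t) := by
    rw [continuous_iff_continuousAt]
    exact fun t => (contDiffAt_comp (S.contMDiffAt_harmonicCurvature (hc.regular t))
      (hc.contMDiff t)).continuousAt
  exact ((continuous_harmonicCurvatureDeriv S hε hc).div (continuous_const.mul hτ)
    (fun t => mul_ne_zero two_ne_zero (hne t))).add
    (((hc.continuous_geodesicCurvature S hε).div hτ hne).mul (hH.sub hh))

/-- The direction field in moving coordinates depends, locally, only on the point. -/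
theorem tubeDir_eventuallyEq {t₀ : ℝ} (h : IsTubeAt α N c Θ t₀) :
    tubeDir α N ε c Θ =ᶠ[𝓝 (t₀, 0)] fun q => dirField α N ε (tangent α c t₀) (Θ q) := by
  obtain ⟨hp0, hd0⟩ := tubeDir_base S hε hc h.base
  have hr0 : IsRegularPoint α N (Θ (t₀, 0)) := by rw [h.base]; exact hc.regular t₀
  have hcd := contDiffAt_tubeDir S hε hc h.contMDiffAt hr0 hp0
  have e1 : ∀ᶠ q in 𝓝 ((t₀, 0) : ℝ × (ℝ × ℝ)),
      0 < inner ℝ (tangent α c t₀) (tubeDir α N ε c Θ q) := by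
    refine (continuousAt_const.inner hcd.continuousAt).eventually (lt_mem_nhds ?_)
    simp only [hd0]
    rw [(hc.dir t₀).isFrame.inner_ee]; norm_num
  filter_upwards [e1, eventually_isGood S hε hc h] with q h1 h2
  exact (S.dirField_eq hε h2.regular (S.isHarmonicDir_dirField hε h2.regular h2.proj_ne) h1).2.symm

/-- The linearized equation of the foliation along the line. -/
theorem tubeDir_fderiv {t₀ : ℝ} (h : IsTubeAt α N c Θ t₀) (y : ℝ × ℝ) :
    2 * torsionFun α N ε (c t₀) *
      inner ℝ (fderiv ℝ (tubeDir α N ε c Θ) (t₀, 0) (0, y)) (conormal α N c t₀)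
    = 2 * torsionFun α N ε (c t₀) * geodesicCurvature α N c t₀ * y.1
      + (harmonicCurvatureDeriv α N c t₀ - deriv (fun t => torsionFun α N ε (c t)) t₀
        + 2 * geodesicCurvature α N c t₀
          * (meanCurvature α N (c t₀) - harmonicCurvature α N (c t₀))) * y.2 := by
  obtain ⟨hp0, hd0⟩ := tubeDir_base S hε hc h.base
  have hr0 : IsRegularPoint α N (Θ (t₀, 0)) := by rw [h.base]; exact hc.regular t₀
  have hXd := ((contDiffAt_tubeDir S hε hc h.contMDiffAt hr0 hp0).differentiableAt
    (by norm_num)).hasFDerivAt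
  set DX := fderiv ℝ (tubeDir α N ε c Θ) (t₀, 0) with hDX
  have hΘm := h.contMDiffAt.mdifferentiableAt (by norm_num)
  set DΘ := mapDeriv Θ (t₀, 0) with hDΘ
  have hΘv := tderiv_tube S hε hc h
  have hU : DΘ (1, 0) = velocity c t₀ := by
    apply S.injective (c t₀)
    rw [hΘv, ← S.tangent_eq (hc.mdifferentiableAt t₀)]
    simp
  -- The time axis and the first coordinate axis have the same image under the differential. Since X
  -- locally depends on the point alone, its derivative in the first coordinate is T'.
  have hU' : DΘ (0, (1, 0)) = DΘ (1, 0) := by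
    apply S.injective (c t₀)
    rw [hΘv, hΘv]
    simp
  -- the derivative along the line
  have hDX1 : DX (1, 0) = deriv (tangent α c) t₀ := by
    have h1 : HasDerivAt (fun t : ℝ => ((t, 0) : ℝ × (ℝ × ℝ))) (1, 0) t₀ :=
      (hasDerivAt_id t₀).prodMk (hasDerivAt_const t₀ 0)
    have h2 := HasFDerivAt.comp_hasDerivAt (f := fun t : ℝ => ((t, 0) : ℝ × (ℝ × ℝ))) t₀ hXd h1
    refine (h2.congr_of_eventuallyEq ?_).unique (hc.hasDerivAt_tangent S hε t₀)
    have h3 : ContinuousAt (fun t : ℝ => ((t, c t) : ℝ × M)) t₀ :=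
      continuousAt_id.prodMk hc.contMDiff.continuous.continuousAt
    filter_upwards [h3.eventually h.left_inv] with t ht
    simp only [movingCoord_self] at ht
    exact (tubeDir_base S hε hc ht).2.symm
  have hDX2 : DX (0, (1, 0)) = DX (1, 0) := by
    have hm : MDifferentiableAt (𝓡 2) 𝓘(ℝ, E3) (dirField α N ε (tangent α c t₀)) (Θ (t₀, 0)) := by
      have hs := mem_extChartAt_source (I := 𝓡 2) (Θ (t₀, 0))
      have h1 := contDiffAt_chartRep hs (S.contMDiffAt_dirProj ε hr0)
      have hpp := (extChartAt (𝓡 2) (Θ (t₀, 0))).left_inv hs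
      have h2 : ContDiffAt ℝ (1 : ℕ) (chartRep (dirField α N ε (tangent α c t₀)) (Θ (t₀, 0)))
          (extChartAt (𝓡 2) (Θ (t₀, 0)) (Θ (t₀, 0))) := by
        refine contDiffAt_normalize (h1.clm_apply contDiffAt_const) ?_
        simp only [hpp]
        exact hp0
      exact (contMDiffAt_of_chartRep hs h2).mdifferentiableAt (by norm_num)
    have h2 := (hXd.congr_of_eventuallyEq (tubeDir_eventuallyEq S hε hc h).symm).unique
      (hasFDerivAt_comp hm hΘm)
    rw [h2, ContinuousLinearMap.comp_apply, ContinuousLinearMap.comp_apply]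
    exact congrArg _ hU'
  -- the derivative along the conormal
  set W := DΘ (0, (0, 1)) with hW
  have hWV : tderiv α (c t₀) W = conormal α N c t₀ := by rw [hΘv]; simp
  have hWc : W = conormalVector α N c t₀ := mfderiv_tube_conormal S hε hc h
  have hB : HasFDerivAt (fun q => shapeOp α N (Θ q)) _ (t₀, 0) :=
    hasFDerivAt_comp (S.mdifferentiableAt_shapeOp _) hΘm
  have hh : HasFDerivAt (fun q => harmonicCurvature α N (Θ q)) _ (t₀, 0) :=
    hasFDerivAt_comp ((S.contMDiffAt_harmonicCurvature hr0).mdifferentiableAt (by norm_num)) hΘm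
  have hgood := eventually_isGood S hε hc h
  -- Here `q1` differentiates ⟨X, X⟩ = 1 along V, `q2` differentiates ⟨BX, X⟩ = h along V, and `q3`
  -- differentiates ⟨BT, V⟩ = τ along T.
  have key : 2 * torsionFun α N ε (c t₀) * inner ℝ (DX (0, (0, 1))) (conormal α N c t₀)
      = harmonicCurvatureDeriv α N c t₀ - deriv (fun t => torsionFun α N ε (c t)) t₀
        + 2 * geodesicCurvature α N c t₀
          * (meanCurvature α N (c t₀) - harmonicCurvature α N (c t₀)) := by
    have fr := hc.dir t₀
    have hBT : shapeOp α N (c t₀) (tangent α c t₀) = harmonicCurvature α N (c t₀) • tangent α c t₀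
        + torsionFun α N ε (c t₀) • conormal α N c t₀ := by
      have := (S.isShape (c t₀)).apply_fst fr.isFrame
      rwa [fr.normal, fr.torsion] at this
    have q1 : inner ℝ (DX (0, (0, 1))) (tangent α c t₀) = 0 := by
      have h1 := hXd.inner ℝ hXd
      have h2 : (fun q => inner ℝ (tubeDir α N ε c Θ q) (tubeDir α N ε c Θ q))
          =ᶠ[𝓝 (t₀, 0)] fun _ => (1 : ℝ) := by
        filter_upwards [hgood] with q hq
        exact (S.isHarmonicDir_dirField hε hq.regular hq.proj_ne).isFrame.inner_ee
      have h3 := congrArg (fun l : ℝ × (ℝ × ℝ) →L[ℝ] ℝ => l (0, (0, 1)))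
        (h1.unique ((hasFDerivAt_const (1 : ℝ) _).congr_of_eventuallyEq h2))
      have h4 : inner ℝ (tubeDir α N ε c Θ (t₀, 0)) (DX (0, (0, 1)))
        + inner ℝ (DX (0, (0, 1))) (tubeDir α N ε c Θ (t₀, 0)) = 0 := h3
      rw [hd0, real_inner_comm (DX (0, (0, 1)))] at h4
      linarith
    have q2 : inner ℝ (tderiv (shapeOp α N) (c t₀) W (tangent α c t₀)) (tangent α c t₀)
        + 2 * inner ℝ (shapeOp α N (c t₀) (tangent α c t₀)) (DX (0, (0, 1)))
        = harmonicCurvatureDeriv α N c t₀ := by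
      have h1 := (hB.clm_apply hXd).inner ℝ hXd
      have h2 : (fun q => inner ℝ (shapeOp α N (Θ q) (tubeDir α N ε c Θ q)) (tubeDir α N ε c Θ q))
          =ᶠ[𝓝 (t₀, 0)] fun q => harmonicCurvature α N (Θ q) := by
        filter_upwards [hgood] with q hq
        exact (S.isHarmonicDir_dirField hε hq.regular hq.proj_ne).normal
      have h3 := congrArg (fun l : ℝ × (ℝ × ℝ) →L[ℝ] ℝ => l (0, (0, 1)))
        (h1.unique (hh.congr_of_eventuallyEq h2))
      have h4 : inner ℝ (shapeOp α N (Θ (t₀, 0)) (tubeDir α N ε c Θ (t₀, 0))) (DX (0, (0, 1)))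
        + inner ℝ (shapeOp α N (Θ (t₀, 0)) (DX (0, (0, 1)))
            + tderiv (shapeOp α N) (Θ (t₀, 0)) W (tubeDir α N ε c Θ (t₀, 0)))
            (tubeDir α N ε c Θ (t₀, 0))
        = tderiv (harmonicCurvature α N) (Θ (t₀, 0)) W := h3
      rw [hd0, h.base, inner_add_left, (S.isShape _).symm (DX (0, (0, 1))),
        real_inner_comm (shapeOp α N (c t₀) (tangent α c t₀)) (DX (0, (0, 1)))] at h4
      have h5 : harmonicCurvatureDeriv α N c t₀ = tderiv (harmonicCurvature α N) (c t₀) W := by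
        rw [hWc]; rfl
      linarith
    have q3 : deriv (fun t => torsionFun α N ε (c t)) t₀
        = inner ℝ (tderiv (shapeOp α N) (c t₀) (velocity c t₀) (tangent α c t₀)) (conormal α N c t₀)
          + inner ℝ (shapeOp α N (c t₀) (deriv (tangent α c) t₀)) (conormal α N c t₀)
          + inner ℝ (shapeOp α N (c t₀) (tangent α c t₀)) (deriv (conormal α N c) t₀) := by
      have h1 := ((hasDerivAt_comp (S.mdifferentiableAt_shapeOp _)
        (hc.mdifferentiableAt t₀)).clm_apply (hc.hasDerivAt_tangent S hε t₀)).inner ℝ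
          (hc.hasDerivAt_conormal S hε t₀)
      have h2 : (fun t => inner ℝ (shapeOp α N (c t) (tangent α c t)) (conormal α N c t))
          = fun t => torsionFun α N ε (c t) := by
        funext t; exact (hc.dir t).torsion
      rw [h2] at h1
      rw [h1.deriv, inner_add_left]
      ring
    -- Codazzi and the symmetry of the derivative of B: the derivative along V on (T, T) equals that
    -- along T on (T, V). This eliminates the derivative of B between `q2` and `q3`.
    have q4 : inner ℝ (tderiv (shapeOp α N) (c t₀) W (tangent α c t₀)) (tangent α c t₀)
        = inner ℝ (tderiv (shapeOp α N) (c t₀) (velocity c t₀) (tangent α c t₀))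
          (conormal α N c t₀) := by
      have := S.codazzi (c t₀) W (velocity c t₀)
      rw [← S.tangent_eq (hc.mdifferentiableAt t₀), hWV] at this
      rw [this, S.tderiv_shapeOp_symm, real_inner_comm]
    have q5 : inner ℝ (shapeOp α N (c t₀) (deriv (tangent α c) t₀)) (conormal α N c t₀)
        = geodesicCurvature α N c t₀
          * (2 * meanCurvature α N (c t₀) - harmonicCurvature α N (c t₀)) := by
      rw [hc.deriv_tangent S hε, map_add, map_smul, map_smul, IsOrientedImmersion.shapeOp_normal, smul_zero,
        add_zero, real_inner_smul_left, hc.shapeOp_conormal_inner S]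
    have q6 : inner ℝ (shapeOp α N (c t₀) (tangent α c t₀)) (deriv (conormal α N c) t₀)
        = -(geodesicCurvature α N c t₀ * harmonicCurvature α N (c t₀)) := by
      rw [hc.deriv_conormal S hε, inner_add_right, real_inner_smul_right, real_inner_smul_right,
        (S.isShape _).inner_normal, fr.normal]
      ring
    rw [hBT, inner_add_left, real_inner_smul_left, real_inner_smul_left,
      real_inner_comm (DX (0, (0, 1))), q1, real_inner_comm (DX (0, (0, 1)))] at q2
    rw [q5, q6] at q3
    linarith
  have hy : ((0, y) : ℝ × (ℝ × ℝ)) = y.1 • (0, (1, 0)) + y.2 • (0, (0, 1)) := by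
    ext <;> simp
  rw [hy, map_add, map_smul, map_smul, hDX2, hDX1, inner_add_left, real_inner_smul_left,
    real_inner_smul_left]
  have hk : inner ℝ (deriv (tangent α c) t₀) (conormal α N c t₀) = geodesicCurvature α N c t₀ := rfl
  rw [hk]
  linear_combination y.2 * key

end Field

/-! ### Uniform estimates along a compact piece of the line -/

section Estimates

/-- Local estimates near the zero section hold in a tube of uniform radius, with a uniform
constant. -/
theorem exists_uniform_radius {Y : Type*} [NormedAddCommGroup Y] {Q : ℝ → ℝ → Y → Prop}
    (hmono : ∀ C C' t y, C ≤ C' → Q C t y → Q C' t y) {a b : ℝ}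
    (h : ∀ t ∈ Icc a b, ∃ C, ∀ᶠ q in 𝓝 ((t, 0) : ℝ × Y), Q C q.1 q.2) :
    ∃ ρ > 0, ∃ C, ∀ t ∈ Icc a b, ∀ y : Y, ‖y‖ < ρ → Q C t y := by
  refine isCompact_Icc.induction_on (p := fun s => ∃ ρ > 0, ∃ C, ∀ t ∈ s, ∀ y : Y, ‖y‖ < ρ → Q C t y)
    ⟨1, one_pos, 0, by simp⟩ ?_ ?_ ?_
  · rintro s s' hs ⟨ρ, hρ, C, H⟩
    exact ⟨ρ, hρ, C, fun t ht => H t (hs ht)⟩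
  · rintro s s' ⟨ρ, hρ, C, H⟩ ⟨ρ', hρ', C', H'⟩
    refine ⟨min ρ ρ', lt_min hρ hρ', max C C', ?_⟩
    rintro t (ht | ht) y hy
    · exact hmono _ _ _ _ (le_max_left _ _) (H t ht y (hy.trans_le (min_le_left _ _)))
    · exact hmono _ _ _ _ (le_max_right _ _) (H' t ht y (hy.trans_le (min_le_right _ _)))
  · intro t ht
    obtain ⟨C, hC⟩ := h t ht
    rw [nhds_prod_eq] at hC
    obtain ⟨pa, ha, pb, hb, hab⟩ := eventually_prod_iff.1 hC
    obtain ⟨ρ, hρ, hball⟩ := Metric.eventually_nhds_iff.1 hb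
    refine ⟨{t | pa t}, mem_nhdsWithin_of_mem_nhds ha, ρ, hρ, C, fun t' ht' y hy => ?_⟩
    exact hab ht' (hball (by simpa using hy))

variable {M : Type*} [TopologicalSpace M] [ChartedSpace E2 M]

/-- The weight that turns the linearized equation of the foliation into a conservation law. -/
def returnWeight (α N : M → E3) (ε : ℝ) (c : ℝ → M) (t : ℝ) : ℝ :=
  Real.exp (1 / 2 * Real.log (torsionFun α N ε (c t)) - ∫ s in (0 : ℝ)..t, returnIntegrand α N c s)

theorem returnWeight_pos (α N : M → E3) (ε : ℝ) (c : ℝ → M) (t : ℝ) :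
    0 < returnWeight α N ε c t := Real.exp_pos _

variable {α N : M → E3} {ε : ℝ} {c : ℝ → M} {Θ : ℝ × (ℝ × ℝ) → M}
variable [IsManifold (𝓡 2) ∞ M] [T2Space M] (S : IsOrientedImmersion α N) (hε : ε ^ 2 = 1)
  (hc : IsDirectedLine α N ε c)
include S hε hc

omit [T2Space M] in
theorem torsionFun_ne_zero (t : ℝ) : torsionFun α N ε (c t) ≠ 0 := fun h => by
  have := S.torsionFun_mul_pos hε (hc.regular t)
  rw [h] at this
  simp at this

omit [T2Space M] hε in
theorem contDiff_torsionFun : ContDiff ℝ 1 (fun t => torsionFun α N ε (c t)) := by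
  rw [contDiff_iff_contDiffAt]
  exact fun t => contDiffAt_comp (S.contMDiffAt_torsionFun ε (hc.regular t)) (hc.contMDiff t)

/-- The torsion may be negative. `Real.log` is the logarithm of the absolute value, so its
derivative is τ'/τ for either sign, and the weight is √|τ| exp(−∫ρ). -/
theorem hasDerivAt_returnWeight (t : ℝ) : HasDerivAt (returnWeight α N ε c)
    (returnWeight α N ε c t * (deriv (fun t => torsionFun α N ε (c t)) t
      / (2 * torsionFun α N ε (c t)) - returnIntegrand α N c t)) t := by
  have hρ := continuous_returnIntegrand S hε hc
  have h1 : HasDerivAt (fun t => ∫ s in (0 : ℝ)..t, returnIntegrand α N c s)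
      (returnIntegrand α N c t) t :=
    intervalIntegral.integral_hasDerivAt_right (hρ.intervalIntegrable _ _)
      (hρ.stronglyMeasurableAtFilter _ _) hρ.continuousAt
  have h2 := (((contDiff_torsionFun S hc).differentiable (by norm_num) t).hasDerivAt.log
    (torsionFun_ne_zero S hε hc t)).const_mul (1 / 2)
  refine ((h2.sub h1).exp).congr_deriv ?_
  rw [returnWeight]
  congr 2
  field_simp

theorem continuous_deriv_returnWeight : Continuous (deriv (returnWeight α N ε c)) := by
  have h1 : deriv (returnWeight α N ε c) = fun t =>
      returnWeight α N ε c t * (deriv (fun t => torsionFun α N ε (c t)) t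
      / (2 * torsionFun α N ε (c t)) - returnIntegrand α N c t) :=
    funext fun t => (hasDerivAt_returnWeight S hε hc t).deriv
  have h2 : Continuous (returnWeight α N ε c) :=
    continuous_iff_continuousAt.2 fun t => (hasDerivAt_returnWeight S hε hc t).continuousAt
  rw [h1]
  have h3 := contDiff_torsionFun S hc
  exact h2.mul (((h3.continuous_deriv le_rfl).div (continuous_const.mul h3.continuous)
    (fun t => mul_ne_zero two_ne_zero (torsionFun_ne_zero S hε hc t))).sub
      (continuous_returnIntegrand S hε hc))

/-- The conservation law for the linearized equation. -/
theorem returnWeight_identity {t₀ : ℝ} (h : IsTubeAt α N c Θ t₀) (y : ℝ × ℝ) :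
    returnWeight α N ε c t₀
        * inner ℝ (fderiv ℝ (tubeDir α N ε c Θ) (t₀, 0) (0, y)) (conormal α N c t₀)
      + returnWeight α N ε c t₀
        * inner ℝ (fderiv ℝ (fun q => α (Θ q)) (t₀, 0) (0, y)) (deriv (conormal α N c) t₀)
      + deriv (returnWeight α N ε c) t₀ * y.2 = 0 := by
  have h0 := torsionFun_ne_zero S hε hc t₀
  have h1 := tubeDir_fderiv S hε hc h y
  -- V' has T-component −k_g and no V-component. The displacement thus contributes −k_g y₁, which
  -- cancels the k_g y₁ in the derivative of X.
  rw [(hasDerivAt_returnWeight S hε hc t₀).deriv, tubePoint_fderiv S hε hc h, inner_add_left,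
    real_inner_smul_left, real_inner_smul_left, real_inner_comm _ (tangent α c t₀),
    hc.inner_deriv_conormal_tangent S hε, real_inner_comm _ (conormal α N c t₀),
    hc.inner_deriv_conormal_conormal S hε, returnIntegrand, hc.geodesicTorsion_eq S hε]
  generalize inner ℝ (fderiv ℝ (tubeDir α N ε c Θ) (t₀, 0) (0, y)) (conormal α N c t₀) = X at *
  generalize torsionFun α N ε (c t₀) = τ at *
  generalize deriv (fun t => torsionFun α N ε (c t)) t₀ = τ' at *
  have h2 : X = geodesicCurvature α N c t₀ * y.1
      + (harmonicCurvatureDeriv α N c t₀ - τ' + 2 * geodesicCurvature α N c t₀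
          * (meanCurvature α N (c t₀) - harmonicCurvature α N (c t₀))) * y.2 / (2 * τ) := by
    field_simp
    linarith
  rw [h2]
  field_simp
  ring

omit [T2Space M] in
-- X and α ∘ Θ are of class C¹, hence locally Lipschitz. T' and V' are only continuous in time,
-- which is enough because both arguments of the field are taken at the same time.
theorem tubeField_lipschitz {t₀ : ℝ} (h : IsTubeAt α N c Θ t₀) :
    ∃ C : ℝ, ∀ᶠ q in 𝓝 ((t₀, 0) : ℝ × ((ℝ × ℝ) × (ℝ × ℝ))),
      ‖tubeField α N ε c Θ q.1 q.2.1 - tubeField α N ε c Θ q.1 q.2.2‖ ≤ C * ‖q.2.1 - q.2.2‖ := by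
  have hgood := (eventually_isGood S hε hc h).self_of_nhds
  obtain ⟨K, s, hs, hK⟩ := (hgood.contDiffAt_tubeDir S hε hc).exists_lipschitzOnWith
  obtain ⟨K', s', hs', hK'⟩ := (contDiffAt_tubePoint S h.contMDiffAt).exists_lipschitzOnWith
  have hT' := (hc.contDiff_tangent S hε).continuous_deriv le_rfl
  have hV' := (hc.contDiff_conormal S hε).continuous_deriv le_rfl
  refine ⟨K + K' * (‖deriv (tangent α c) t₀‖ + 1 + (‖deriv (conormal α N c) t₀‖ + 1)), ?_⟩
  have c1 : ContinuousAt (fun q : ℝ × ((ℝ × ℝ) × (ℝ × ℝ)) => (q.1, q.2.1)) (t₀, 0) := by fun_prop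
  have c2 : ContinuousAt (fun q : ℝ × ((ℝ × ℝ) × (ℝ × ℝ)) => (q.1, q.2.2)) (t₀, 0) := by fun_prop
  have c3 : ContinuousAt (fun q : ℝ × ((ℝ × ℝ) × (ℝ × ℝ)) => ‖deriv (tangent α c) q.1‖) (t₀, 0) :=
    (hT'.comp continuous_fst).norm.continuousAt
  have c4 : ContinuousAt (fun q : ℝ × ((ℝ × ℝ) × (ℝ × ℝ)) => ‖deriv (conormal α N c) q.1‖) (t₀, 0) :=
    (hV'.comp continuous_fst).norm.continuousAt
  filter_upwards [c1.eventually (inter_mem hs hs'), c2.eventually (inter_mem hs hs'),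
    c3.eventually (gt_mem_nhds (lt_add_one _)), c4.eventually (gt_mem_nhds (lt_add_one _))]
    with q h1 h2 h3 h4
  obtain ⟨t, y, y'⟩ := q
  simp only at h1 h2 h3 h4 ⊢
  have l1 := hK.norm_sub_le h1.1 h2.1
  have l2 := hK'.norm_sub_le h1.2 h2.2
  have l0 : ‖((t, y) : ℝ × (ℝ × ℝ)) - (t, y')‖ = ‖y - y'‖ := by
    rw [Prod.mk_sub_mk, sub_self, Prod.norm_def, norm_zero, max_eq_right (norm_nonneg _)]
  rw [l0] at l1 l2
  have key : ∀ u u' : E3, ‖u‖ = 1 → ‖u'‖ ≤ ‖deriv (tangent α c) t₀‖ + 1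
      + (‖deriv (conormal α N c) t₀‖ + 1) →
      ‖(inner ℝ (tubeDir α N ε c Θ (t, y) - tangent α c t) u
        + inner ℝ (α (Θ (t, y)) - α (c t)) u')
      - (inner ℝ (tubeDir α N ε c Θ (t, y') - tangent α c t) u
        + inner ℝ (α (Θ (t, y')) - α (c t)) u')‖ ≤
      (K + K' * (‖deriv (tangent α c) t₀‖ + 1 + (‖deriv (conormal α N c) t₀‖ + 1))) * ‖y - y'‖ := by
    intro u u' hu hu'
    have e : (inner ℝ (tubeDir α N ε c Θ (t, y) - tangent α c t) u
        + inner ℝ (α (Θ (t, y)) - α (c t)) u')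
      - (inner ℝ (tubeDir α N ε c Θ (t, y') - tangent α c t) u
        + inner ℝ (α (Θ (t, y')) - α (c t)) u')
      = inner ℝ (tubeDir α N ε c Θ (t, y) - tubeDir α N ε c Θ (t, y')) u
        + inner ℝ (α (Θ (t, y)) - α (Θ (t, y'))) u' := by
      simp only [inner_sub_left]; ring
    rw [e]
    refine (norm_add_le _ _).trans ?_
    have b1 := norm_inner_le_norm (𝕜 := ℝ) (tubeDir α N ε c Θ (t, y) - tubeDir α N ε c Θ (t, y')) u
    have b2 := norm_inner_le_norm (𝕜 := ℝ) (α (Θ (t, y)) - α (Θ (t, y'))) u'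
    rw [hu, mul_one] at b1
    have b3 : ‖α (Θ (t, y)) - α (Θ (t, y'))‖ * ‖u'‖ ≤ (K' * ‖y - y'‖) *
      (‖deriv (tangent α c) t₀‖ + 1 + (‖deriv (conormal α N c) t₀‖ + 1)) :=
      mul_le_mul l2 hu' (norm_nonneg _) (by positivity)
    nlinarith
  refine norm_prod_le_iff.2 ⟨?_, ?_⟩
  · exact key _ _ (hc.dir t).isFrame.norm_fst (by linarith [norm_nonneg (deriv (conormal α N c) t₀)])
  · exact key _ _ (hc.dir t).isFrame.norm_snd (by linarith [norm_nonneg (deriv (tangent α c) t₀)])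

/-- The conservation law with an error uniform in time. Strict differentiability at (t₀, 0), applied
to the pairs (t, y) and (t, 0), allows the derivatives of X and α ∘ Θ to be frozen at t₀. The
resulting form `Φ t` is continuous in t and vanishes at t₀ by `returnWeight_identity`, so it is
small nearby. -/
theorem tubeField_linear_estimate {t₀ : ℝ} (h : IsTubeAt α N c Θ t₀) {η : ℝ} (hη : 0 < η) :
    ∀ᶠ q in 𝓝 ((t₀, 0) : ℝ × (ℝ × ℝ)),
      |returnWeight α N ε c q.1 * (tubeField α N ε c Θ q.1 q.2).2
        + deriv (returnWeight α N ε c) q.1 * q.2.2| ≤ η * ‖q.2‖ := by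
  have hgood := (eventually_isGood S hε hc h).self_of_nhds
  have hX := (hgood.contDiffAt_tubeDir S hε hc).hasStrictFDerivAt (by norm_num)
  have hx := (contDiffAt_tubePoint S h.contMDiffAt).hasStrictFDerivAt (by norm_num)
  set DX := fderiv ℝ (tubeDir α N ε c Θ) (t₀, 0) with hDX
  set Dx := fderiv ℝ (fun q => α (Θ q)) (t₀, 0) with hDx
  have cw : Continuous (returnWeight α N ε c) :=
    continuous_iff_continuousAt.2 fun t => (hasDerivAt_returnWeight S hε hc t).continuousAt
  have cw' := continuous_deriv_returnWeight S hε hc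
  have cV := (hc.contDiff_conormal S hε).continuous
  have cV' := (hc.contDiff_conormal S hε).continuous_deriv le_rfl
  let inr := ContinuousLinearMap.inr ℝ ℝ (ℝ × ℝ)
  let Φ : ℝ → (ℝ × ℝ) →L[ℝ] ℝ := fun t =>
    returnWeight α N ε c t • (innerSL ℝ (conormal α N c t)).comp (DX.comp inr)
      + returnWeight α N ε c t • (innerSL ℝ (deriv (conormal α N c) t)).comp (Dx.comp inr)
      + deriv (returnWeight α N ε c) t • ContinuousLinearMap.snd ℝ ℝ ℝ
  have hΦc : Continuous Φ := by
    have i1 : Continuous fun t => innerSL ℝ (conormal α N c t) := (innerSL ℝ).continuous.comp cV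
    have i2 : Continuous fun t => innerSL ℝ (deriv (conormal α N c) t) :=
      (innerSL ℝ).continuous.comp cV'
    exact ((cw.smul (i1.clm_comp continuous_const)).add
      (cw.smul (i2.clm_comp continuous_const))).add (cw'.smul continuous_const)
  have hΦ0 : Φ t₀ = 0 := by
    refine ContinuousLinearMap.ext fun y => ?_
    have := returnWeight_identity S hε hc h y
    rw [real_inner_comm, real_inner_comm (deriv (conormal α N c) t₀)] at this
    exact this
  -- With this bound, remainders of size η/(2W)·‖y‖ use up half of η‖y‖; the form `Φ` uses up the
  -- other half.
  obtain ⟨W, hW0, hW⟩ : ∃ W > 0, ∀ᶠ t in 𝓝 t₀, returnWeight α N ε c t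
      * (1 + ‖deriv (conormal α N c) t‖) < W := by
    have : Continuous fun t => returnWeight α N ε c t * (1 + ‖deriv (conormal α N c) t‖) :=
      cw.mul (continuous_const.add cV'.norm)
    refine ⟨_, ?_, this.continuousAt.eventually (gt_mem_nhds (lt_add_one _))⟩
    have := returnWeight_pos α N ε c t₀
    positivity
  have hη' : 0 < η / 2 := by positivity
  have hδ : 0 < η / (2 * W) := by positivity
  have cq : Tendsto (fun q : ℝ × (ℝ × ℝ) => (q, ((q.1, 0) : ℝ × (ℝ × ℝ)))) (𝓝 (t₀, 0))
      (𝓝 ((t₀, 0), (t₀, 0))) := by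
    have : Continuous fun q : ℝ × (ℝ × ℝ) => (q, ((q.1, 0) : ℝ × (ℝ × ℝ))) := by fun_prop
    exact this.tendsto _
  have hXe := cq.eventually (hX.isLittleO.def hδ)
  have hxe := cq.eventually (hx.isLittleO.def hδ)
  have hΦe : ∀ᶠ q in 𝓝 ((t₀, 0) : ℝ × (ℝ × ℝ)), ‖Φ q.1‖ < η / 2 := by
    have : Continuous fun q : ℝ × (ℝ × ℝ) => ‖Φ q.1‖ := (hΦc.comp continuous_fst).norm
    refine this.continuousAt.eventually (gt_mem_nhds ?_)
    simp only [hΦ0, norm_zero]; exact hη'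
  have hbase : ∀ᶠ q in 𝓝 ((t₀, 0) : ℝ × (ℝ × ℝ)), Θ (q.1, 0) = c q.1 := by
    have h3 : ContinuousAt (fun q : ℝ × (ℝ × ℝ) => ((q.1, c q.1) : ℝ × M)) (t₀, 0) :=
      (continuous_fst.prodMk (hc.contMDiff.continuous.comp continuous_fst)).continuousAt
    filter_upwards [h3.eventually h.left_inv] with q hq
    simpa only [movingCoord_self] using hq
  have hWe : ∀ᶠ q in 𝓝 ((t₀, 0) : ℝ × (ℝ × ℝ)), returnWeight α N ε c q.1
      * (1 + ‖deriv (conormal α N c) q.1‖) < W :=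
    (continuousAt_fst (p := ((t₀, 0) : ℝ × (ℝ × ℝ)))).eventually hW
  filter_upwards [hXe, hxe, hΦe, hbase, hWe, h.right_inv] with q h1 h2 h3 h4 h5 h6
  obtain ⟨t, y⟩ := q
  simp only at h1 h2 h3 h4 h5 h6 ⊢
  have e0 : ((t, y) : ℝ × (ℝ × ℝ)) - (t, 0) = (0, y) := by simp
  have e1 : ‖((0, y) : ℝ × (ℝ × ℝ))‖ = ‖y‖ := by
    rw [Prod.norm_def, norm_zero, max_eq_right (norm_nonneg _)]
  rw [e0, e1, (tubeDir_base S hε hc h4).2] at h1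
  rw [e0, e1, h4] at h2
  have hy2 : y.2 = inner ℝ (α (Θ (t, y)) - α (c t)) (conormal α N c t) := by
    conv_lhs => rw [← h6]
    rfl
  have hsplit : returnWeight α N ε c t * (tubeField α N ε c Θ t y).2
        + deriv (returnWeight α N ε c) t * y.2
      = Φ t y + returnWeight α N ε c t
        * (inner ℝ (tubeDir α N ε c Θ (t, y) - tangent α c t - DX (0, y)) (conormal α N c t)
          + inner ℝ (α (Θ (t, y)) - α (c t) - Dx (0, y)) (deriv (conormal α N c) t)) := by
    have e2 : Φ t y = returnWeight α N ε c t * inner ℝ (conormal α N c t) (DX (0, y))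
      + returnWeight α N ε c t * inner ℝ (deriv (conormal α N c) t) (Dx (0, y))
      + deriv (returnWeight α N ε c) t * y.2 := rfl
    rw [e2, inner_sub_left _ (DX (0, y)), inner_sub_left _ (Dx (0, y)),
      real_inner_comm (DX (0, y)), real_inner_comm (Dx (0, y))]
    simp only [tubeField]
    ring
  rw [hsplit]
  refine (abs_add_le _ _).trans ?_
  have b1 : |Φ t y| ≤ η / 2 * ‖y‖ :=
    (Φ t).le_of_opNorm_le h3.le y
  have b2 := abs_real_inner_le_norm (tubeDir α N ε c Θ (t, y) - tangent α c t - DX (0, y))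
    (conormal α N c t)
  have hV1 : ‖conormal α N c t‖ = 1 := (hc.dir t).isFrame.norm_snd
  rw [hV1, mul_one] at b2
  have b3 := abs_real_inner_le_norm (α (Θ (t, y)) - α (c t) - Dx (0, y))
    (deriv (conormal α N c) t)
  have b4 : |inner ℝ (tubeDir α N ε c Θ (t, y) - tangent α c t - DX (0, y)) (conormal α N c t)
          + inner ℝ (α (Θ (t, y)) - α (c t) - Dx (0, y)) (deriv (conormal α N c) t)|
      ≤ η / (2 * W) * ‖y‖ * (1 + ‖deriv (conormal α N c) t‖) := by
    refine (abs_add_le _ _).trans ?_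
    have := mul_le_mul_of_nonneg_right h2 (norm_nonneg (deriv (conormal α N c) t))
    linarith
  have hw := returnWeight_pos α N ε c t
  rw [abs_mul, abs_of_pos hw]
  have b5 := mul_le_mul_of_nonneg_left b4 hw.le
  have b6 : returnWeight α N ε c t * (η / (2 * W) * ‖y‖ * (1 + ‖deriv (conormal α N c) t‖))
      ≤ η / (2 * W) * ‖y‖ * W := by
    have := mul_le_mul_of_nonneg_left h5.le (show 0 ≤ η / (2 * W) * ‖y‖ by positivity)
    linarith
  have b7 : η / (2 * W) * ‖y‖ * W = η / 2 * ‖y‖ := by field_simp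
  linarith

end Estimates

/-! ### Solutions of a differential equation with an equilibrium -/

section Solutions

open Metric

/-- The field is controlled only in a ball. Composing it with the coordinatewise clamp `K` gives a
bounded, globally Lipschitz field, for which Picard–Lindelöf covers the whole interval. Grönwall's
inequality against the zero solution keeps the orbit in the ball for t ≥ 0, where the clamp is
inactive. For t < 0 continuity at 0 suffices, since only some open interval around 0 is wanted. -/
theorem exists_solution {G : ℝ → ℝ × ℝ → ℝ × ℝ} {a b ρ C : ℝ} (ha : a < 0) (hb : 0 < b)
    (hρ : 0 < ρ) (hC : 0 ≤ C)
    (hL : ∀ t ∈ Icc a b, ∀ y y', ‖y‖ ≤ ρ → ‖y'‖ ≤ ρ → ‖G t y - G t y'‖ ≤ C * ‖y - y'‖)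
    (hG0 : ∀ t ∈ Icc a b, G t 0 = 0)
    (hcont : ∀ y, ‖y‖ ≤ ρ → ContinuousOn (fun t => G t y) (Icc a b))
    {y₀ : ℝ × ℝ} (hy₀ : ‖y₀‖ * Real.exp (C * b) < ρ) :
    ∃ y : ℝ → ℝ × ℝ, y 0 = y₀ ∧ (∀ t ∈ Ico 0 b, ‖y t‖ ≤ ‖y₀‖ * Real.exp (C * b)) ∧
      ∃ a' < 0, ∀ t ∈ Ioo a' b, ‖y t‖ < ρ ∧ HasDerivAt y (G t (y t)) t := by
  let κ : ℝ → ℝ := fun x => projIcc (-ρ) ρ (by linarith) x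
  have hκ : ∀ x x', |κ x - κ x'| ≤ |x - x'| := fun x x' => abs_projIcc_sub_projIcc _
  have hκb : ∀ x, |κ x| ≤ ρ := fun x => abs_le.2 (projIcc (-ρ) ρ (by linarith) x).2
  have hκi : ∀ x, |x| ≤ ρ → κ x = x := fun x hx => by
    simp only [κ]; rw [projIcc_of_mem _ (abs_le.1 hx)]
  let K : ℝ × ℝ → ℝ × ℝ := fun y => (κ y.1, κ y.2)
  have hK : ∀ y y', ‖K y - K y'‖ ≤ ‖y - y'‖ := fun y y' => max_le_max (hκ _ _) (hκ _ _)
  have hKb : ∀ y, ‖K y‖ ≤ ρ := fun y => max_le (hκb _) (hκb _)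
  have hKi : ∀ y, ‖y‖ ≤ ρ → K y = y := fun y hy =>
    Prod.ext (hκi _ ((le_max_left _ _).trans hy)) (hκi _ ((le_max_right _ _).trans hy))
  let F : ℝ → ℝ × ℝ → ℝ × ℝ := fun t y => G t (K y)
  have hK0 : K 0 = 0 := hKi 0 (by simpa using hρ.le)
  have hFL : ∀ t ∈ Icc a b, LipschitzWith C.toNNReal (F t) := fun t ht => by
    refine LipschitzWith.of_dist_le_mul fun y y' => ?_
    rw [dist_eq_norm, dist_eq_norm, Real.coe_toNNReal C hC]
    exact (hL t ht _ _ (hKb y) (hKb y')).trans (mul_le_mul_of_nonneg_left (hK y y') hC)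
  have hF0 : ∀ t ∈ Icc a b, F t 0 = 0 := fun t ht => by simp only [F, hK0, hG0 t ht]
  have hFb : ∀ t ∈ Icc a b, ∀ y, ‖F t y‖ ≤ C * ρ := fun t ht y => by
    have := hL t ht (K y) 0 (hKb y) (by simpa using hρ.le)
    rw [hG0 t ht, sub_zero, sub_zero] at this
    exact this.trans (mul_le_mul_of_nonneg_left (hKb y) hC)
  have h0 : (0 : ℝ) ∈ Icc a b := ⟨ha.le, hb.le⟩
  have hm : 0 ≤ max (b - 0) (0 - a) := le_max_of_le_left (by linarith)
  -- The clamped speed is at most Cρ, so a start within ρ of 0 cannot leave the larger ball over the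
  -- whole interval.
  have hPL : IsPicardLindelof F (⟨0, h0⟩ : Icc a b) (0 : ℝ × ℝ)
      (C * ρ * max (b - 0) (0 - a) + ρ).toNNReal ρ.toNNReal (C * ρ).toNNReal C.toNNReal := by
    refine ⟨fun t ht => (hFL t ht).lipschitzOnWith, fun y _ => hcont _ (hKb y), fun t ht y _ => ?_, ?_⟩
    · rw [Real.coe_toNNReal _ (by positivity)]; exact hFb t ht y
    · rw [Real.coe_toNNReal _ (by positivity), Real.coe_toNNReal _ (by positivity),
        Real.coe_toNNReal _ hρ.le]
      simp
  have hexp : 1 ≤ Real.exp (C * b) := Real.one_le_exp (by positivity)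
  have hy₀ρ : ‖y₀‖ < ρ := lt_of_le_of_lt (le_mul_of_one_le_right (norm_nonneg _) hexp) hy₀
  obtain ⟨y, hy0, hyd⟩ := hPL.exists_eq_forall_mem_Icc_hasDerivWithinAt (x := y₀)
    (by rw [mem_closedBall, dist_zero_right, Real.coe_toNNReal _ hρ.le]; exact hy₀ρ.le)
  have hyc : ContinuousOn y (Icc a b) := fun t ht => (hyd t ht).continuousWithinAt
  have hbd : ∀ t ∈ Icc 0 b, ‖y t‖ ≤ ‖y₀‖ * Real.exp (C * b) := by
    have h1 := dist_le_of_trajectories_ODE_of_mem (v := F) (K := C.toNNReal) (s := fun _ => univ)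
      (f := y) (g := fun _ => 0) (a := 0) (b := b) (δ := ‖y₀‖)
      (fun t ht => (hFL t ⟨by linarith [ht.1], ht.2.le⟩).lipschitzOnWith)
      (hyc.mono (Icc_subset_Icc_left ha.le))
      (fun t ht => ((hyd t ⟨by linarith [ht.1], ht.2.le⟩).hasDerivAt
        (Icc_mem_nhds (by linarith [ht.1]) ht.2)).hasDerivWithinAt)
      (fun t ht => mem_univ _) continuousOn_const
      (fun t ht => by rw [hF0 t ⟨by linarith [ht.1], ht.2.le⟩]; exact hasDerivWithinAt_const _ _ _)
      (fun t ht => mem_univ _) (by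
        have : y 0 = y₀ := hy0
        rw [this, dist_zero_right])
    intro t ht
    have h2 := h1 t ht
    rw [dist_zero_right, Real.coe_toNNReal C hC, sub_zero] at h2
    refine h2.trans (mul_le_mul_of_nonneg_left (Real.exp_le_exp.2 ?_) (norm_nonneg _))
    exact mul_le_mul_of_nonneg_left ht.2 hC
  have hy0' : y 0 = y₀ := hy0
  have hnear : ∀ᶠ t in 𝓝 (0 : ℝ), ‖y t‖ < ρ := by
    have : ContinuousAt y 0 := hyc.continuousAt (Icc_mem_nhds ha hb)
    exact this.norm.eventually (gt_mem_nhds (by simp only [hy0']; exact hy₀ρ))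
  obtain ⟨δ, hδ, hball⟩ := Metric.eventually_nhds_iff.1 hnear
  refine ⟨y, hy0', fun t ht => hbd t (Ico_subset_Icc_self ht), max a (-δ),
    max_lt ha (by linarith), fun t ht => ?_⟩
  have hlt : ‖y t‖ < ρ := by
    rcases lt_or_ge t 0 with h | h
    · refine hball ?_
      rw [Real.dist_eq, sub_zero, abs_of_neg h]
      linarith [(max_lt_iff.1 ht.1).2]
    · exact (hbd t ⟨h, ht.2.le⟩).trans_lt hy₀
  refine ⟨hlt, ?_⟩
  have h1 := (hyd t ⟨(max_lt_iff.1 ht.1).1.le, ht.2.le⟩).hasDerivAt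
    (Icc_mem_nhds (max_lt_iff.1 ht.1).1 ht.2)
  have h2 : F t (y t) = G t (y t) := by simp only [F, hKi _ hlt.le]
  rwa [h2] at h1

end Solutions

/-! ### Lines of harmonic mean curvature in moving coordinates -/

section TubeCurves

variable {M : Type*} [TopologicalSpace M] [ChartedSpace E2 M]
variable {α N : M → E3} {ε : ℝ} {c : ℝ → M} {Θ : ℝ × (ℝ × ℝ) → M}
variable [IsManifold (𝓡 2) ∞ M] (S : IsOrientedImmersion α N) (hε : ε ^ 2 = 1)
  (hc : IsDirectedLine α N ε c)
include S hε hc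

/-- The velocity of a curve in moving coordinates. -/
theorem hasDerivAt_movingCoord {γ : ℝ → M} {t : ℝ}
    (hγ : MDifferentiableAt 𝓘(ℝ, ℝ) (𝓡 2) γ t) :
    HasDerivAt (fun s => movingCoord α N c s (γ s))
      (inner ℝ (tangent α γ t - tangent α c t) (tangent α c t)
        + inner ℝ (α (γ t) - α (c t)) (deriv (tangent α c) t),
       inner ℝ (tangent α γ t - tangent α c t) (conormal α N c t)
        + inner ℝ (α (γ t) - α (c t)) (deriv (conormal α N c) t)) t := by
  have h := (hasFDerivAt_movingCoord S hε hc (hasFDerivAt_id t)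
    (S.hasDerivAt_curve hγ).hasFDerivAt).hasDerivAt
  refine h.congr_deriv ?_
  have e1 : inner ℝ (tangent α c t) (tangent α c t) = 1 := (hc.dir t).isFrame.inner_ee
  have e2 : inner ℝ (tangent α c t) (conormal α N c t) = 0 := inner_right_cross _ _
  have e3 : inner ℝ (tangent α γ t - tangent α c t) (tangent α c t)
      = inner ℝ (tangent α c t) (tangent α γ t) - 1 := by
    rw [inner_sub_left, e1, real_inner_comm]
  have e4 : inner ℝ (tangent α γ t - tangent α c t) (conormal α N c t)
      = inner ℝ (conormal α N c t) (tangent α γ t) := by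
    rw [inner_sub_left, e2, real_inner_comm, sub_zero]
  rw [e3, e4, S.tangent_eq hγ]
  simp [velocity, inner_sub_left]

/-- A curve that follows the direction field solves the differential equation in moving
coordinates. -/
theorem hasDerivAt_of_tangent {γ : ℝ → M} {t : ℝ}
    (hγ : MDifferentiableAt 𝓘(ℝ, ℝ) (𝓡 2) γ t) (hΘ : Θ (t, movingCoord α N c t (γ t)) = γ t)
    (hT : tangent α γ t = dirField α N ε (tangent α c t) (γ t)) :
    HasDerivAt (fun s => movingCoord α N c s (γ s))
      (tubeField α N ε c Θ t (movingCoord α N c t (γ t))) t := by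
  refine (hasDerivAt_movingCoord S hε hc hγ).congr_deriv ?_
  simp only [tubeField, tubeDir, hΘ, hT]

/-- The equation fixes only the components of the velocity along T and V, so its difference from X
is a multiple of N(c(t)). This difference is also orthogonal to the normal at the point itself, and
by `IsGood.normal` the two normals are not orthogonal. -/
theorem tangent_of_hasDerivAt {y : ℝ → ℝ × ℝ} {t : ℝ} (hg : IsGood α N ε c Θ (t, y t))
    (hy : HasDerivAt y (tubeField α N ε c Θ t (y t)) t)
    (hγ : MDifferentiableAt 𝓘(ℝ, ℝ) (𝓡 2) (fun s => Θ (s, y s)) t) :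
    tangent α (fun s => Θ (s, y s)) t = tubeDir α N ε c Θ (t, y t) := by
  have h1 := hasDerivAt_movingCoord S hε hc hγ
  have hq : ContinuousAt (fun s => ((s, y s) : ℝ × (ℝ × ℝ))) t := continuousAt_id.prodMk hy.continuousAt
  have h2 := h1.unique (hy.congr_of_eventuallyEq (hq.eventually hg.right_inv))
  simp only [tubeField, Prod.mk.injEq] at h2
  obtain ⟨h3, h4⟩ := h2
  set x' := tangent α (fun s => Θ (s, y s)) t with hx'
  set X := tubeDir α N ε c Θ (t, y t) with hX
  have h3' : inner ℝ (x' - X) (tangent α c t) = 0 := by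
    simp only [inner_sub_left] at h3 ⊢
    linarith
  have h4' : inner ℝ (x' - X) (conormal α N c t) = 0 := by
    simp only [inner_sub_left] at h4 ⊢
    linarith
  have h5 : inner ℝ (N (Θ (t, y t))) (x' - X) = 0 := by
    rw [inner_sub_right, hx', S.tangent_eq hγ, S.orthogonal]
    have := (S.isHarmonicDir_dirField hε hg.regular hg.proj_ne).isFrame.inner_eq_zero
    change inner ℝ (N (Θ (t, y t))) X = 0 at this
    rw [this, sub_zero]
  have h6 := (hc.dir t).isFrame.expand (x' - X)
  change inner ℝ (x' - X) (cross (N (c t)) (tangent α c t)) = 0 at h4'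
  rw [h3', h4', zero_smul, zero_smul, zero_add, zero_add] at h6
  rw [h6, real_inner_smul_right] at h5
  have h7 := (mul_eq_zero.1 h5).resolve_right hg.normal.ne'
  rw [h7, zero_smul] at h6
  exact sub_eq_zero.1 h6

/-- Solutions of the differential equation in moving coordinates are lines of harmonic mean
curvature with torsion of sign `ε`. -/
theorem isHarmonicLineOn_of_solution {y : ℝ → ℝ × ℝ} {a b : ℝ}
    (h : ∀ t ∈ Ioo a b, IsGood α N ε c Θ (t, y t) ∧ HasDerivAt y (tubeField α N ε c Θ t (y t)) t) :
    IsHarmonicLineOn α N (fun t => Θ (t, y t)) (Ioo a b) ∧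
    ∀ t ∈ Ioo a b, tangent α (fun t => Θ (t, y t)) t = tubeDir α N ε c Θ (t, y t) ∧
      0 < geodesicTorsion α N (fun t => Θ (t, y t)) t * ε := by
  have hyc : ∀ t ∈ Ioo a b, ContinuousAt y t := fun t ht => (h t ht).2.continuousAt
  have hq : ∀ t ∈ Ioo a b, ContinuousAt (fun s => ((s, y s) : ℝ × (ℝ × ℝ))) t := fun t ht =>
    continuousAt_id.prodMk (hyc t ht)
  have hyC : ContDiffOn ℝ 1 y (Ioo a b) := by
    have h1 : (1 : WithTop ℕ∞) = 0 + 1 := by norm_num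
    rw [h1, contDiffOn_succ_iff_deriv_of_isOpen isOpen_Ioo]
    refine ⟨fun t ht => (h t ht).2.differentiableAt.differentiableWithinAt, by simp, ?_⟩
    rw [contDiffOn_zero]
    have h2 : ContinuousOn (fun t => tubeField α N ε c Θ t (y t)) (Ioo a b) := fun t ht =>
      (ContinuousAt.comp (f := fun s => ((s, y s) : ℝ × (ℝ × ℝ)))
        (continuousAt_tubeField S hε hc (h t ht).1) (hq t ht)).continuousWithinAt
    exact h2.congr fun t ht => (h t ht).2.deriv
  have hqC : ∀ t ∈ Ioo a b, ContDiffAt ℝ 1 (fun s => ((s, y s) : ℝ × (ℝ × ℝ))) t := fun t ht =>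
    contDiffAt_id.prodMk (hyC.contDiffAt (isOpen_Ioo.mem_nhds ht))
  set γ : ℝ → M := fun t => Θ (t, y t) with hγ
  have hγC : ∀ t ∈ Ioo a b, ContMDiffAt 𝓘(ℝ, ℝ) (𝓡 2) 1 γ t := fun t ht =>
    ContMDiffAt.comp t (h t ht).1.contMDiffAt (contMDiffAt_iff_contDiffAt.2 (hqC t ht))
  have hγd : ∀ t ∈ Ioo a b, MDifferentiableAt 𝓘(ℝ, ℝ) (𝓡 2) γ t := fun t ht =>
    (hγC t ht).mdifferentiableAt (by norm_num)
  have hT : ∀ t ∈ Ioo a b, tangent α γ t = tubeDir α N ε c Θ (t, y t) := fun t ht =>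
    tangent_of_hasDerivAt S hε hc (h t ht).1 (h t ht).2 (hγd t ht)
  have hdir : ∀ t ∈ Ioo a b, IsHarmonicDir α N ε (γ t) (tangent α γ t) := fun t ht => by
    rw [hT t ht]
    exact S.isHarmonicDir_dirField hε (h t ht).1.regular (h t ht).1.proj_ne
  refine ⟨S.isHarmonicLineOn_of_tangent isOpen_Ioo
    (fun t ht => (hγC t ht).contMDiffWithinAt) (fun t ht => (h t ht).1.regular) hdir,
    fun t ht => ⟨hT t ht, ?_⟩⟩
  -- Along the curve the tangent coincides with X, a C¹ map composed with a C¹ curve; hence the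
  -- conormal is differentiable and the torsion can be computed from B.
  have hd : DifferentiableAt ℝ (conormal α N γ) t := by
    have h1 : DifferentiableAt ℝ (fun s => N (γ s)) t := (S.hasDerivAt_normal (hγd t ht)).differentiableAt
    have h2 : DifferentiableAt ℝ (tangent α γ) t := by
      have h3 : DifferentiableAt ℝ (fun s => tubeDir α N ε c Θ (s, y s)) t :=
        DifferentiableAt.comp (f := fun s => ((s, y s) : ℝ × (ℝ × ℝ))) t
          (((h t ht).1.contDiffAt_tubeDir S hε hc).differentiableAt (by norm_num))
          ((hqC t ht).differentiableAt (by norm_num))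
      refine h3.congr_of_eventuallyEq ?_
      filter_upwards [isOpen_Ioo.mem_nhds ht] with s hs using hT s hs
    have h4 : DifferentiableAt ℝ (fun s => crossL (N (γ s)) (tangent α γ s)) t :=
      (crossL.differentiableAt.comp t h1).clm_apply h2
    exact h4
  rw [S.geodesicTorsion_eq (hγd t ht) hd, (hdir t ht).torsion]
  exact S.torsionFun_mul_pos hε (h t ht).1.regular

end TubeCurves

/-! ### The orbits near a line, over a long time interval -/

section Orbits

variable {M : Type*} [TopologicalSpace M] [ChartedSpace E2 M]

/-- Moving coordinates in a tube of radius `ρ` over a compact interval of times, with `C` a Lipschitz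
constant of the foliation. -/
structure IsUniformTube (α N : M → E3) (ε : ℝ) (c : ℝ → M) (Θ : ℝ × (ℝ × ℝ) → M)
    (a b ρ C : ℝ) : Prop where
  tube : ∀ t ∈ Icc a b, IsTubeAt α N c Θ t
  radius_pos : 0 < ρ
  const_nonneg : 0 ≤ C
  good : ∀ t ∈ Icc a b, ∀ y, ‖y‖ < ρ → IsGood α N ε c Θ (t, y)
  lipschitz : ∀ t ∈ Icc a b, ∀ y y', ‖y‖ < ρ → ‖y'‖ < ρ →
    ‖tubeField α N ε c Θ t y - tubeField α N ε c Θ t y'‖ ≤ C * ‖y - y'‖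

variable {α N : M → E3} {ε : ℝ} {c : ℝ → M} {Θ : ℝ × (ℝ × ℝ) → M} {a b ρ C : ℝ}
variable [IsManifold (𝓡 2) ∞ M] [T2Space M] (S : IsOrientedImmersion α N) (hε : ε ^ 2 = 1)
  (hc : IsDirectedLine α N ε c)
include S hε hc

theorem exists_isUniformTube (a b : ℝ) :
    ∃ Θ ρ C, IsUniformTube α N ε c Θ a b ρ C := by
  obtain ⟨Θ, hΘ⟩ := exists_tube S hε hc a b
  obtain ⟨ρ₁, hρ₁, -, h₁⟩ := exists_uniform_radius
    (Q := fun _ t (y : ℝ × ℝ) => IsGood α N ε c Θ (t, y)) (fun _ _ _ _ _ h => h)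
    (a := a) (b := b) (fun t ht => ⟨0, eventually_isGood S hε hc (hΘ t ht)⟩)
  obtain ⟨ρ₂, hρ₂, C, h₂⟩ := exists_uniform_radius
    (Q := fun C t (y : (ℝ × ℝ) × (ℝ × ℝ)) =>
      ‖tubeField α N ε c Θ t y.1 - tubeField α N ε c Θ t y.2‖ ≤ C * ‖y.1 - y.2‖)
    (fun _ _ _ _ hC h => h.trans (mul_le_mul_of_nonneg_right hC (norm_nonneg _)))
    (a := a) (b := b) (fun t ht => tubeField_lipschitz S hε hc (hΘ t ht))
  refine ⟨Θ, min ρ₁ ρ₂, max C 0, hΘ, lt_min hρ₁ hρ₂, le_max_right _ _,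
    fun t ht y hy => h₁ t ht y (hy.trans_le (min_le_left _ _)), fun t ht y y' hy hy' => ?_⟩
  refine (h₂ t ht (y, y') ?_).trans (mul_le_mul_of_nonneg_right (le_max_left _ _) (norm_nonneg _))
  exact max_lt (hy.trans_le (min_le_right _ _)) (hy'.trans_le (min_le_right _ _))

omit [T2Space M] in
/-- The orbit with given initial position. -/
theorem IsUniformTube.exists_orbit (h : IsUniformTube α N ε c Θ a b ρ C) (ha : a < 0) (hb : 0 < b)
    {y₀ : ℝ × ℝ} (hy₀ : ‖y₀‖ * Real.exp (C * b) < ρ) :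
    ∃ y : ℝ → ℝ × ℝ, y 0 = y₀ ∧ (∀ t ∈ Ico 0 b, ‖y t‖ ≤ ‖y₀‖ * Real.exp (C * b)) ∧
      ∃ a' < 0, a ≤ a' ∧
        ∀ t ∈ Ioo a' b, ‖y t‖ < ρ ∧ HasDerivAt y (tubeField α N ε c Θ t (y t)) t := by
  -- `exists_solution` needs estimates on a closed ball, the tube provides them on the open one.
  obtain ⟨ρ', h1, h2⟩ := exists_between hy₀
  have hρ' : 0 < ρ' := lt_of_le_of_lt (by positivity) h1
  obtain ⟨y, hy0, hyb, a', ha', hy⟩ := exists_solution (G := tubeField α N ε c Θ) ha hb hρ'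
    h.const_nonneg
    (fun t ht y y' hy hy' => h.lipschitz t ht y y' (hy.trans_lt h2) (hy'.trans_lt h2))
    (fun t ht => tubeField_zero S hε hc (h.tube t ht).base)
    (fun y hy t ht => by
      have hq : ContinuousAt (fun s : ℝ => ((s, y) : ℝ × (ℝ × ℝ))) t :=
        continuousAt_id.prodMk continuousAt_const
      exact (ContinuousAt.comp (f := fun s : ℝ => ((s, y) : ℝ × (ℝ × ℝ)))
        (continuousAt_tubeField S hε hc (h.good t ht y (hy.trans_lt h2))) hq).continuousWithinAt)
    h1
  refine ⟨y, hy0, hyb, max a a', max_lt ha ha', le_max_left _ _, fun t ht => ?_⟩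
  have := hy t ⟨(le_max_right _ _).trans_lt ht.1, ht.2⟩
  exact ⟨this.1.trans h2, this.2⟩

/-- Along the orbits near the line, the weighted distance to the line is nearly constant. -/
theorem exists_radius_conservation {b : ℝ} (hΘ : ∀ t ∈ Icc 0 b, IsTubeAt α N c Θ t) {η : ℝ}
    (hη : 0 < η) :
    ∃ r > 0, ∀ (y : ℝ → ℝ × ℝ) (m : ℝ), m < r →
      (∀ t ∈ Icc 0 b, ‖y t‖ ≤ m ∧ HasDerivAt y (tubeField α N ε c Θ t (y t)) t) →
      ∀ t ∈ Icc 0 b, |returnWeight α N ε c t * (y t).2 - returnWeight α N ε c 0 * (y 0).2|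
        ≤ η * m * b := by
  obtain ⟨r, hr, -, h⟩ := exists_uniform_radius
    (Q := fun _ t (y : ℝ × ℝ) => |returnWeight α N ε c t * (tubeField α N ε c Θ t y).2
        + deriv (returnWeight α N ε c) t * y.2| ≤ η * ‖y‖) (fun _ _ _ _ _ h => h)
    (a := 0) (b := b) (fun t ht => ⟨0, tubeField_linear_estimate S hε hc (hΘ t ht) hη⟩)
  refine ⟨r, hr, fun y m hm hy t ht => ?_⟩
  have hd : ∀ s ∈ Icc 0 b, HasDerivAt (fun s => returnWeight α N ε c s * (y s).2)
      (deriv (returnWeight α N ε c) s * (y s).2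
        + returnWeight α N ε c s * (tubeField α N ε c Θ s (y s)).2) s := fun s hs =>
    ((hasDerivAt_returnWeight S hε hc s).differentiableAt.hasDerivAt).mul (hy s hs).2.snd
  have hm0 : 0 ≤ m := (norm_nonneg _).trans (hy t ht).1
  have h1 := norm_image_sub_le_of_norm_deriv_le_segment' (C := η * m)
    (fun s hs => (hd s hs).hasDerivWithinAt) (fun s hs => by
      rw [Real.norm_eq_abs, add_comm]
      have hs' : s ∈ Icc 0 b := Ico_subset_Icc_self hs
      exact (h s hs' (y s) ((hy s hs').1.trans_lt hm)).trans
        (mul_le_mul_of_nonneg_left (hy s hs').1 hη.le)) t ht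
  rw [Real.norm_eq_abs, sub_zero] at h1
  exact h1.trans (mul_le_mul_of_nonneg_left ht.2 (by positivity))

end Orbits

/-! ### Cross-sections in moving coordinates -/

section CrossSection

variable {M : Type*} [TopologicalSpace M] [ChartedSpace E2 M]

theorem IsCrossSection.contMDiffAt {α : M → E3} {c σ : ℝ → M} {δ : ℝ}
    (hσ : IsCrossSection α c σ δ) : ContMDiffAt 𝓘(ℝ, ℝ) (𝓡 2) 1 σ 0 :=
  hσ.contMDiffOn.contMDiffAt (Icc_mem_nhds (by linarith [hσ.pos]) hσ.pos)

theorem IsCrossSection.zero_mem {α : M → E3} {c σ : ℝ → M} {δ : ℝ}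
    (hσ : IsCrossSection α c σ δ) : (0 : ℝ) ∈ Icc (-δ) δ :=
  ⟨by linarith [hσ.pos], hσ.pos.le⟩

theorem IsCrossSection.isClosed_image [T2Space M] {α : M → E3} {c σ : ℝ → M} {δ : ℝ}
    (hσ : IsCrossSection α c σ δ) {s : Set ℝ} (hs : IsClosed s) (hsub : s ⊆ Icc (-δ) δ) :
    IsClosed (σ '' s) :=
  ((isCompact_Icc.of_isClosed_subset hs hsub).image_of_continuousOn
    (hσ.contMDiffOn.continuousOn.mono hsub)).isClosed

/-- Points of the section close to its base point have parameters close to `0`. -/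
theorem IsCrossSection.eventually_param [T2Space M] {α : M → E3} {c σ : ℝ → M} {δ : ℝ}
    (hσ : IsCrossSection α c σ δ) {u : Set ℝ} (hu : u ∈ 𝓝 (0 : ℝ)) :
    ∀ᶠ p in 𝓝 (σ 0), ∀ w ∈ Icc (-δ) δ, σ w = p → w ∈ u := by
  obtain ⟨v, hvu, hv, h0⟩ := mem_nhds_iff.1 hu
  have hcl := hσ.isClosed_image (isClosed_Icc.inter hv.isClosed_compl) inter_subset_left
  have h1 : σ 0 ∉ σ '' (Icc (-δ) δ ∩ vᶜ) := by
    rintro ⟨w, ⟨hw, hwv⟩, h⟩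
    exact hwv (hσ.injOn hw hσ.zero_mem h ▸ h0)
  filter_upwards [hcl.isOpen_compl.mem_nhds h1] with p hp w hw h
  by_contra hwu
  exact hp ⟨w, ⟨hw, fun h' => hwu (hvu h')⟩, h⟩

/-- `Ψ` assigns to moving coordinates `y` the time `t` close to `t₀` at which a point of the section
has coordinates `y`, and the parameter of that point. -/
structure IsSectionChart (σ : ℝ → M) (δ : ℝ) (Θ : ℝ × (ℝ × ℝ) → M) (D t₀ : ℝ)
    (Ψ : ℝ × ℝ → ℝ × ℝ) : Prop where
  base : Ψ 0 = (t₀, 0)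
  mem : ∀ᶠ y in 𝓝 0, (Ψ y).2 ∈ Icc (-δ) δ
  hit : ∀ᶠ q in 𝓝 ((t₀, 0) : ℝ × (ℝ × ℝ)), ∀ w ∈ Icc (-δ) δ, σ w = Θ q ↔ Ψ q.2 = (q.1, w)
  lipschitz : ∃ K, ∃ s ∈ 𝓝 (0 : ℝ × ℝ), LipschitzOnWith K Ψ s
  deriv : (fun y => y.2 - D * (Ψ y).2) =o[𝓝 0] fun y => y

variable {α N : M → E3} {ε : ℝ} {c : ℝ → M} {Θ : ℝ × (ℝ × ℝ) → M} {σ : ℝ → M} {δ : ℝ}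
variable [IsManifold (𝓡 2) ∞ M] (S : IsOrientedImmersion α N) (hε : ε ^ 2 = 1)
  (hc : IsDirectedLine α N ε c) (hσ : IsCrossSection α c σ δ)
include S hc hσ

omit [IsManifold (𝓡 2) ∞ M] in
-- Without a V-component the tangent vector of the section would be a multiple of T, against
-- transversality.
theorem IsCrossSection.inner_ne_zero : inner ℝ (tangent α σ 0) (conormal α N c 0) ≠ 0 := by
  intro h
  have h1 : inner ℝ (tangent α σ 0) (N (c 0)) = 0 := by
    rw [S.tangent_eq (hσ.contMDiffAt.mdifferentiableAt (by norm_num)), real_inner_comm, ← hσ.base]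
    exact S.orthogonal _ _
  have h2 := (hc.dir 0).isFrame.expand (tangent α σ 0)
  change inner ℝ (tangent α σ 0) (cross (N (c 0)) (tangent α c 0)) = 0 at h
  rw [h, h1, zero_smul, zero_smul, add_zero, add_zero] at h2
  have h3 := LinearIndependent.pair_iff.1 hσ.transversal
    (-inner ℝ (tangent α σ 0) (tangent α c 0)) 1 (by
      rw [one_smul, neg_smul]; nth_rewrite 2 [h2]; abel)
  exact one_ne_zero h3.2

include hε

/-- Ψ is the local inverse of Z(t, w), the moving coordinates of σ(w) at time t. The derivative (s,
w) ↦ (wB − s, wD) of Z is invertible because D ≠ 0, and its second component gives y₂ = D w to first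
order. An orbit meets the section at time t in σ(w) exactly when Ψ(y(t)) = (t, w). -/
theorem exists_isSectionChart [T2Space M] {t₀ : ℝ} (hΘ : IsTubeAt α N c Θ t₀) (hct : c t₀ = c 0)
    (hT : tangent α c t₀ = tangent α c 0) :
    ∃ Ψ, IsSectionChart σ δ Θ (inner ℝ (tangent α σ 0) (conormal α N c 0)) t₀ Ψ := by
  have hV : conormal α N c t₀ = conormal α N c 0 := by simp only [conormal, hct, hT]
  set D := inner ℝ (tangent α σ 0) (conormal α N c 0) with hD
  have hD0 : D ≠ 0 := hσ.inner_ne_zero S hc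
  set B := inner ℝ (tangent α σ 0) (tangent α c 0) with hB
  set Z : ℝ × ℝ → ℝ × ℝ := fun x => movingCoord α N c x.1 (σ x.2) with hZ
  have hbase : σ 0 = c t₀ := hσ.base.trans hct.symm
  have hZ0 : Z (t₀, 0) = 0 := by simp only [hZ, hbase, movingCoord_self]
  have hσd := hσ.contMDiffAt.mdifferentiableAt (by norm_num)
  have hPC : ContDiffAt ℝ 1 (fun x : ℝ × ℝ => α (σ x.2)) (t₀, 0) :=
    ContDiffAt.comp (t₀, (0 : ℝ)) (g := fun w => α (σ w))
      (contDiffAt_comp ((S.contMDiff _).of_le (by norm_num)) hσ.contMDiffAt) contDiffAt_snd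
  have hZC : ContDiffAt ℝ 1 Z (t₀, 0) :=
    contDiffAt_movingCoord S hε hc (τ := Prod.fst) (P := fun x : ℝ × ℝ => σ x.2) contDiffAt_fst hPC
  have hPD : HasFDerivAt (fun x : ℝ × ℝ => α (σ x.2)) _ (t₀, (0 : ℝ)) :=
    HasFDerivAt.comp (g := fun w => α (σ w)) (f := Prod.snd) (t₀, (0 : ℝ))
      (S.hasDerivAt_curve hσd).hasFDerivAt hasFDerivAt_snd
  have hZD : HasFDerivAt Z _ (t₀, 0) :=
    hasFDerivAt_movingCoord S hε hc (hasFDerivAt_fst (𝕜 := ℝ) (p := (t₀, (0 : ℝ)))) hPD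
  set Z' : ℝ × ℝ →L[ℝ] ℝ × ℝ := _ with hZ'
  replace hZD : HasFDerivAt Z Z' (t₀, 0) := hZD
  have hZa : ∀ x : ℝ × ℝ, Z' x = (x.2 * B - x.1, x.2 * D) := by
    intro x
    simp only [hZ', hbase, sub_self, map_zero, ContinuousLinearMap.zero_comp, add_zero, hT, hV]
    ext
    · simp [hB, real_inner_comm]
    · simp [hD, real_inner_comm]
  have hinj : Function.Injective Z' := by
    rw [injective_iff_map_eq_zero]
    rintro ⟨s, w⟩ h
    rw [hZa, Prod.mk_eq_zero] at h
    have h1 : w = 0 := (mul_eq_zero.1 h.2).resolve_right hD0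
    have h2 := h.1
    simp only [h1, zero_mul, zero_sub, neg_eq_zero] at h2
    rw [h1, h2]; rfl
  let e' : (ℝ × ℝ) ≃L[ℝ] ℝ × ℝ :=
    (LinearEquiv.ofInjectiveOfFinrankEq (Z' : (ℝ × ℝ) →ₗ[ℝ] ℝ × ℝ) hinj
      (by simp)).toContinuousLinearEquiv
  have he' : ∀ x, e' x = Z' x := fun x => rfl
  have hst : HasStrictFDerivAt Z (e' : ℝ × ℝ →L[ℝ] ℝ × ℝ) (t₀, 0) :=
    hZC.hasStrictFDerivAt' hZD (by norm_num)
  set Ψ := hst.localInverse Z e' (t₀, 0) with hΨ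
  have hΨ0 : Ψ 0 = (t₀, 0) := by rw [← hZ0]; exact hst.localInverse_apply_image
  have hΨD : HasStrictFDerivAt Ψ (e'.symm : ℝ × ℝ →L[ℝ] ℝ × ℝ) 0 := by
    rw [← hZ0]; exact hst.to_localInverse
  have hΨl : ∀ᶠ x in 𝓝 (t₀, (0 : ℝ)), Ψ (Z x) = x := hst.eventually_left_inverse
  have hΨr : ∀ᶠ y in 𝓝 (0 : ℝ × ℝ), Z (Ψ y) = y := by
    rw [← hZ0]; exact hst.eventually_right_inverse
  have hΨc : Tendsto Ψ (𝓝 0) (𝓝 (t₀, 0)) := by rw [← hΨ0]; exact hΨD.hasFDerivAt.continuousAt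
  have hmem : ∀ᶠ y in 𝓝 (0 : ℝ × ℝ), (Ψ y).2 ∈ Icc (-δ) δ :=
    ((continuous_snd.tendsto _).comp hΨc).eventually
      (Icc_mem_nhds (by simpa using hσ.pos) (by simpa using hσ.pos))
  refine ⟨Ψ, hΨ0, hmem, ?_, hΨD.exists_lipschitzOnWith, ?_⟩
  · have hsnd : Tendsto (fun q : ℝ × (ℝ × ℝ) => q.2) (𝓝 (t₀, 0)) (𝓝 0) := continuousAt_snd
    have hfst : Tendsto (fun q : ℝ × (ℝ × ℝ) => q.1) (𝓝 (t₀, 0)) (𝓝 t₀) := continuousAt_fst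
    obtain ⟨u, hu, u', hu', huu⟩ := mem_nhds_prod_iff.1 hΨl
    have e1 := hsnd.eventually hΨr
    have e2 := hfst.eventually hu
    -- Ψ inverts Z only for small parameters. Compactness and injectivity of the arc, through
    -- `eventually_param`, exclude that a remote part of it comes back near the base point.
    have e3 : ∀ᶠ q in 𝓝 ((t₀, 0) : ℝ × (ℝ × ℝ)), ∀ w ∈ Icc (-δ) δ, σ w = Θ q → w ∈ u' := by
      have h1 : Tendsto Θ (𝓝 (t₀, 0)) (𝓝 (σ 0)) := by
        rw [hbase, ← hΘ.base]; exact hΘ.contMDiffAt.continuousAt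
      exact h1.eventually (hσ.eventually_param hu')
    have e4 : ∀ᶠ y in 𝓝 (0 : ℝ × ℝ), Θ ((Ψ y).1, Z (Ψ y)) = σ (Ψ y).2 := by
      have h1 : Tendsto (fun y => ((Ψ y).1, σ (Ψ y).2)) (𝓝 0) (𝓝 (t₀, c t₀)) := by
        have h2 : Tendsto σ (𝓝 0) (𝓝 (c t₀)) := by
          rw [← hbase]; exact hσ.contMDiffAt.continuousAt
        exact ((continuous_fst.tendsto _).comp hΨc).prodMk_nhds
          (h2.comp ((continuous_snd.tendsto _).comp hΨc))
      exact h1.eventually hΘ.left_inv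
    filter_upwards [e1, e2, e3, hsnd.eventually e4, hΘ.right_inv] with q h1 h2 h3 h4 h5 w hw
    constructor
    · intro h
      have h6 : Ψ (Z (q.1, w)) = (q.1, w) := huu ⟨h2, h3 w hw h⟩
      rwa [show Z (q.1, w) = q.2 by simp only [hZ, h, h5]] at h6
    · intro h
      rw [h1, h] at h4
      exact h4.symm
  · have h1 := hΨD.hasFDerivAt.isLittleO
    have h2 : ∀ y : ℝ × ℝ, D * (e'.symm y).2 = y.2 := fun y => by
      have := congrArg Prod.snd ((he' (e'.symm y)).symm.trans (e'.apply_symm_apply y))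
      rw [hZa] at this
      rw [mul_comm]; exact this
    simp only [hΨ0, sub_zero] at h1
    refine Asymptotics.IsLittleO.congr' (f₁ := fun y => -D * (Ψ y - (t₀, 0) - e'.symm y).2) ?_
      (Eventually.of_forall fun y => ?_) (Eventually.of_forall fun y => rfl)
    · refine Asymptotics.IsLittleO.const_mul_left ?_ _
      exact (Asymptotics.isBigO_of_le _ fun y => norm_snd_le _).trans_isLittleO h1
    · simp only [Prod.snd_sub, sub_zero]
      linear_combination (1 : ℝ) * h2 y

/-- The moving coordinates of the points of the section at time `0`. -/
theorem section_start {t₀ : ℝ} (hct : c t₀ = c 0) :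
    (fun v => movingCoord α N c t₀ (σ v)) =O[𝓝 0] fun v : ℝ => v := by
  have hσd := hσ.contMDiffAt.mdifferentiableAt (by norm_num)
  have h := hasFDerivAt_movingCoord S hε hc (hasFDerivAt_const t₀ (0 : ℝ))
    (S.hasDerivAt_curve hσd).hasFDerivAt
  have h1 := h.isBigO_sub
  simpa only [hσ.base.trans hct.symm, movingCoord_self, sub_zero] using h1

end CrossSection

/-! ### Uniqueness of the orbits -/

section Uniqueness

variable {M : Type*} [TopologicalSpace M] [ChartedSpace E2 M]
variable {α N : M → E3} {ε : ℝ} {c : ℝ → M} {Θ : ℝ × (ℝ × ℝ) → M}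
variable [IsManifold (𝓡 2) ∞ M] (S : IsOrientedImmersion α N) (hε : ε ^ 2 = 1)
  (hc : IsDirectedLine α N ε c)
include S hε

omit [IsManifold (𝓡 2) ∞ M] hε in
theorem continuousOn_tangent {γ : ℝ → M} {U : Set ℝ} (hU : IsOpen U)
    (hγ : ContMDiffOn 𝓘(ℝ, ℝ) (𝓡 2) 1 γ U) : ContinuousOn (tangent α γ) U := by
  have h : ContDiffOn ℝ 1 (fun t => α (γ t)) U := fun t ht =>
    (contDiffAt_comp ((S.contMDiff _).of_le (by norm_num))
      (hγ.contMDiffAt (hU.mem_nhds ht))).contDiffWithinAt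
  exact h.continuousOn_deriv_of_isOpen hU le_rfl

/-- At a regular point, the harmonic directions with torsion of given sign are opposite. -/
theorem inner_ne_zero_of_isHarmonicDir {p : M} (hp : IsRegularPoint α N p) {e f u : E3}
    (he : IsHarmonicDir α N ε p e) (hf : IsHarmonicDir α N ε p f) (h : inner ℝ u e ≠ 0) :
    inner ℝ u f ≠ 0 := by
  intro h0
  have h1 := S.dirProj_apply hε hp he u
  rw [S.dirProj_apply hε hp hf u, h0, zero_smul, eq_comm, smul_eq_zero] at h1
  rcases h1 with h1 | h1
  · exact h h1
  · have := he.isFrame.norm_fst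
    rw [h1, norm_zero] at this
    norm_num at this

include hc

/-- Two lines of the foliation that leave a point in the same direction coincide. -/
theorem eq_of_isHarmonicLineOn [T2Space M] {a₀ b₀ ρ C : ℝ} (hU : IsUniformTube α N ε c Θ a₀ b₀ ρ C)
    {y : ℝ → ℝ × ℝ} {m : ℝ} (ha₀ : a₀ ≤ 0) (hm : m < b₀)
    (hy : ∀ t ∈ Icc 0 m, ‖y t‖ < ρ ∧ HasDerivAt y (tubeField α N ε c Θ t (y t)) t)
    {γ : ℝ → M} {a b : ℝ} (ha : a < 0) (hmb : m < b) (hγ : IsHarmonicLineOn α N γ (Ioo a b))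
    (hs : ∀ t ∈ Ioo a b, 0 < geodesicTorsion α N γ t * ε) (h0 : γ 0 = Θ (0, y 0))
    (hd : 0 < inner ℝ (tangent α γ 0) (tangent α c 0)) :
    ∀ t ∈ Icc 0 m, γ t = Θ (t, y t) := by
  have hsub : Icc 0 m ⊆ Ioo a b := fun t ht => ⟨ha.trans_le ht.1, ht.2.trans_lt hmb⟩
  have hsub' : Icc 0 m ⊆ Icc a₀ b₀ := fun t ht => ⟨ha₀.trans ht.1, ht.2.trans hm.le⟩
  have hTγ := continuousOn_tangent S isOpen_Ioo hγ.contMDiffOn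
  have hT := (hc.contDiff_tangent S hε).continuous
  have hgood : ∀ t ∈ Icc 0 m, IsGood α N ε c Θ (t, y t) := fun t ht =>
    hU.good t (hsub' ht) _ (hy t ht).1
  have hγd : ∀ t ∈ Ioo a b, MDifferentiableAt 𝓘(ℝ, ℝ) (𝓡 2) γ t := fun t ht =>
    (hγ.contMDiffOn.contMDiffAt (isOpen_Ioo.mem_nhds ht)).mdifferentiableAt (by norm_num)
  -- Continuation along the interval. The weak inequality makes `s` closed; at a point of `s` the
  -- inner product cannot vanish, so it is positive nearby, the orientation persists, and local
  -- uniqueness for the differential equation extends the agreement.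
  set s : Set ℝ := {t | γ t = Θ (t, y t) ∧ 0 ≤ inner ℝ (tangent α γ t) (tangent α c t)} with hsdef
  have hclosed : IsClosed (s ∩ Icc 0 m) := by
    have h1 : ContinuousOn (fun t => (γ t, Θ (t, y t))) (Icc 0 m) :=
      (hγ.contMDiffOn.continuousOn.mono hsub).prodMk fun t ht =>
        (ContinuousAt.comp (f := fun s => ((s, y s) : ℝ × (ℝ × ℝ)))
          (hgood t ht).contMDiffAt.continuousAt
          (continuousAt_id.prodMk (hy t ht).2.continuousAt)).continuousWithinAt
    have h2 : ContinuousOn (fun t => inner ℝ (tangent α γ t) (tangent α c t)) (Icc 0 m) :=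
      (hTγ.mono hsub).inner hT.continuousOn
    have h3 := h1.preimage_isClosed_of_isClosed isClosed_Icc isClosed_diagonal
    have h4 := h2.preimage_isClosed_of_isClosed isClosed_Icc isClosed_Ici (t := Ici 0)
    convert h3.inter h4 using 1
    ext t
    simp only [hsdef, mem_inter_iff, mem_ofPred_eq, mem_preimage, mem_diagonal_iff, mem_Ici]
    tauto
  have hmain := hclosed.Icc_subset_of_forall_exists_gt ⟨h0, hd.le⟩ (fun x hx z hz => by
    obtain ⟨⟨hx1, hx2⟩, hx3⟩ := hx
    have hxm : x ∈ Icc 0 m := Ico_subset_Icc_self hx3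
    have hg := hgood x hxm
    have hxU := hsub hxm
    have hdir : ∀ t ∈ Ioo a b, IsHarmonicDir α N ε (γ t) (tangent α γ t) := fun t ht =>
      S.isHarmonicDir_tangent hε isOpen_Ioo hγ ht (hs t ht)
    have hne : inner ℝ (tangent α c x) (tangent α γ x) ≠ 0 := by
      have h1 := hdir x hxU
      rw [hx1] at h1
      refine inner_ne_zero_of_isHarmonicDir S hε hg.regular
        (S.isHarmonicDir_dirField hε hg.regular hg.proj_ne) h1 ?_
      have := hg.forward
      rw [real_inner_comm] at this
      exact this.ne'
    rw [real_inner_comm] at hx2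
    have hpos : 0 < inner ℝ (tangent α c x) (tangent α γ x) := lt_of_le_of_ne hx2 hne.symm
    have hγc : ContinuousAt γ x :=
      (hγ.contMDiffOn.contMDiffAt (isOpen_Ioo.mem_nhds hxU)).continuousAt
    have e1 : ∀ᶠ t in 𝓝 x, 0 < inner ℝ (tangent α c t) (tangent α γ t) :=
      (hT.continuousAt.inner (hTγ.continuousAt (isOpen_Ioo.mem_nhds hxU))).eventually
        (lt_mem_nhds hpos)
    have e2 : ∀ᶠ t in 𝓝 x, t ∈ Ioo a b := isOpen_Ioo.mem_nhds hxU
    have e3 : ∀ᶠ t in 𝓝 x, Θ (t, movingCoord α N c t (γ t)) = γ t := by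
      have h1 : Tendsto (fun t => (t, γ t)) (𝓝 x) (𝓝 (x, Θ (x, y x))) := by
        rw [← hx1]; exact tendsto_id.prodMk_nhds hγc
      exact h1.eventually hg.left_inv
    have hzd : ∀ᶠ t in 𝓝 x, HasDerivAt (fun s => movingCoord α N c s (γ s))
        (tubeField α N ε c Θ t (movingCoord α N c t (γ t))) t := by
      filter_upwards [e1, e2, e3] with t h1 h2 h3
      refine hasDerivAt_of_tangent S hε hc (hγd t h2) h3 ?_
      exact (S.dirField_eq hε ⟨hγ.elliptic t h2, hγ.not_umbilic t h2⟩ (hdir t h2) h1).2.symm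
    have hzx : movingCoord α N c x (γ x) = y x := by rw [hx1]; exact hg.right_inv.self_of_nhds
    have e4 : ∀ᶠ t in 𝓝 x, ‖movingCoord α N c t (γ t)‖ < ρ :=
      hzd.self_of_nhds.continuousAt.norm.eventually (gt_mem_nhds (by
        simp only [hzx]; exact (hy x hxm).1))
    obtain ⟨r, hr, hball⟩ := Metric.eventually_nhds_iff.1 (e1.and (e3.and (hzd.and e4)))
    set w := min (x + r / 2) (min z m) with hw
    have hxw : x < w := lt_min (by linarith) (lt_min hz hx3.2)
    have hwm : w ≤ m := (min_le_right _ _).trans (min_le_right _ _)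
    have hnear : ∀ t ∈ Icc x w, dist t x < r := fun t ht => by
      rw [Real.dist_eq, abs_of_nonneg (by linarith [ht.1])]
      linarith [ht.2, min_le_left (x + r / 2) (min z m)]
    have hIcc : ∀ t ∈ Icc x w, t ∈ Icc 0 m := fun t ht =>
      ⟨hx3.1.trans ht.1, ht.2.trans hwm⟩
    have huniq := dist_le_of_trajectories_ODE_of_mem (v := tubeField α N ε c Θ)
      (K := C.toNNReal) (s := fun _ => Metric.ball 0 ρ)
      (f := fun t => movingCoord α N c t (γ t)) (g := y) (a := x) (b := w) (δ := 0)
      (fun t ht => LipschitzOnWith.of_dist_le_mul fun u hu u' hu' => by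
        rw [dist_eq_norm, dist_eq_norm, Real.coe_toNNReal C hU.const_nonneg]
        exact hU.lipschitz t (hsub' (hIcc t (Ico_subset_Icc_self ht))) u u'
          (mem_ball_zero_iff.1 hu) (mem_ball_zero_iff.1 hu'))
      (fun t ht => (hball (hnear t ht)).2.2.1.continuousAt.continuousWithinAt)
      (fun t ht => (hball (hnear t (Ico_subset_Icc_self ht))).2.2.1.hasDerivWithinAt)
      (fun t ht => mem_ball_zero_iff.2 (hball (hnear t (Ico_subset_Icc_self ht))).2.2.2)
      (fun t ht => (hy t (hIcc t ht)).2.continuousAt.continuousWithinAt)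
      (fun t ht => (hy t (hIcc t (Ico_subset_Icc_self ht))).2.hasDerivWithinAt)
      (fun t ht => mem_ball_zero_iff.2 (hy t (hIcc t (Ico_subset_Icc_self ht))).1)
      (by simp [hzx])
    have hww : w ∈ Icc x w := ⟨hxw.le, le_rfl⟩
    have h1 := huniq w hww
    rw [zero_mul] at h1
    have h2 := dist_le_zero.1 h1
    obtain ⟨g1, g2, -⟩ := hball (hnear w hww)
    refine ⟨w, ⟨?_, ?_⟩, hxw, (min_le_right _ _).trans (min_le_left _ _)⟩
    · rw [← h2]; exact g2.symm
    · rw [real_inner_comm]; exact g1.le)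
  exact fun t ht => (hmain ht).1

end Uniqueness

/-! ### The first return -/

section Return

variable {M : Type*} [TopologicalSpace M] [ChartedSpace E2 M]

omit [TopologicalSpace M] [ChartedSpace E2 M] in
theorem tangent_periodic {α : M → E3} {c : ℝ → M} {L : ℝ} (h : Function.Periodic c L) :
    Function.Periodic (tangent α c) L := fun t => by
  have h1 : (fun u => α (c (u + L))) = fun u => α (c u) := funext fun u => by rw [h u]
  have h2 := deriv_comp_add_const (fun u => α (c u)) L t
  rw [h1] at h2
  exact h2.symm

/-- The orbit `t ↦ Θ (t, y t)` starts at the section point `σ v` and returns to the section for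
the first time at time `T`, in the point `σ w`. -/
structure IsReturnOrbit (α N : M → E3) (ε : ℝ) (c σ : ℝ → M) (δ : ℝ) (Θ : ℝ × (ℝ × ℝ) → M)
    (ρ b v : ℝ) (y : ℝ → ℝ × ℝ) (T w : ℝ) : Prop where
  start_point : Θ (0, y 0) = σ v
  orbit : ∃ a < 0, ∀ t ∈ Ioo a b, IsGood α N ε c Θ (t, y t) ∧ ‖y t‖ < ρ ∧
    HasDerivAt y (tubeField α N ε c Θ t (y t)) t
  time_pos : 0 < T
  time_lt : T < b
  end_point : Θ (T, y T) = σ w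
  mem : w ∈ Icc (-δ) δ
  first : ∀ t ∈ Ioo 0 T, Θ (t, y t) ∉ σ '' Icc (-δ) δ

/-- A slow curve meets the section only once in a short time. -/
theorem eq_of_chart_eq {Ψ : ℝ × ℝ → ℝ × ℝ} {K : NNReal} {s : Set (ℝ × ℝ)}
    (hΨ : LipschitzOnWith K Ψ s) {B : ℝ} (hKB : K * B ≤ 1 / 2) {y : ℝ → ℝ × ℝ} {g : ℝ → ℝ × ℝ}
    {p q : ℝ} (hy : ∀ t ∈ Icc p q, y t ∈ s ∧ ‖g t‖ ≤ B ∧ HasDerivAt y (g t) t) {t t' : ℝ}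
    (ht : t ∈ Icc p q) (ht' : t' ∈ Icc p q) (h : (Ψ (y t)).1 = t) (h' : (Ψ (y t')).1 = t') :
    t = t' := by
  have h1 : ‖y t' - y t‖ ≤ B * ‖t' - t‖ :=
    (convex_Icc p q).norm_image_sub_le_of_norm_hasDerivWithin_le
      (fun x hx => (hy x hx).2.2.hasDerivWithinAt) (fun x hx => (hy x hx).2.1) ht ht'
  have h2 := hΨ.dist_le_mul _ (hy t' ht').1 _ (hy t ht).1
  rw [dist_eq_norm, dist_eq_norm] at h2
  have h3 : ‖t' - t‖ ≤ ‖Ψ (y t') - Ψ (y t)‖ := by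
    have := norm_fst_le (Ψ (y t') - Ψ (y t))
    rwa [Prod.fst_sub, h, h'] at this
  -- The map t ↦ (Ψ (y t)).1 contracts by the factor K·B ≤ 1/2, and both times are fixed points of
  -- it.
  have h4 : ‖t' - t‖ ≤ 1 / 2 * ‖t' - t‖ := by
    refine h3.trans (h2.trans ((mul_le_mul_of_nonneg_left h1 K.2).trans ?_))
    rw [← mul_assoc]
    exact mul_le_mul_of_nonneg_right hKB (norm_nonneg _)
  have h5 : ‖t' - t‖ ≤ 0 := by linarith
  exact (sub_eq_zero.1 (norm_le_zero_iff.1 h5)).symm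

variable {α N : M → E3} {ε : ℝ} {c : ℝ → M} {Θ : ℝ × (ℝ × ℝ) → M} {σ : ℝ → M} {δ : ℝ}
variable [IsManifold (𝓡 2) ∞ M] [T2Space M] (S : IsOrientedImmersion α N) (hε : ε ^ 2 = 1)
  (hc : IsDirectedLine α N ε c) (hσ : IsCrossSection α c σ δ)
include hσ

omit [IsManifold (𝓡 2) ∞ M] in
/-- Away from the ends of a period, the orbits near the cycle avoid the section. -/
theorem exists_radius_avoid {L η : ℝ} (hinj : InjOn c (Ico 0 L)) (hη : 0 < η)
    (hΘ : ∀ t ∈ Icc η (L - η), IsTubeAt α N c Θ t) :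
    ∃ r > 0, ∀ t ∈ Icc η (L - η), ∀ y, ‖y‖ < r → Θ (t, y) ∉ σ '' Icc (-δ) δ := by
  obtain ⟨r, hr, -, h⟩ := exists_uniform_radius
    (Q := fun _ t (y : ℝ × ℝ) => Θ (t, y) ∉ σ '' Icc (-δ) δ) (fun _ _ _ _ _ h => h)
    (a := η) (b := L - η) (fun t ht => ⟨0, by
      have h1 : c t ∉ σ '' Icc (-δ) δ := by
        rintro ⟨w, hw, h⟩
        have h0 := hσ.meets_once w hw ⟨t, h.symm⟩
        rw [h0, hσ.base] at h
        have := hinj ⟨le_rfl, by linarith [ht.1, ht.2]⟩ ⟨by linarith [ht.1], by linarith [ht.2]⟩ h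
        linarith [ht.1]
      have h2 : ContinuousAt Θ (t, 0) := (hΘ t ht).contMDiffAt.continuousAt
      rw [← (hΘ t ht).base] at h1
      exact h2.eventually
        ((hσ.isClosed_image isClosed_Icc subset_rfl).isOpen_compl.mem_nhds h1)⟩)
  exact ⟨r, hr, h⟩

include S hε hc

/-- Every orbit that starts on the section close to the cycle returns to the section. -/
theorem exists_returnOrbit {L : ℝ} (hL : 0 < L)
    (hinj : InjOn c (Ico 0 L)) {ρ C : ℝ} (hU : IsUniformTube α N ε c Θ (-1) (L + 1) ρ C)
    {D : ℝ} {Ψ₀ Ψ : ℝ × ℝ → ℝ × ℝ} (hΨ₀ : IsSectionChart σ δ Θ D 0 Ψ₀)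
    (hΨ : IsSectionChart σ δ Θ D L Ψ) :
    ∃ A ≥ 0, ∀ᶠ v in 𝓝 (0 : ℝ), ∃ y T w, IsReturnOrbit α N ε c σ δ Θ ρ (L + 1) v y T w ∧
      (∀ t ∈ Ico 0 (L + 1), ‖y t‖ ≤ A * |v|) ∧ Ψ (y T) = (T, w) ∧ Ψ₀ (y 0) = (0, v) := by
  have hΘ := hU.tube
  obtain ⟨K₀, s₀, hs₀, hK₀⟩ := hΨ₀.lipschitz
  obtain ⟨K, s, hs, hK⟩ := hΨ.lipschitz
  obtain ⟨e₀, he₀, h₀⟩ := Metric.eventually_nhds_iff.1 hΨ₀.hit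
  obtain ⟨e, he, h⟩ := Metric.eventually_nhds_iff.1 hΨ.hit
  obtain ⟨e', he', hnear⟩ := Metric.eventually_nhds_iff.1 ((hΨ.mem.and hs₀).and hs)
  -- Half-width of the time windows around 0 and L in which the charts detect hits of the section.
  -- The bound 1/2 keeps them inside the tube, and L/2 gives η ≤ L − η.
  set η := min (min (e₀ / 2) (e / 2)) (min (1 / 2) (L / 2)) with hηdef
  have hη : 0 < η := by positivity
  have hη₀ : η < e₀ := ((min_le_left _ _).trans (min_le_left _ _)).trans_lt (half_lt_self he₀)
  have hηe : η < e := ((min_le_left _ _).trans (min_le_right _ _)).trans_lt (half_lt_self he)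
  have hη1 : η ≤ 1 / 2 := (min_le_right _ _).trans (min_le_left _ _)
  have hηL : η ≤ L / 2 := (min_le_right _ _).trans (min_le_right _ _)
  obtain ⟨r', hr', havoid⟩ := exists_radius_avoid hσ hinj hη
    (fun t ht => hΘ t ⟨by linarith [ht.1], by linarith [ht.2]⟩)
  have hC := hU.const_nonneg
  -- Orbits of size below r have speed at most C r. The bounds r κ ≤ 1 and r κ ≤ η yield the
  -- contraction condition in both windows and keep the time component of Ψ within η of L.
  set κ : ℝ := 2 * (K₀ + K + 1) * (C + 1) with hκ
  have hK₀0 : (0 : ℝ) ≤ K₀ := K₀.2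
  have hK0 : (0 : ℝ) ≤ K := K.2
  have hκ1 : 0 < κ := by positivity
  set r := min (min (min e₀ e) (min e' r')) (min ρ (min (1 / κ) (η / κ))) with hrdef
  have hr : 0 < r := by have := hU.radius_pos; positivity
  have hre₀ : r ≤ e₀ := (min_le_left _ _).trans ((min_le_left _ _).trans (min_le_left _ _))
  have hre : r ≤ e := (min_le_left _ _).trans ((min_le_left _ _).trans (min_le_right _ _))
  have hre' : r ≤ e' := (min_le_left _ _).trans ((min_le_right _ _).trans (min_le_left _ _))
  have hrr' : r ≤ r' := (min_le_left _ _).trans ((min_le_right _ _).trans (min_le_right _ _))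
  have hrρ : r ≤ ρ := (min_le_right _ _).trans (min_le_left _ _)
  have hrκ : r * κ ≤ 1 := (le_div_iff₀ hκ1).1
    ((min_le_right _ _).trans ((min_le_right _ _).trans (min_le_left _ _)))
  have hrη : r * κ ≤ η := (le_div_iff₀ hκ1).1
    ((min_le_right _ _).trans ((min_le_right _ _).trans (min_le_right _ _)))
  have hb₀ : K₀ * (C * r) ≤ 1 / 2 := by
    have : K₀ * C * r * 2 ≤ r * κ := by
      rw [hκ]
      nlinarith [mul_nonneg hK₀0 hr.le, mul_nonneg hK0 hr.le, mul_nonneg hC hr.le,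
        mul_nonneg (mul_nonneg hK0 hC) hr.le]
    linarith
  have hb : K * (C * r) ≤ 1 / 2 := by
    have : K * C * r * 2 ≤ r * κ := by
      rw [hκ]
      nlinarith [mul_nonneg hK₀0 hr.le, mul_nonneg hK0 hr.le, mul_nonneg hC hr.le,
        mul_nonneg (mul_nonneg hK₀0 hC) hr.le]
    linarith
  have hKr : K * r < η := by
    have : K * r < r * κ := by
      rw [hκ]
      nlinarith [mul_nonneg hK₀0 hr.le, mul_nonneg hK0 hr.le, mul_nonneg hC hr.le,
        mul_nonneg (mul_nonneg hK₀0 hC) hr.le, mul_nonneg (mul_nonneg hK0 hC) hr.le]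
    linarith
  obtain ⟨A₀, hA₀, hstart⟩ := (section_start S hε hc hσ (t₀ := 0) rfl).exists_nonneg
  set E := Real.exp (C * (L + 1)) with hE
  have hE0 : 0 < E := Real.exp_pos _
  refine ⟨A₀ * E, by positivity, ?_⟩
  have q1 : ∀ᶠ v in 𝓝 (0 : ℝ), A₀ * E * |v| < r := by
    have : ContinuousAt (fun v : ℝ => A₀ * E * |v|) 0 := by fun_prop
    exact this.eventually (gt_mem_nhds (by simpa using hr))
  have q2 : ∀ᶠ v in 𝓝 (0 : ℝ), Θ (0, movingCoord α N c 0 (σ v)) = σ v := by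
    have h1 : Tendsto (fun v => ((0 : ℝ), σ v)) (𝓝 0) (𝓝 (0, c 0)) := by
      rw [← hσ.base]
      exact tendsto_const_nhds.prodMk_nhds hσ.contMDiffAt.continuousAt
    exact h1.eventually (hΘ 0 ⟨by linarith, by linarith⟩).left_inv
  have q3 : ∀ᶠ v in 𝓝 (0 : ℝ), v ∈ Icc (-δ) δ :=
    Icc_mem_nhds (by linarith [hσ.pos]) hσ.pos
  filter_upwards [q1, q2, q3, hstart.bound] with v h1 h2 h3 h4
  have h5 : ‖movingCoord α N c 0 (σ v)‖ * E ≤ A₀ * E * |v| := by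
    rw [mul_right_comm]; exact mul_le_mul_of_nonneg_right h4 hE0.le
  obtain ⟨y, hy0, hyb, a', ha', ha, hy⟩ := hU.exists_orbit S hε hc (by norm_num) (by linarith)
    (y₀ := movingCoord α N c 0 (σ v)) (by linarith)
  have hyA : ∀ t ∈ Ico 0 (L + 1), ‖y t‖ ≤ A₀ * E * |v| := fun t ht => (hyb t ht).trans h5
  have hyr : ∀ t ∈ Ico 0 (L + 1), ‖y t‖ < r := fun t ht => (hyA t ht).trans_lt h1
  have hyn : ∀ t ∈ Ico 0 (L + 1), ((Ψ (y t)).2 ∈ Icc (-δ) δ ∧ y t ∈ s₀) ∧ y t ∈ s := fun t ht =>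
    hnear (by rw [dist_zero_right]; exact (hyr t ht).trans_le hre')
  have hyD : ∀ t ∈ Ico 0 (L + 1), ‖tubeField α N ε c Θ t (y t)‖ ≤ C * r := fun t ht => by
    have ht' : t ∈ Icc (-1) (L + 1) := ⟨by linarith [ht.1], ht.2.le⟩
    have h6 := hU.lipschitz t ht' (y t) 0 ((hyr t ht).trans_le hrρ)
      (by rw [norm_zero]; exact hU.radius_pos)
    rw [tubeField_zero S hε hc (hΘ t ht').base, sub_zero, sub_zero] at h6
    exact h6.trans (mul_le_mul_of_nonneg_left (hyr t ht).le hC)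
  have hhit₀ : ∀ t ∈ Icc 0 η, ∀ w ∈ Icc (-δ) δ, σ w = Θ (t, y t) ↔ Ψ₀ (y t) = (t, w) :=
    fun t ht => h₀ (y := (t, y t)) (by
      change max (dist t 0) (dist (y t) 0) < e₀
      rw [dist_zero_right (y t), Real.dist_eq, sub_zero, abs_of_nonneg ht.1]
      exact max_lt (by linarith [ht.2])
        ((hyr t ⟨ht.1, by linarith [ht.2]⟩).trans_le hre₀))
  have hhit : ∀ t ∈ Icc (L - η) (L + η), ∀ w ∈ Icc (-δ) δ, σ w = Θ (t, y t) ↔ Ψ (y t) = (t, w) :=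
    fun t ht => h (y := (t, y t)) (by
      change max (dist t L) (dist (y t) 0) < e
      rw [dist_zero_right (y t), Real.dist_eq]
      exact max_lt ((abs_le.2 ⟨by linarith [ht.1], by linarith [ht.2]⟩ : |t - L| ≤ η).trans_lt hηe)
        ((hyr t ⟨by linarith [ht.1], by linarith [ht.2]⟩).trans_le hre))
  have hIL : ∀ t ∈ Icc (L - η) (L + η), t ∈ Ico 0 (L + 1) := fun t ht =>
    ⟨by linarith [ht.1], by linarith [ht.2]⟩
  have hΨL : ∀ t ∈ Icc (L - η) (L + η), |(Ψ (y t)).1 - L| < η := fun t ht => by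
    have h6 := hK.dist_le_mul _ (hyn t (hIL t ht)).2 0 (mem_of_mem_nhds hs)
    rw [hΨ.base, dist_zero_right] at h6
    have h7 : |(Ψ (y t)).1 - L| ≤ dist (Ψ (y t)) (L, 0) := by
      rw [Prod.dist_eq, Real.dist_eq]; exact le_max_left _ _
    exact h7.trans_lt (h6.trans_lt
      ((mul_le_mul_of_nonneg_left (hyr t (hIL t ht)).le hK0).trans_lt hKr))
  have hhc : ContinuousOn (fun t => t - (Ψ (y t)).1) (Icc (L - η) (L + η)) := by
    refine continuousOn_id.sub (continuous_fst.comp_continuousOn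
      (hK.continuousOn.comp (fun t ht => ?_) fun t ht => (hyn t (hIL t ht)).2))
    have := hIL t ht
    exact (hy t ⟨by linarith [this.1], this.2⟩).2.continuousAt.continuousWithinAt
  -- A return time is a zero of t − (Ψ (y t)).1, which changes sign across the window as the time
  -- component of Ψ stays within η of L.
  obtain ⟨T, hT, hT0⟩ := intermediate_value_Icc (by linarith) hhc (show (0 : ℝ) ∈ Icc _ _ from by
    have g1 := abs_lt.1 (hΨL (L - η) ⟨le_rfl, by linarith⟩)
    have g2 := abs_lt.1 (hΨL (L + η) ⟨by linarith, le_rfl⟩)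
    exact ⟨by linarith [g1.1], by linarith [g2.2]⟩)
  have hT1 : (Ψ (y T)).1 = T := (sub_eq_zero.1 hT0).symm
  have hwm := (hyn T (hIL T hT)).1.1
  have hw : Ψ (y T) = (T, (Ψ (y T)).2) := Prod.ext hT1 rfl
  have hv : Ψ₀ (y 0) = (0, v) := (hhit₀ 0 ⟨le_rfl, hη.le⟩ v h3).1 (by rw [hy0, h2])
  refine ⟨y, T, (Ψ (y T)).2, ⟨by rw [hy0, h2], ⟨a', ha', fun t ht =>
    ⟨hU.good t ⟨by linarith [ht.1], ht.2.le⟩ _ (hy t ht).1, hy t ht⟩⟩,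
    by linarith [hT.1], by linarith [hT.2], ((hhit T hT _ hwm).2 hw).symm, hwm, ?_⟩, hyA, hw, hv⟩
  rintro t ht ⟨w', hw', heq⟩
  have hdata : ∀ t ∈ Ico 0 (L + 1), HasDerivAt y (tubeField α N ε c Θ t (y t)) t := fun t ht =>
    (hy t ⟨by linarith [ht.1], ht.2⟩).2
  -- An earlier hit is impossible: in the first window time 0 is the only one, the middle piece
  -- avoids the section, and in the last window T is the only one.
  rcases le_or_gt t η with g1 | g1
  · have g2 := (hhit₀ t ⟨ht.1.le, g1⟩ w' hw').1 heq
    have g3 := eq_of_chart_eq hK₀ hb₀ (y := y) (g := fun t => tubeField α N ε c Θ t (y t))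
      (p := 0) (q := η) (fun t ht => by
        have ht' : t ∈ Ico 0 (L + 1) := ⟨ht.1, by linarith [ht.2]⟩
        exact ⟨(hyn t ht').1.2, hyD t ht', hdata t ht'⟩)
      (t := t) (t' := 0) ⟨ht.1.le, g1⟩ ⟨le_rfl, hη.le⟩ (by rw [g2]) (by rw [hv])
    linarith [ht.1]
  · rcases le_or_gt t (L - η) with g2 | g2
    · exact havoid t ⟨g1.le, g2⟩ (y t)
        ((hyr t ⟨ht.1.le, by linarith⟩).trans_le hrr') ⟨w', hw', heq⟩
    · have htI : t ∈ Icc (L - η) (L + η) := ⟨g2.le, by linarith [ht.2, hT.2]⟩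
      have g3 := (hhit t htI w' hw').1 heq
      have g4 := eq_of_chart_eq hK hb (y := y) (g := fun t => tubeField α N ε c Θ t (y t))
        (p := L - η) (q := L + η)
        (fun t ht => ⟨(hyn t (hIL t ht)).2, hyD t (hIL t ht), hdata t (hIL t ht)⟩)
        htI hT (by rw [g3]) hT1
      linarith [ht.2]

end Return

/-! ### The Poincaré map and its derivative -/

section PoincareMap

open Asymptotics

variable {M : Type*} [TopologicalSpace M] [ChartedSpace E2 M]
variable {α N : M → E3} {ε : ℝ} {c : ℝ → M} {Θ : ℝ × (ℝ × ℝ) → M} {σ : ℝ → M} {δ : ℝ}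
variable [IsManifold (𝓡 2) ∞ M] [T2Space M] (S : IsOrientedImmersion α N) (hε : ε ^ 2 = 1)
  (hc : IsDirectedLine α N ε c)
include S hε hc

omit [T2Space M] in
theorem IsReturnOrbit.firstReturn {ρ b v T w : ℝ} {y : ℝ → ℝ × ℝ}
    (h : IsReturnOrbit α N ε c σ δ Θ ρ b v y T w) : FirstReturn α N c σ δ v w := by
  obtain ⟨a, ha, horb⟩ := h.orbit
  obtain ⟨h1, h2⟩ := isHarmonicLineOn_of_solution S hε hc
    (fun t ht => ⟨(horb t ht).1, (horb t ht).2.2⟩)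
  have h0 : (0 : ℝ) ∈ Ioo a b := ⟨ha, h.time_pos.trans h.time_lt⟩
  refine ⟨_, a, b, T, ha, h.time_pos, h.time_lt, h1, fun t ht => ?_, ?_, h.start_point, h.end_point,
    h.mem, h.first⟩
  · have h3 := mul_pos (h2 t ht).2 (S.torsionFun_mul_pos hε (hc.regular 0))
    rw [hc.geodesicTorsion_eq S hε]
    have h4 : ∀ x y : ℝ, x * ε * (y * ε) = x * y := fun x y => by
      linear_combination (x * y) * hε
    rwa [h4] at h3
  · rw [(h2 0 h0).1]
    exact (horb 0 h0).1.forward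

/-- The first return is unique. -/
theorem IsReturnOrbit.eq_of_firstReturn {a₀ b₀ ρ C v T w w' : ℝ} {y : ℝ → ℝ × ℝ}
    (hU : IsUniformTube α N ε c Θ a₀ b₀ ρ C) (ha₀ : a₀ ≤ 0) (hσ : IsCrossSection α c σ δ)
    (h : IsReturnOrbit α N ε c σ δ Θ ρ b₀ v y T w) (h' : FirstReturn α N c σ δ v w') : w' = w := by
  obtain ⟨γ, a, b, T', ha, hT', hTb, hγ, hs, hd, hγ0, hγT, hw', hfirst⟩ := h'
  obtain ⟨a', ha', horb⟩ := h.orbit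
  have hs' : ∀ t ∈ Ioo a b, 0 < geodesicTorsion α N γ t * ε := fun t ht => by
    have h1 := hs t ht
    rw [hc.geodesicTorsion_eq S hε] at h1
    have h2 := S.torsionFun_mul_pos hε (hc.regular 0)
    have h3 : geodesicTorsion α N γ t * torsionFun α N ε (c 0)
        = geodesicTorsion α N γ t * ε * (torsionFun α N ε (c 0) * ε) := by
      linear_combination -(geodesicTorsion α N γ t * torsionFun α N ε (c 0)) * hε
    rw [h3] at h1
    exact (pos_iff_pos_of_mul_pos h1).2 h2
  have key : ∀ m, m < b₀ → m < b → ∀ t ∈ Icc 0 m, γ t = Θ (t, y t) := fun m hm hmb =>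
    eq_of_isHarmonicLineOn S hε hc hU ha₀ hm
      (fun t ht => (horb t ⟨ha'.trans_le ht.1, ht.2.trans_lt hm⟩).2) ha hmb hγ hs'
      (hγ0.trans h.start_point.symm) hd
  have hT0 := h.time_pos
  -- The curves agree as long as both are defined. If the times differed, the earlier one would be a
  -- hit before the first return of the other curve; for equal times injectivity of the section
  -- gives the claim.
  rcases lt_trichotomy T' T with g | g | g
  · have h1 := key T' (g.trans h.time_lt) hTb T' ⟨hT'.le, le_rfl⟩
    exact absurd ⟨w', hw', by rw [← h1, hγT]⟩ (h.first T' ⟨hT', g⟩)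
  · subst g
    have h1 := key T' h.time_lt hTb T' ⟨hT'.le, le_rfl⟩
    exact hσ.injOn hw' h.mem (by rw [← hγT, h1, h.end_point])
  · have h1 := key T h.time_lt (g.trans hTb) T ⟨hT0.le, le_rfl⟩
    exact absurd ⟨w, h.mem, by rw [h1, h.end_point]⟩ (hfirst T ⟨hT0, g⟩)

/-- The derivative of the return map at the cycle. -/
theorem hasDerivAt_return {L : ℝ} (hL : 0 < L) {ρ C : ℝ}
    (hU : IsUniformTube α N ε c Θ (-1) (L + 1) ρ C) {D : ℝ} (hD : D ≠ 0) {Ψ₀ Ψ : ℝ × ℝ → ℝ × ℝ}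
    (hΨ₀ : IsSectionChart σ δ Θ D 0 Ψ₀) (hΨ : IsSectionChart σ δ Θ D L Ψ) {A : ℝ} (hA : 0 ≤ A)
    {P : ℝ → ℝ} (hP : ∀ᶠ v in 𝓝 (0 : ℝ), ∃ y T,
      IsReturnOrbit α N ε c σ δ Θ ρ (L + 1) v y T (P v) ∧
      (∀ t ∈ Ico 0 (L + 1), ‖y t‖ ≤ A * |v|) ∧ Ψ (y T) = (T, P v) ∧ Ψ₀ (y 0) = (0, v)) :
    HasDerivAt P (returnWeight α N ε c 0 / returnWeight α N ε c L) 0 := by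
  obtain ⟨y, hP⟩ := hP.choice
  obtain ⟨T, hP⟩ := hP.choice
  set W := returnWeight α N ε c with hW
  have hWc : Continuous W :=
    continuous_iff_continuousAt.2 fun t => (hasDerivAt_returnWeight S hε hc t).continuousAt
  have bY : ∀ᶠ v in 𝓝 (0 : ℝ), ‖y v (T v)‖ ≤ A * ‖v‖ := by
    filter_upwards [hP] with v hv
    exact hv.2.1 _ ⟨hv.1.time_pos.le, hv.1.time_lt⟩
  have bY₀ : ∀ᶠ v in 𝓝 (0 : ℝ), ‖y v 0‖ ≤ A * ‖v‖ := by
    filter_upwards [hP] with v hv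
    exact hv.2.1 _ ⟨le_rfl, hv.1.time_pos.trans hv.1.time_lt⟩
  have oY : (fun v => y v (T v)) =O[𝓝 0] fun v : ℝ => v := IsBigO.of_bound A bY
  have oY₀ : (fun v => y v 0) =O[𝓝 0] fun v : ℝ => v := IsBigO.of_bound A bY₀
  have tid : Tendsto (fun v : ℝ => v) (𝓝 0) (𝓝 0) := tendsto_id
  have tY : Tendsto (fun v => y v (T v)) (𝓝 0) (𝓝 0) := oY.trans_tendsto tid
  have tY₀ : Tendsto (fun v => y v 0) (𝓝 0) (𝓝 0) := oY₀.trans_tendsto tid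
  obtain ⟨K, s, hs, hK⟩ := hΨ.lipschitz
  have hΨd : (fun v => (T v - L, P v)) =O[𝓝 0] fun v : ℝ => v := by
    refine IsBigO.trans (IsBigO.of_bound K ?_) oY
    filter_upwards [hP, tY.eventually hs] with v hv hvs
    have h1 := hK.dist_le_mul _ hvs 0 (mem_of_mem_nhds hs)
    rw [hv.2.2.1, hΨ.base, dist_zero_right, dist_eq_norm, Prod.mk_sub_mk, sub_zero] at h1
    exact h1
  have oT : (fun v => T v - L) =O[𝓝 0] fun v : ℝ => v :=
    (isBigO_of_le _ fun v => norm_fst_le (T v - L, P v)).trans hΨd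
  have oP : P =O[𝓝 0] fun v : ℝ => v :=
    (isBigO_of_le _ fun v => norm_snd_le (T v - L, P v)).trans hΨd
  have tT : Tendsto T (𝓝 0) (𝓝 L) := by
    have := (oT.trans_tendsto tid).add_const L
    simpa using this
  have tW : Tendsto (fun v => W (T v)) (𝓝 0) (𝓝 (W L)) := (hWc.tendsto L).comp tT
  -- The section charts give y₂ = D v + o(v) at the start and y₂ = D P(v) + o(v) at the end (`f0`,
  -- `f2`), the conservation law joins the two (`f1`), and T(v) → L allows the final weight to be
  -- taken at L (`f3`). Together W(L) D P(v) = W(0) D v + o(v).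
  have f0 : (fun v => (y v 0).2 - D * v) =o[𝓝 0] fun v : ℝ => v := by
    refine IsLittleO.congr' ((hΨ₀.deriv.comp_tendsto tY₀).trans_isBigO oY₀) ?_ EventuallyEq.rfl
    filter_upwards [hP] with v hv
    simp only [Function.comp, hv.2.2.2]
  have f2 : (fun v => (y v (T v)).2 - D * P v) =o[𝓝 0] fun v : ℝ => v := by
    refine IsLittleO.congr' ((hΨ.deriv.comp_tendsto tY).trans_isBigO oY) ?_ EventuallyEq.rfl
    filter_upwards [hP] with v hv
    simp only [Function.comp, hv.2.2.1]
  have f1 : (fun v => W (T v) * (y v (T v)).2 - W 0 * (y v 0).2) =o[𝓝 0] fun v : ℝ => v := by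
    rw [isLittleO_iff]
    intro k hk
    -- For small v the return occurs before L + 1/2, so a fixed interval serves all orbits. The rate
    -- η makes the accumulated error at most k|v|; A + 1 replaces A because A may be zero.
    obtain ⟨r, hr, hcons⟩ := exists_radius_conservation S hε hc (b := L + 1 / 2)
      (fun t ht => hU.tube t ⟨by linarith [ht.1], by linarith [ht.2]⟩)
      (η := k / ((A + 1) * (L + 1 / 2))) (by positivity)
    have e1 : ∀ᶠ v in 𝓝 (0 : ℝ), A * |v| < r := by
      have : ContinuousAt (fun v : ℝ => A * |v|) 0 := by fun_prop
      exact this.eventually (gt_mem_nhds (by simpa using hr))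
    have e2 : ∀ᶠ v in 𝓝 (0 : ℝ), T v < L + 1 / 2 := tT.eventually (gt_mem_nhds (by linarith))
    filter_upwards [hP, e1, e2] with v hv h1 h2
    obtain ⟨a, ha, horb⟩ := hv.1.orbit
    have h3 := hcons (y v) (A * |v|) h1 (fun t ht =>
      ⟨hv.2.1 t ⟨ht.1, by linarith [ht.2]⟩, (horb t ⟨by linarith [ht.1], by linarith [ht.2]⟩).2.2⟩)
      (T v) ⟨hv.1.time_pos.le, h2.le⟩
    rw [Real.norm_eq_abs, Real.norm_eq_abs]
    refine h3.trans ?_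
    have h4 : k / ((A + 1) * (L + 1 / 2)) * (A * |v|) * (L + 1 / 2) = k * |v| * (A / (A + 1)) := by
      field_simp
    rw [h4]
    exact mul_le_of_le_one_right (by positivity) ((div_le_one (by positivity)).2 (by linarith))
  have f3 : (fun v => (W (T v) - W L) * (D * P v)) =o[𝓝 0] fun v : ℝ => v := by
    have h1 : (fun v => W (T v) - W L) =o[𝓝 0] fun _ => (1 : ℝ) := by
      rw [isLittleO_one_iff]
      have := tW.sub_const (W L)
      rwa [sub_self] at this
    simpa using h1.mul_isBigO (oP.const_mul_left D)
  have f4 : (fun v => W (T v) * ((y v (T v)).2 - D * P v)) =o[𝓝 0] fun v : ℝ => v := by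
    simpa using (tW.isBigO_one ℝ).mul_isLittleO f2
  have f5 : (fun v => W L * D * P v - W 0 * D * v) =o[𝓝 0] fun v : ℝ => v := by
    refine (((f1.sub f4).add (f0.const_mul_left (W 0))).sub f3).congr_left fun v => ?_
    ring
  have hP0 : P 0 = 0 := by
    have h0 := hP.self_of_nhds
    have h1 := bY.self_of_nhds
    rw [norm_zero, mul_zero] at h1
    have h2 := h0.2.2.1
    rw [norm_le_zero_iff.1 h1, hΨ.base] at h2
    exact (congrArg Prod.snd h2).symm
  rw [hasDerivAt_iff_isLittleO]
  have hWL : W L ≠ 0 := (returnWeight_pos α N ε c L).ne'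
  simp only [hP0, sub_zero]
  refine (f5.const_mul_left (W L * D)⁻¹).congr_left fun v => ?_
  rw [smul_eq_mul]
  field_simp

omit S hε hc [IsManifold (𝓡 2) ∞ M] [T2Space M] in
-- The factor √|τ| has the same value at both ends of the cycle, so only the integral survives.
theorem returnWeight_ratio {L : ℝ} (hL : c L = c 0) :
    returnWeight α N ε c 0 / returnWeight α N ε c L
      = Real.exp (∫ s in (0 : ℝ)..L, returnIntegrand α N c s) := by
  rw [returnWeight, returnWeight, hL, intervalIntegral.integral_same, ← Real.exp_sub]
  congr 1
  ring

omit [T2Space M] in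
-- `torsionFun` amounts to having |H| in the denominator. Since H has no zero along the line, its
-- sign is constant and is absorbed, together with ε, into the choice of alternative.
theorem geodesicTorsion_eq_or_neg :
    (∀ s, geodesicTorsion α N c s = √(gaussCurvature α N (c s)) / meanCurvature α N (c s)
      * √(meanCurvature α N (c s) ^ 2 - gaussCurvature α N (c s))) ∨
    ∀ s, geodesicTorsion α N c s = -(√(gaussCurvature α N (c s)) / meanCurvature α N (c s)
      * √(meanCurvature α N (c s) ^ 2 - gaussCurvature α N (c s))) := by
  have hH : Continuous fun t => meanCurvature α N (c t) :=
    S.contMDiff_curvatures.2.continuous.comp hc.contMDiff.continuous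
  have h0 : ∀ t, meanCurvature α N (c t) ≠ 0 := fun t => S.mean_ne_zero (hc.regular t)
  have hform : ∀ t, geodesicTorsion α N c t = ε * (√(gaussCurvature α N (c t))
      / |meanCurvature α N (c t)| * √(meanCurvature α N (c t) ^ 2 - gaussCurvature α N (c t))) := by
    intro t
    rw [hc.geodesicTorsion_eq S hε, torsionFun, Real.sqrt_div' _ (sq_nonneg _), Real.sqrt_sq_eq_abs,
      Real.sqrt_mul (hc.regular t).1.le]
    ring
  have hsign : (∀ t, 0 < meanCurvature α N (c t)) ∨ ∀ t, meanCurvature α N (c t) < 0 := by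
    by_contra! h
    obtain ⟨⟨a, ha⟩, b, hb⟩ := h
    obtain ⟨t, ht⟩ := mem_range_of_exists_le_of_exists_ge hH ⟨a, ha⟩ ⟨b, hb⟩
    exact h0 t ht
  have hε' : ε = 1 ∨ ε = -1 := sq_eq_one_iff.1 hε
  rcases hsign with h | h <;> rcases hε' with h' | h'
  · left; intro s; rw [hform, h', abs_of_pos (h s), one_mul]
  · right; intro s; rw [hform, h', abs_of_pos (h s), neg_one_mul]
  · right; intro s; rw [hform, h', abs_of_neg (h s), one_mul, div_neg, neg_mul]
  · left; intro s; rw [hform, h', abs_of_neg (h s), neg_one_mul, div_neg, neg_mul, neg_neg]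

/-- Existence, uniqueness and derivative of the Poincaré map of a cycle. -/
theorem exists_poincareMap {L : ℝ} (hL : 0 < L) (hper : Function.Periodic c L)
    (hinj : InjOn c (Ico 0 L)) (hσ : IsCrossSection α c σ δ) :
    ∃ P : ℝ → ℝ, IsPoincareMap α N c σ δ P ∧
      HasDerivAt P (Real.exp (∫ s in (0 : ℝ)..L, returnIntegrand α N c s)) 0 ∧
      ∀ᶠ v in 𝓝 (0 : ℝ), ∀ w, FirstReturn α N c σ δ v w → w = P v := by
  -- The time interval exceeds the period on both sides: leaves must be defined around time 0, and
  -- the return may take longer than L.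
  obtain ⟨Θ, ρ, C, hU⟩ := exists_isUniformTube S hε hc (-1) (L + 1)
  have hcL : c L = c 0 := by simpa using hper 0
  have hTL : tangent α c L = tangent α c 0 := by simpa using tangent_periodic (α := α) hper 0
  obtain ⟨Ψ₀, hΨ₀⟩ := exists_isSectionChart S hε hc hσ (hU.tube 0 ⟨by norm_num, by linarith⟩) rfl rfl
  obtain ⟨Ψ, hΨ⟩ := exists_isSectionChart S hε hc hσ (hU.tube L ⟨by linarith, by linarith⟩) hcL hTL
  obtain ⟨A, hA, hret⟩ := exists_returnOrbit S hε hc hσ hL hinj hU hΨ₀ hΨ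
  have hret' : ∀ᶠ v in 𝓝 (0 : ℝ), ∃ w y T, IsReturnOrbit α N ε c σ δ Θ ρ (L + 1) v y T w ∧
      (∀ t ∈ Ico 0 (L + 1), ‖y t‖ ≤ A * |v|) ∧ Ψ (y T) = (T, w) ∧ Ψ₀ (y 0) = (0, v) := by
    filter_upwards [hret] with v ⟨y, T, w, h⟩ using ⟨w, y, T, h⟩
  obtain ⟨P, hP⟩ := hret'.choice
  refine ⟨P, ?_, ?_, ?_⟩
  · filter_upwards [hP] with v ⟨y, T, h, _⟩ using h.firstReturn S hε hc
  · rw [← returnWeight_ratio (ε := ε) hcL]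
    exact hasDerivAt_return S hε hc hL hU (hσ.inner_ne_zero S hc) hΨ₀ hΨ hA hP
  · filter_upwards [hP] with v ⟨y, T, h, _⟩ w hw
    exact h.eq_of_firstReturn S hε hc hU (by norm_num) hσ hw

end PoincareMap

end HarmonicLines

end

/-! ### The derivative of the Poincaré map of a closed line -/

theorem proposition3 {M : Type*} [TopologicalSpace M] [T2Space M]
    [ChartedSpace (EuclideanSpace ℝ (Fin 2)) M] [IsManifold (𝓡 2) ∞ M]
    (r : ℕ) (hr : 6 ≤ r)
    (α N : M → EuclideanSpace ℝ (Fin 3))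
    (hα : ContMDiff (𝓡 2) 𝓘(ℝ, EuclideanSpace ℝ (Fin 3)) r α)
    (himm : ∀ p : M,
      Function.Injective (mfderiv (𝓡 2) 𝓘(ℝ, EuclideanSpace ℝ (Fin 3)) α p))
    (hN : HarmonicLines.IsUnitNormal α N)
    (c : ℝ → M) (L : ℝ) (hc : HarmonicLines.IsHarmonicCycle α N c L)
    (σ : ℝ → M) (δ : ℝ) (hσ : HarmonicLines.IsCrossSection α c σ δ) :
    ((∀ s : ℝ, HarmonicLines.geodesicTorsion α N c s =
        Real.sqrt (HarmonicLines.gaussCurvature α N (c s))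
          / HarmonicLines.meanCurvature α N (c s)
          * Real.sqrt (HarmonicLines.meanCurvature α N (c s) ^ 2
              - HarmonicLines.gaussCurvature α N (c s))) ∨
      (∀ s : ℝ, HarmonicLines.geodesicTorsion α N c s =
        -(Real.sqrt (HarmonicLines.gaussCurvature α N (c s))
          / HarmonicLines.meanCurvature α N (c s)
          * Real.sqrt (HarmonicLines.meanCurvature α N (c s) ^ 2
              - HarmonicLines.gaussCurvature α N (c s))))) ∧
    IntervalIntegrable (HarmonicLines.returnIntegrand α N c) MeasureTheory.volume 0 L ∧
    (∃ P : ℝ → ℝ, HarmonicLines.IsPoincareMap α N c σ δ P) ∧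
    ∀ P : ℝ → ℝ, HarmonicLines.IsPoincareMap α N c σ δ P →
      DifferentiableAt ℝ P 0 ∧ 0 < deriv P 0 ∧
      Real.log (deriv P 0) = ∫ s in (0 : ℝ)..L, HarmonicLines.returnIntegrand α N c s := by
  have hα3 : ContMDiff (𝓡 2) 𝓘(ℝ, EuclideanSpace ℝ (Fin 3)) (3 : ℕ) α :=
    hα.of_le (by exact_mod_cast (by omega : 3 ≤ r))
  have S : HarmonicLines.IsOrientedImmersion α N :=
    ⟨hα3, hN.contMDiff hα3 himm, himm, hN.norm_eq_one, hN.orthogonal⟩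
  obtain ⟨ε, hε, hd⟩ := S.exists_isDirectedLine hc.isHarmonicLine
  obtain ⟨P₀, hP₀, hderiv, huniq⟩ := HarmonicLines.exists_poincareMap S hε hd hc.length_pos
    hc.periodic hc.injOn hσ
  refine ⟨HarmonicLines.geodesicTorsion_eq_or_neg S hε hd,
    (HarmonicLines.continuous_returnIntegrand S hε hd).intervalIntegrable _ _, ⟨P₀, hP₀⟩,
    fun P hP => ?_⟩
  -- First returns are unique near 0, so every Poincaré map has the germ of P₀ and hence its
  -- derivative.
  have hPP : P =ᶠ[nhds 0] P₀ := by
    filter_upwards [hP, huniq] with v h1 h2 using h2 _ h1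
  have h := hderiv.congr_of_eventuallyEq hPP
  rw [h.deriv]
  exact ⟨h.differentiableAt, Real.exp_pos _, Real.log_exp _⟩
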